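/- Let $N>1$ be an integer and let $b\in\mathbb C$ with $\operatorname{Re} b\neq 0$ and either $b\in\mathbb R$ or $|b|=1$ (equivalently $1+6(b+b^{-1})^2>1$). Indices $j$ of operators are taken in $\mathbb Z/2N$. On $L^2(\mathbb R^{2N})$ let $\mathsf q_j$ be multiplication by $x_j$ and $\mathsf p_j=(2\pi\mathsf i)^{-1}\partial/\partial x_j$; functions of real polynomials in the $\mathsf p_j,\mathsf q_j$ below are understood through the functional calculus of their self-adjoint closures from the Schwartz space. For a permutation $\sigma$ of $\mathbb Z/2N$ let $(\mathsf P_\sigma f)(x)=f((x_{\sigma(i)})_i)$. Put $$\varphi_b(z)=\exp\Big(\tfrac14\int_{\mathbb R+\mathsf i0}\frac{e^{-2\mathsf izw}\,dw}{\sinh(wb)\sinh(w/b)\,w}\Big),\qquad \zeta^x=e^{-\mathsf i\pi x(b+b^{-1})^2/12},$$ $$\mathsf A_k=e^{-\mathsf i\pi/3}e^{3\pi\mathsf i\mathsf q_k^2}e^{\mathsf i\pi(\mathsf p_k+\mathsf q_k)^2},\quad \mathsf T_{k,l}=e^{2\pi\mathsf i\mathsf p_k\mathsf q_l}\varphi_b(\mathsf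 q_k+\mathsf p_l-\mathsf q_l)^{-1},\quad \mathsf T_{k,\check l}=e^{-2\pi\mathsf i\mathsf p_k\mathsf p_l}\varphi_b(\mathsf q_k+\mathsf q_l)^{-1},$$ $$\mathsf D^{1/N}=\zeta^{-N-6/N}\,\mathsf P_{j\mapsto j+1}\prod_{k=1}^{2N}\mathsf A_k\prod_{l=1}^N\mathsf T_{2l+1,\check{2l}},\qquad \mathsf D=(\mathsf D^{1/N})^N .$$ Let $\mathcal A_N$ be the algebra generated by $\mathsf f_j$, $j\in\mathbb Z/2N$, with $[\mathsf f_m,\mathsf f_n]=(-1)^m(2\pi\mathsf i)^{-1}$ if $n=m\pm1$ and $0$ otherwise. Consider the annulus with $N$ marked points on each boundary component; its universal cover is a strip with marked points $b_n$ (bottom) and $t_n$ (top), $n\in\mathbb Z$, modulo $n\mapsto n+N$. Decorated ideal triangulations (up to isotopy) are those with $2N$ triangles labelled by $\mathbb Z/2N$, each with a distinguished corner; a triangle is written as its vertices in counterclockwise order, distinguished corner first. Let $\tau_N$ be the one with triangles $2m+1=(t_m,b_m,b_{m+1})$ and $2m+2=(b_{m+1},t_{m+1},t_m)$. The mapping classes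 $D^{1/N}$ and $D$ (the Dehn twist) fix the bottom boundary and shift the top boundary to the right by one, respectively $N$, spacings. In quantum Teichmüller theory a pair of decorated ideal triangulations is represented by operators $\mathsf F(\tau,\tau')$, up to phase, generated under $\mathsf F(\tau,\tau)\simeq1$, $\mathsf F(\tau,\tau')\mathsf F(\tau',\tau'')\simeq\mathsf F(\tau,\tau'')$ and $\mathsf F(\tau',\tau)\simeq\mathsf F(\tau,\tau')^{-1}$ by: $\mathsf P_\sigma$ for the relabelling $\tau'(k)=\tau(\sigma(k))$; $\mathsf A_i$ for moving the distinguished corner of triangle $i$ one step counterclockwise; $\mathsf T_{i,j}$, $i\ne j$, for the flip of $i=(L,B,U)$, $j=(B,R,U)$ to $i=(L,R,U)$, $j=(B,R,L)$. Then: 1. $\mathsf D^{1/N}$ is unitary, $\mathsf F(\tau_N,D^{1/N}(\tau_N))\simeq\mathsf D^{1/N}$, and $\mathsf F(\tau_N,D(\tau_N))\simeq\mathsf D$. 2. There is a realization $\kappa$ of $\mathcal A_N$ by operators on the Schwartz space of $\mathbb R^{2N}$ with $\kappa(\mathsf f_j)=\mathsf p_j+\mathsf p_{j-1}$ for $j$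 even and $\kappa(\mathsf f_j)=\mathsf q_j+\mathsf q_{j-1}$ for $j$ odd; the $\kappa(\mathsf f_j)$ are essentially self-adjoint, and $$\kappa(\mathsf G)=\zeta^{N+6/N}e^{2\pi\mathsf i\sum_{j=1}^N\mathsf p_{2j}\mathsf p_{2j+1}}\prod_{k=1}^{2N}\mathsf A_k^{-1}\,\mathsf P_{l\mapsto l-1}$$ is unitary and satisfies $\kappa(\mathsf G)\kappa(\mathsf f_j)=(-1)^j\kappa(\mathsf f_{j-1})\kappa(\mathsf G)$ (as self-adjoint operators, with domains). 3. For the light-cone evolution operator $\mathsf U_{lc}=\mathsf G\prod_{j=1}^N\varphi_b(\mathsf f_{2j})=\prod_{j=1}^N\varphi_b(\mathsf f_{2j-1})\,\mathsf G$ of the $2N$-periodic quantum discrete Liouville model, the images under $\kappa$ of both expressions coincide and $$\kappa(\mathsf U_{lc})=(\mathsf D^{1/N})^{-1},\qquad \kappa(\mathsf U_{lc})^N=\mathsf D^{-1}.$$ -/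

import Mathlib

open MeasureTheory
open scoped SchwartzMap LineDeriv

noncomputable section

namespace QuantumLiouville

/-! ## Hilbert space, Heisenberg operators, functional calculus -/

/-- Configuration space `ℝ^{2N}`, coordinates indexed by `ℤ/2N`. -/
abbrev Config (N : ℕ) : Type := EuclideanSpace ℝ (ZMod (2 * N))

/-- The Schwartz space of `ℝ^{2N}`, the common invariant core of all unbounded operators below. -/
abbrev Core (N : ℕ) [NeZero N] : Type := 𝓢(Config N, ℂ)

/-- The Hilbert space `L²(ℝ^{2N})`. -/
abbrev L2 (N : ℕ) [NeZero N] : Type := Lp (α := Config N) ℂ 2 volume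

/-- The position operator `q_j`: multiplication by the coordinate `x_j`. -/
def q {N : ℕ} [NeZero N] (j : ZMod (2 * N)) : Module.End ℂ (Core N) :=
  (SchwartzMap.smulLeftCLM ℂ (fun x : Config N => ((x j : ℝ) : ℂ))).toLinearMap

/-- The momentum operator `p_j = (2πi)⁻¹ ∂/∂x_j`. -/
def p {N : ℕ} [NeZero N] (j : ZMod (2 * N)) : Module.End ℂ (Core N) :=
  (2 * (Real.pi : ℂ) * Complex.I)⁻¹ •
    (LineDeriv.lineDerivOpCLM ℂ (Core N) (EuclideanSpace.single j (1 : ℝ))).toLinearMap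

/-- The inclusion of Schwartz functions into `L²`. -/
def coreIncl (N : ℕ) [NeZero N] : Core N →ₗ[ℂ] L2 N :=
  (SchwartzMap.toLpCLM ℂ (E := Config N) ℂ 2 volume).toLinearMap

theorem coreIncl_injective (N : ℕ) [NeZero N] : Function.Injective (coreIncl N) :=
  SchwartzMap.injective_toLp (E := Config N) (F := ℂ) 2 volume

/-- The closed operator in `L²(ℝ^{2N})` defined by an operator `T` on Schwartz functions: the
closure of `T` with domain the Schwartz space. -/
def closedOp {N : ℕ} [NeZero N] (T : Module.End ℂ (Core N)) : L2 N →ₗ.[ℂ] L2 N :=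
  LinearPMap.closure
    { domain := LinearMap.range (coreIncl N)
      toFun := coreIncl N ∘ₗ T ∘ₗ
        (LinearEquiv.ofInjective (coreIncl N) (coreIncl_injective N)).symm.toLinearMap }

/-- `B = g(A)` in the sense of the functional calculus of self-adjoint operators: some unitary map
`V` onto an `L²` space carries `A` to the operator of multiplication (with maximal domain) by a
real measurable function `a`, and carries `B` to multiplication by `g ∘ a`. -/
def IsFunctionOf {H : Type*} [NormedAddCommGroup H] [InnerProductSpace ℂ H]
    (A : H →ₗ.[ℂ] H) (g : ℝ → ℂ) (B : H →L[ℂ] H) : Prop :=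
  ∃ (X : Type) (_ : MeasurableSpace X) (μ : Measure X) (V : H ≃ₗᵢ[ℂ] Lp ℂ 2 μ) (a : X → ℝ),
    Measurable a ∧
    (∀ ψ χ : H, (ψ, χ) ∈ A.graph ↔
      (V χ : X → ℂ) =ᵐ[μ] fun x => ((a x : ℝ) : ℂ) * (V ψ : X → ℂ) x) ∧
    ∀ ψ : H, (V (B ψ) : X → ℂ) =ᵐ[μ] fun x => g (a x) * (V ψ : X → ℂ) x

open Classical in
/-- The bounded operator `g(A)`, where `A` is the closure of `T` (with the value `0` when there is
no such operator). -/
def fc {N : ℕ} [NeZero N] (g : ℝ → ℂ) (T : Module.End ℂ (Core N)) : L2 N →L[ℂ] L2 N :=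
  if h : ∃ B : L2 N →L[ℂ] L2 N, IsFunctionOf (closedOp T) g B then h.choose else 0

/-- The permutation operator `(P_σ f)(x) = f(i ↦ x_{σ(i)})`; it satisfies
`P_σ q_j P_σ⁻¹ = q_{σ(j)}` and `P_σ P_τ = P_{στ}`. -/
def P {N : ℕ} [NeZero N] (σ : Equiv.Perm (ZMod (2 * N))) : L2 N →L[ℂ] L2 N :=
  (Lp.compMeasurePreservingₗᵢ ℂ (LinearIsometryEquiv.piLpCongrLeft 2 ℝ ℝ σ.symm)
    (LinearIsometryEquiv.measurePreserving
      (LinearIsometryEquiv.piLpCongrLeft 2 ℝ ℝ σ.symm : Config N ≃ₗᵢ[ℝ] Config N))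
    ).toContinuousLinearMap

/-- The ordered product `F 1 * F 2 * ⋯ * F n`, from left to right. -/
def prodUpTo {M : Type*} [Monoid M] (n : ℕ) (F : ℕ → M) : M :=
  ((List.range n).map fun i => F (i + 1)).prod

/-! ## The noncompact quantum dilogarithm and the elementary operators -/

/-- A height at which the line `Im w = const` runs strictly between the pole `w = 0` and the
nonzero poles (of the form `iπn b^{±1}`) of the integrand of the quantum dilogarithm. By Cauchy's
theorem any smaller positive height defines the same integral, so this is the
contour `ℝ + i0`. -/
def contourHeight (b : ℂ) : ℝ := min |b.re| |(b⁻¹).re|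

/-- The noncompact quantum dilogarithm
`φ_b(z) = exp (1/4 ∫_{ℝ + i0} e^{-2izw} / (sinh(wb) sinh(w/b) w) dw)`. -/
def phi (b : ℂ) (z : ℝ) : ℂ :=
  Complex.exp ((1 / 4 : ℂ) * ∫ u : ℝ,
    (fun w : ℂ => Complex.exp (-2 * Complex.I * (z : ℂ) * w) /
      (Complex.sinh (w * b) * Complex.sinh (w / b) * w))
      ((u : ℂ) + (contourHeight b : ℂ) * Complex.I))

/-- The power `ζ^x` of `ζ = exp(-iπ(b + b⁻¹)²/12)`. -/
def zetaPow (b : ℂ) (x : ℝ) : ℂ :=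
  Complex.exp (-(Complex.I * (Real.pi : ℂ) * (b + b⁻¹) ^ 2 / 12) * (x : ℂ))

variable {N : ℕ} [NeZero N]

/-- `A_k = e^{-iπ/3} e^{3πi q_k²} e^{iπ(p_k + q_k)²}`. -/
def A (k : ZMod (2 * N)) : L2 N →L[ℂ] L2 N :=
  Complex.exp (-(Complex.I * (Real.pi : ℂ) / 3)) •
    (fc (fun x => Complex.exp (3 * (Real.pi : ℂ) * Complex.I * (x : ℂ) ^ 2)) (q k) *
      fc (fun x => Complex.exp ((Real.pi : ℂ) * Complex.I * (x : ℂ) ^ 2)) (p k + q k))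

/-- `T_{k,l} = e^{2πi p_k q_l} φ_b(q_k + p_l - q_l)⁻¹`. -/
def T (b : ℂ) (k l : ZMod (2 * N)) : L2 N →L[ℂ] L2 N :=
  fc (fun x => Complex.exp (2 * (Real.pi : ℂ) * Complex.I * (x : ℂ))) (p k * q l) *
    fc (fun x => (phi b x)⁻¹) (q k + p l - q l)

/-- `T_{k,ľ} = e^{-2πi p_k p_l} φ_b(q_k + q_l)⁻¹`. -/
def Tcheck (b : ℂ) (k l : ZMod (2 * N)) : L2 N →L[ℂ] L2 N :=
  fc (fun x => Complex.exp (-(2 * (Real.pi : ℂ) * Complex.I * (x : ℂ)))) (p k * p l) *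
    fc (fun x => (phi b x)⁻¹) (q k + q l)

variable (N) in
/-- The fractional Dehn twist operator
`D^{1/N} = ζ^{-N-6/N} P_{(…,j,j+1,…)} ∏_{k=1}^{2N} A_k ∏_{l=1}^N T_{2l+1,\check{2l}}`. -/
def fracDehnOp (b : ℂ) : L2 N →L[ℂ] L2 N :=
  zetaPow b (-(N : ℝ) - 6 / (N : ℝ)) •
    (P (Equiv.addRight (1 : ZMod (2 * N))) *
      prodUpTo (2 * N) (fun k => A (N := N) (k : ZMod (2 * N))) *
      prodUpTo N (fun l => Tcheck b (2 * (l : ZMod (2 * N)) + 1) (2 * (l : ZMod (2 * N)))))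

variable (N) in
/-- The Dehn twist operator `D = (D^{1/N})^N`. -/
def dehnOp (b : ℂ) : L2 N →L[ℂ] L2 N := fracDehnOp N b ^ N

/-! ## The quantum discrete Liouville system -/

variable (N) in
/-- The structure constants of the observable algebra: `[f_m, f_n] = commConst m n`. -/
def commConst (m n : ZMod (2 * N)) : ℂ :=
  if n = m + 1 ∨ n = m - 1 then (-1) ^ m.val * (2 * (Real.pi : ℂ) * Complex.I)⁻¹ else 0

/-- The defining relations of the observable algebra. -/
inductive ObsRel (N : ℕ) :
    FreeAlgebra ℂ (ZMod (2 * N)) → FreeAlgebra ℂ (ZMod (2 * N)) → Prop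
  | comm (m n : ZMod (2 * N)) :
      ObsRel N
        (FreeAlgebra.ι ℂ m * FreeAlgebra.ι ℂ n - FreeAlgebra.ι ℂ n * FreeAlgebra.ι ℂ m)
        (algebraMap ℂ _ (commConst N m n))

/-- The observable algebra: generators `f_j`, `j ∈ ℤ/2N`, with the above commutation relations. -/
abbrev ObsAlgebra (N : ℕ) : Type := RingQuot (ObsRel N)

/-- The generator `f_j`. -/
def f (j : ZMod (2 * N)) : ObsAlgebra N :=
  RingQuot.mkAlgHom ℂ (ObsRel N) (FreeAlgebra.ι ℂ j)

variable (N) in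
/-- The operator `κ(G) = ζ^{N+6/N} e^{2πi ∑_{j=1}^N p_{2j} p_{2j+1}} ∏_{k=1}^{2N} A_k⁻¹
P_{(…,l,l-1,…)}`. -/
def kappaG (b : ℂ) : L2 N →L[ℂ] L2 N :=
  zetaPow b ((N : ℝ) + 6 / (N : ℝ)) •
    (fc (fun x => Complex.exp (2 * (Real.pi : ℂ) * Complex.I * (x : ℂ)))
        (∑ j ∈ Finset.Icc 1 N,
          p (N := N) (2 * (j : ZMod (2 * N))) * p (2 * (j : ZMod (2 * N)) + 1)) *
      prodUpTo (2 * N) (fun k => Ring.inverse (A (N := N) (k : ZMod (2 * N)))) *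
      P (Equiv.subRight (1 : ZMod (2 * N))))

/-- The image of `U_lc = G ∏_{j=1}^N φ_b(f_{2j})` under a realization `κ` of the `f_j` and `κG`
of `G`. -/
def evolEven (b : ℂ) (κ : ObsAlgebra N →ₐ[ℂ] Module.End ℂ (Core N)) (κG : L2 N →L[ℂ] L2 N) :
    L2 N →L[ℂ] L2 N :=
  κG * prodUpTo N (fun j => fc (phi b) (κ (f (2 * (j : ZMod (2 * N))))))

/-- The image of `U_lc = ∏_{j=1}^N φ_b(f_{2j-1}) G` under a realization `κ` of the `f_j` and `κG`
of `G`. -/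
def evolOdd (b : ℂ) (κ : ObsAlgebra N →ₐ[ℂ] Module.End ℂ (Core N)) (κG : L2 N →L[ℂ] L2 N) :
    L2 N →L[ℂ] L2 N :=
  prodUpTo N (fun j => fc (phi b) (κ (f (2 * (j : ZMod (2 * N)) - 1)))) * κG

/-! ## Decorated ideal triangulations of the annulus

The universal cover of the annulus with `N` marked points on each boundary component is the strip
`ℝ × [0,1]` with marked points at the integers of both boundary lines; the deck group is generated
by the horizontal translation by `N`. An isotopy class of ideal triangles in the strip is
determined by the three vertices. -/

/-- Marked points of the strip. -/
inductive MarkedPoint : Type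
  | bot (n : ℤ) : MarkedPoint
  | top (n : ℤ) : MarkedPoint

namespace MarkedPoint

/-- The boundary order of the strip, counterclockwise starting at the left end. -/
def Before : MarkedPoint → MarkedPoint → Prop
  | bot m, bot n => m < n
  | bot _, top _ => True
  | top _, bot _ => False
  | top m, top n => n < m

/-- Three distinct marked points in counterclockwise cyclic order. -/
def CCW (x y z : MarkedPoint) : Prop :=
  (Before x y ∧ Before y z) ∨ (Before y z ∧ Before z x) ∨ (Before z x ∧ Before x y)

/-- Horizontal translation by `k`. -/
def shift (k : ℤ) : MarkedPoint → MarkedPoint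
  | bot n => bot (n + k)
  | top n => top (n + k)

/-- Rotation of the top boundary with respect to the bottom by `k` spacings to the right
(the action on marked points of the homeomorphism `(x, y) ↦ (x + k y, y)` of the strip). -/
def rotateTop (k : ℤ) : MarkedPoint → MarkedPoint
  | bot n => bot n
  | top n => top (n + k)

theorem before_rotateTop (k : ℤ) (x y : MarkedPoint) :
    Before (rotateTop k x) (rotateTop k y) ↔ Before x y := by
  cases x <;> cases y <;> simp [rotateTop, Before]

theorem ccw_rotateTop (k : ℤ) (x y z : MarkedPoint) :
    CCW (rotateTop k x) (rotateTop k y) (rotateTop k z) ↔ CCW x y z := by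
  simp [CCW, before_rotateTop]

theorem rotateTop_shift (k l : ℤ) (x : MarkedPoint) :
    rotateTop k (shift l x) = shift l (rotateTop k x) := by
  cases x <;> simp [rotateTop, shift]; ring

theorem rotateTop_neg (k : ℤ) (x : MarkedPoint) : rotateTop k (rotateTop (-k) x) = x := by
  cases x <;> simp [rotateTop]

theorem rotateTop_neg' (k : ℤ) (x : MarkedPoint) : rotateTop (-k) (rotateTop k x) = x := by
  cases x <;> simp [rotateTop]

theorem rotateTop_inj (k : ℤ) (x y : MarkedPoint) :
    rotateTop k x = rotateTop k y ↔ x = y :=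
  ⟨fun h => by rw [← rotateTop_neg' k x, h, rotateTop_neg'], fun h => by rw [h]⟩

end MarkedPoint

open MarkedPoint

/-- A decorated ideal triangle of the strip: its vertices in counterclockwise order, starting with
the distinguished corner. -/
abbrev Triple : Type := Fin 3 → MarkedPoint

/-- The ideal triangles `s` and `t` have disjoint interiors: all vertices of `t` are on the outer
side of some edge of `s`. -/
def InteriorsDisjoint (s t : Triple) : Prop :=
  ∃ i : Fin 3, ∀ j : Fin 3, t j = s i ∨ t j = s (i + 1) ∨ CCW (s i) (t j) (s (i + 1))

/-- Two decorated triangles of the strip cover the same triangle of the annulus. -/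
def deckSetoid (N : ℕ) : Setoid Triple where
  r s t := ∃ k : ℤ, ∀ i, t i = shift (N * k) (s i)
  iseqv :=
    { refl := fun s => ⟨0, fun i => by cases h : s i <;> simp [shift]⟩
      symm := by
        rintro s t ⟨k, h⟩
        refine ⟨-k, fun i => ?_⟩
        rw [h i]
        cases s i <;> simp [shift]
      trans := by
        rintro s t u ⟨k, h⟩ ⟨l, h'⟩
        refine ⟨k + l, fun i => ?_⟩
        rw [h' i, h i]
        cases s i <;> simp [shift] <;> ring }

/-- Decorated triangles in the annulus, up to isotopy, as deck orbits of triples. -/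
def AnnTriangle (N : ℕ) : Type := Quotient (deckSetoid N)

/-- The image in the annulus of a decorated triangle of the strip. -/
def toAnn (N : ℕ) (s : Triple) : AnnTriangle N := Quotient.mk (deckSetoid N) s

/-- The action of the rotation of the top boundary on decorated triangles of the annulus. -/
def AnnTriangle.rotateTop {N : ℕ} (k : ℤ) : AnnTriangle N → AnnTriangle N :=
  Quotient.map (sa := deckSetoid N) (sb := deckSetoid N)
    (fun s i => MarkedPoint.rotateTop k (s i))
    (by
      rintro s t ⟨l, h⟩
      exact ⟨l, fun i => by simp only [h i, rotateTop_shift]⟩)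

/-- A decorated ideal triangulation of the annulus (up to isotopy): `2N` labelled decorated
triangles, all of whose lifts to the strip have pairwise disjoint interiors. (Every ideal
triangulation of this annulus has `2N` triangles and `2N` triangles with disjoint interiors
fill it.) -/
@[ext] structure DecTriangulation (N : ℕ) where
  tri : ZMod (2 * N) → AnnTriangle N
  ccw : ∀ k s, toAnn N s = tri k → CCW (s 0) (s 1) (s 2)
  disjoint : ∀ k l s t, toAnn N s = tri k → toAnn N t = tri l → (k ≠ l ∨ s ≠ t) →
    InteriorsDisjoint s t

theorem toAnn_eq_rotateTop {N : ℕ} (m : ℤ) (s : Triple) (c : AnnTriangle N)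
    (h : toAnn N s = c.rotateTop m) :
    toAnn N (fun i => MarkedPoint.rotateTop (-m) (s i)) = c := by
  induction c using Quotient.inductionOn with
  | h u =>
    obtain ⟨l, hl⟩ := Quotient.exact (s := deckSetoid N) h
    refine Quotient.sound (s := deckSetoid N) ⟨l, fun i => ?_⟩
    have := hl i
    simp only at this
    rw [← rotateTop_shift, ← this, rotateTop_neg']

/-- The image of a decorated ideal triangulation under the mapping class of the annulus that
rotates the top boundary by `m` spacings to the right: `m = 1` is the fractional Dehn twist
`D^{1/N}`, and `m = N`, a full turn, is the Dehn twist `D`. -/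
def DecTriangulation.rotateTop {N : ℕ} (m : ℤ) (τ : DecTriangulation N) : DecTriangulation N where
  tri k := (τ.tri k).rotateTop m
  ccw k s h := by
    have := τ.ccw k _ (toAnn_eq_rotateTop m s _ h)
    rwa [ccw_rotateTop] at this
  disjoint k l s t hs ht hne := by
    have hne' : k ≠ l ∨ (fun i => MarkedPoint.rotateTop (-m) (s i)) ≠
        (fun i => MarkedPoint.rotateTop (-m) (t i)) := by
      refine hne.imp id fun h h' => h (funext fun i => ?_)
      exact (rotateTop_inj (-m) _ _).1 (congrFun h' i)
    obtain ⟨i, hi⟩ := τ.disjoint k l _ _ (toAnn_eq_rotateTop m s _ hs)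
      (toAnn_eq_rotateTop m t _ ht) hne'
    refine ⟨i, fun j => ?_⟩
    simpa only [rotateTop_inj, ccw_rotateTop] using hi j

/-- The lift of the standard triangulation: the square with lower left corner `m` is cut by the
diagonal from its upper left to its lower right corner; the lower triangle has number `2m+1` and
is marked at `top m`, the upper one has number `2m+2` and is marked at `bot (m+1)`. -/
def stdLift (n : ℤ) : Triple :=
  if n % 2 = 1 then ![.top (n / 2), .bot (n / 2), .bot (n / 2 + 1)]
  else ![.bot (n / 2), .top (n / 2), .top (n / 2 - 1)]

theorem stdLift_odd (m : ℤ) : stdLift (2 * m + 1) = ![.top m, .bot m, .bot (m + 1)] := by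
  have h1 : (2 * m + 1) % 2 = 1 := by omega
  have h2 : (2 * m + 1) / 2 = m := by omega
  simp [stdLift, h1, h2]

theorem stdLift_even (m : ℤ) : stdLift (2 * m) = ![.bot m, .top m, .top (m - 1)] := by
  have h2 : (2 * m) / 2 = m := by omega
  simp [stdLift, h2]

theorem stdLift_shift (N : ℕ) (n k : ℤ) (i : Fin 3) :
    shift (N * k) (stdLift n i) = stdLift (n + 2 * N * k) i := by
  obtain ⟨m, rfl | rfl⟩ : ∃ m, n = 2 * m ∨ n = 2 * m + 1 := ⟨n / 2, by omega⟩
  · rw [show 2 * m + 2 * N * k = 2 * (m + N * k) by ring, stdLift_even, stdLift_even]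
    fin_cases i <;> simp [shift]; ring
  · rw [show 2 * m + 1 + 2 * N * k = 2 * (m + N * k) + 1 by ring, stdLift_odd, stdLift_odd]
    fin_cases i <;> simp [shift]; ring

theorem stdLift_ccw (n : ℤ) : CCW (stdLift n 0) (stdLift n 1) (stdLift n 2) := by
  obtain ⟨m, rfl | rfl⟩ : ∃ m, n = 2 * m ∨ n = 2 * m + 1 := ⟨n / 2, by omega⟩
  · rw [stdLift_even]; simp [CCW, Before]
  · rw [stdLift_odd]; simp [CCW, Before]

theorem stdLift_disjoint (n n' : ℤ) (h : n ≠ n') :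
    InteriorsDisjoint (stdLift n) (stdLift n') := by
  obtain ⟨m, rfl | rfl⟩ : ∃ m, n = 2 * m ∨ n = 2 * m + 1 := ⟨n / 2, by omega⟩ <;>
  obtain ⟨m', rfl | rfl⟩ : ∃ m, n' = 2 * m ∨ n' = 2 * m + 1 := ⟨n' / 2, by omega⟩
  · rcases lt_or_gt_of_ne (show m ≠ m' by omega) with h' | h'
    · refine ⟨0, fun j => ?_⟩
      rw [stdLift_even, stdLift_even]
      fin_cases j <;> simp [CCW, Before] <;> omega
    · refine ⟨2, fun j => ?_⟩
      rw [stdLift_even, stdLift_even]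
      fin_cases j <;> simp [CCW, Before] <;> omega
  · rcases lt_or_ge m' m with h' | h'
    · refine ⟨2, fun j => ?_⟩
      rw [stdLift_even, stdLift_odd]
      fin_cases j <;> simp [CCW, Before] <;> omega
    · refine ⟨0, fun j => ?_⟩
      rw [stdLift_even, stdLift_odd]
      fin_cases j <;> simp [CCW, Before] <;> omega
  · rcases lt_or_ge m m' with h' | h'
    · refine ⟨2, fun j => ?_⟩
      rw [stdLift_even, stdLift_odd]
      fin_cases j <;> simp [CCW, Before] <;> omega
    · refine ⟨0, fun j => ?_⟩
      rw [stdLift_even, stdLift_odd]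
      fin_cases j <;> simp [CCW, Before] <;> omega
  · rcases lt_or_gt_of_ne (show m ≠ m' by omega) with h' | h'
    · refine ⟨2, fun j => ?_⟩
      rw [stdLift_odd, stdLift_odd]
      fin_cases j <;> simp [CCW, Before] <;> omega
    · refine ⟨0, fun j => ?_⟩
      rw [stdLift_odd, stdLift_odd]
      fin_cases j <;> simp [CCW, Before] <;> omega

theorem lift_of_toAnn {N : ℕ} (s : Triple) (n : ℤ) (h : toAnn N s = toAnn N (stdLift n)) :
    ∃ k : ℤ, s = stdLift (n + 2 * N * k) := by
  obtain ⟨k, hk⟩ := Quotient.exact (s := deckSetoid N) h.symm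
  exact ⟨k, funext fun i => by rw [hk i, stdLift_shift]⟩

variable (N) in
/-- The standard decorated ideal triangulation `τ_N` of the annulus. -/
def stdTriangulation : DecTriangulation N where
  tri k := toAnn N (stdLift k.val)
  ccw k s h := by
    obtain ⟨l, rfl⟩ := lift_of_toAnn s _ h
    exact stdLift_ccw _
  disjoint k l s t hs ht hne := by
    obtain ⟨a, rfl⟩ := lift_of_toAnn s _ hs
    obtain ⟨c, rfl⟩ := lift_of_toAnn t _ ht
    refine stdLift_disjoint _ _ fun h => ?_
    rcases hne with hne | hne
    · apply hne
      have h2 := congrArg (fun n : ℤ => (n : ZMod (2 * N))) h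
      have h0 : (2 * (N : ZMod (2 * N))) = 0 := by exact_mod_cast ZMod.natCast_self (2 * N)
      simpa [h0] using h2
    · exact hne (by rw [h])

/-! ## Quantum Teichmüller theory of the annulus -/

/-- `Quantizes b τ τ' X`: the operator `X` represents, up to a phase, the change of decorated
ideal triangulation from `τ` to `τ'` in quantum Teichmüller theory, `F(τ, τ') ≃ X`. It is generated
by the three elementary transformations:
* relabelling by `σ` is represented by `P_σ`;
* `ρ_i`, moving the distinguished corner of the triangle `i` one step counterclockwise, is
  represented by `A_i`;
* `ω_{ij}`, the flip of the common edge `BT` of the triangles `i = (L,B,T)` and `j = (B,R,T)` to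
  `i = (L,R,T)` and `j = (B,R,L)` (distinguished corners first), is represented by `T_{ij}`;
together with `F(τ, τ) ≃ 1`, `F(τ, τ') F(τ', τ'') ≃ F(τ, τ'')` and `F(τ', τ) ≃ F(τ, τ')⁻¹`. -/
inductive Quantizes (b : ℂ) :
    DecTriangulation N → DecTriangulation N → (L2 N →L[ℂ] L2 N) → Prop
  | relabel (τ τ' : DecTriangulation N) (σ : Equiv.Perm (ZMod (2 * N)))
      (h : ∀ k, τ'.tri k = τ.tri (σ k)) : Quantizes b τ τ' (P σ)
  | rho (τ τ' : DecTriangulation N) (i : ZMod (2 * N)) (s : Triple)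
      (h : τ.tri i = toAnn N s)
      (h' : τ'.tri = Function.update τ.tri i (toAnn N ![s 1, s 2, s 0])) :
      Quantizes b τ τ' (A i)
  | omega (τ τ' : DecTriangulation N) (i j : ZMod (2 * N)) (hij : i ≠ j)
      (L B R U : MarkedPoint)
      (hi : τ.tri i = toAnn N ![L, B, U]) (hj : τ.tri j = toAnn N ![B, R, U])
      (h' : τ'.tri = Function.update (Function.update τ.tri i (toAnn N ![L, R, U])) j
        (toAnn N ![B, R, L])) :
      Quantizes b τ τ' (T b i j)
  | refl (τ : DecTriangulation N) : Quantizes b τ τ 1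
  | trans (τ τ' τ'' : DecTriangulation N) (X Y : L2 N →L[ℂ] L2 N)
      (hX : Quantizes b τ τ' X) (hY : Quantizes b τ' τ'' Y) : Quantizes b τ τ'' (X * Y)
  | symm (τ τ' : DecTriangulation N) (X : L2 N →L[ℂ] L2 N)
      (hX : Quantizes b τ τ' X) : Quantizes b τ' τ (Ring.inverse X)
  | phase (τ τ' : DecTriangulation N) (X : L2 N →L[ℂ] L2 N) (c : ℂ) (hc : ‖c‖ = 1)
      (hX : Quantizes b τ τ' X) : Quantizes b τ τ' (c • X)

end QuantumLiouville

end

/-!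
Apart from the factors `φ_b`, every factor of the operators in question is a unitary operator that
preserves the Schwartz space and acts on the `p_j` and `q_j` by a linear substitution, and a
function of a self-adjoint operator is transported by unitary conjugation. All the operator
identities thereby reduce to identities between linear substitutions and scalars; for instance,
conjugating `T_{k,l}` by `A_l` gives `Tcheck_{k,l}`.

On the side of triangulations, the same conjugation says that moving a corner, flipping and moving
the corner back gives a flip with different corners. The twist `D^{1/N}` of `τ_N` is a relabelling
followed by a move of all the distinguished corners and by `N` flips of this kind. Since a rotation
of the top boundary carries elementary moves to elementary moves, iterating `D^{1/N}` gives `D`.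
-/

noncomputable section

namespace QuantumLiouville

/-! ## Multiplication operators on `L²` -/

section Multiplication

variable {X Y : Type*} [MeasurableSpace X] [MeasurableSpace Y]

variable (X) in
/-- The `⋆`-algebra of bounded measurable functions. Functions are not identified almost everywhere,
so that they can be composed with arbitrary measurable maps. -/
def boundedMeasurable : StarSubalgebra ℂ (X → ℂ) where
  carrier := {g | Measurable g ∧ ∃ C, ∀ x, ‖g x‖ ≤ C}
  mul_mem' := by
    rintro g h ⟨hg, C, hC⟩ ⟨hh, D, hD⟩
    exact ⟨hg.mul hh, C * D, fun x => (norm_mul_le _ _).trans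
      (mul_le_mul (hC x) (hD x) (norm_nonneg _) ((norm_nonneg _).trans (hC x)))⟩
  add_mem' := by
    rintro g h ⟨hg, C, hC⟩ ⟨hh, D, hD⟩
    exact ⟨hg.add hh, C + D, fun x => norm_add_le_of_le (hC x) (hD x)⟩
  algebraMap_mem' r := ⟨measurable_const, ‖r‖, fun _ => le_rfl⟩
  star_mem' := by
    rintro g ⟨hg, C, hC⟩
    exact ⟨continuous_star.measurable.comp hg, C, fun x => (norm_star _).trans_le (hC x)⟩

namespace boundedMeasurable

/-- A measurable function of modulus one as a bounded measurable function. -/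
def ofNormEqOne (g : X → ℂ) (hg : Measurable g) (h1 : ∀ x, ‖g x‖ = 1) : boundedMeasurable X :=
  ⟨g, hg, 1, fun x => (h1 x).le⟩

theorem ofNormEqOne_mem_unitary {g : X → ℂ} (hg : Measurable g) (h1 : ∀ x, ‖g x‖ = 1) :
    ofNormEqOne g hg h1 ∈ unitary (boundedMeasurable X) := by
  have h : ∀ x, star (g x) * g x = 1 := fun x => by
    rw [RCLike.star_def, Complex.conj_mul', h1, Complex.ofReal_one, one_pow]
  exact ⟨Subtype.ext (funext h), Subtype.ext (funext fun x => (mul_comm _ _).trans (h x))⟩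

/-- Precomposition with a measurable map. -/
def comp (a : X → Y) (ha : Measurable a) : boundedMeasurable Y →⋆ₐ[ℂ] boundedMeasurable X where
  toFun g := ⟨fun x => g.1 (a x), g.2.1.comp ha, g.2.2.imp fun _ h x => h (a x)⟩
  map_one' := rfl
  map_mul' _ _ := rfl
  map_zero' := rfl
  map_add' _ _ := rfl
  commutes' _ := rfl
  map_star' _ := rfl

/-- Bounded continuous functions are bounded and measurable. -/
def ofContinuous [TopologicalSpace X] [OpensMeasurableSpace X] :
    BoundedContinuousFunction X ℂ →⋆ₐ[ℂ] boundedMeasurable X where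
  toFun h := ⟨h, h.continuous.measurable, ‖h‖, h.norm_coe_le_norm⟩
  map_one' := rfl
  map_mul' _ _ := rfl
  map_zero' := rfl
  map_add' _ _ := rfl
  commutes' _ := rfl
  map_star' _ := rfl

variable (μ : Measure X)

theorem memLp_top_coe (g : boundedMeasurable X) : MemLp g.1 ⊤ μ :=
  memLp_top_of_bound g.2.1.aestronglyMeasurable g.2.2.choose
    (Filter.Eventually.of_forall g.2.2.choose_spec)

/-- Multiplication by a bounded measurable function, as an operator on `L²`. -/
def mulOp (g : boundedMeasurable X) : Lp ℂ 2 μ →L[ℂ] Lp ℂ 2 μ :=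
  (ContinuousLinearMap.mul ℂ ℂ).holderL μ ⊤ 2 2 ((memLp_top_coe μ g).toLp g.1)

variable {μ}

theorem coeFn_mulOp (g : boundedMeasurable X) (u : Lp ℂ 2 μ) :
    mulOp μ g u =ᵐ[μ] fun x => g.1 x * u x := by
  filter_upwards [(ContinuousLinearMap.mul ℂ ℂ).coeFn_holder (r := 2)
    ((memLp_top_coe μ g).toLp g.1) u, (memLp_top_coe μ g).coeFn_toLp] with x h1 h2
  rw [← h2]
  exact h1

theorem eq_mulOp_iff {g : boundedMeasurable X} {u v : Lp ℂ 2 μ} :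
    v = mulOp μ g u ↔ v =ᵐ[μ] fun x => g.1 x * u x :=
  ⟨fun h => h ▸ coeFn_mulOp g u, fun h => Lp.ext (h.trans (coeFn_mulOp g u).symm)⟩

theorem mulOp_one : mulOp μ (1 : boundedMeasurable X) = 1 :=
  ContinuousLinearMap.ext fun u => (eq_mulOp_iff.2 (by simp)).symm

theorem mulOp_mul (g h : boundedMeasurable X) : mulOp μ (g * h) = mulOp μ g * mulOp μ h :=
  ContinuousLinearMap.ext fun u => Eq.symm <| eq_mulOp_iff.2 <| by
    filter_upwards [coeFn_mulOp g (mulOp μ h u), coeFn_mulOp h u] with x h1 h2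
    simp [h1, h2, mul_assoc]

theorem mulOp_add (g h : boundedMeasurable X) : mulOp μ (g + h) = mulOp μ g + mulOp μ h :=
  ContinuousLinearMap.ext fun u => Eq.symm <| eq_mulOp_iff.2 <| by
    filter_upwards [coeFn_mulOp g u, coeFn_mulOp h u,
      Lp.coeFn_add (mulOp μ g u) (mulOp μ h u)] with x h1 h2 h3
    exact (h3.trans (congrArg₂ (· + ·) h1 h2)).trans (add_mul _ _ _).symm

theorem mulOp_algebraMap (r : ℂ) :
    mulOp μ (algebraMap ℂ (boundedMeasurable X) r) = algebraMap ℂ _ r :=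
  ContinuousLinearMap.ext fun u => Eq.symm <| eq_mulOp_iff.2 <| by
    filter_upwards [Lp.coeFn_smul r u] with x h
    simpa [Algebra.algebraMap_eq_smul_one] using h

theorem mulOp_star (g : boundedMeasurable X) : mulOp μ (star g) = star (mulOp μ g) := by
  refine (ContinuousLinearMap.eq_adjoint_iff _ _).2 fun u v => ?_
  rw [L2.inner_def, L2.inner_def]
  refine integral_congr_ae ?_
  filter_upwards [coeFn_mulOp (star g) u, coeFn_mulOp g v] with x h1 h2
  rw [h1, h2]
  simp only [StarMemClass.coe_star, Pi.star_apply, RCLike.star_def, RCLike.inner_apply, map_mul,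
    RingHomCompTriple.comp_apply, RingHom.id_apply]
  ring

variable (μ) in
/-- The representation of the bounded measurable functions by multiplication operators on `L²`. -/
def mulRep : boundedMeasurable X →⋆ₐ[ℂ] (Lp ℂ 2 μ →L[ℂ] Lp ℂ 2 μ) where
  toFun := mulOp μ
  map_one' := mulOp_one
  map_mul' := mulOp_mul
  map_zero' := by simpa using mulOp_algebraMap (μ := μ) (0 : ℂ)
  map_add' := mulOp_add
  commutes' := mulOp_algebraMap
  map_star' := mulOp_star

end boundedMeasurable

open boundedMeasurable

theorem ofReal_sub_ne_zero {z : ℂ} (hz : z.im ≠ 0) (t : ℝ) : (t : ℂ) - z ≠ 0 := fun h =>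
  hz (by simpa using congrArg Complex.im h)

/-- The bounded continuous function `t ↦ (t - z)⁻¹`. -/
def resolventFun (z : ℂ) (hz : z.im ≠ 0) : BoundedContinuousFunction ℝ ℂ :=
  BoundedContinuousFunction.ofNormedAddCommGroup (fun t : ℝ => ((t : ℂ) - z)⁻¹)
    (Continuous.inv₀ (by fun_prop) (ofReal_sub_ne_zero hz)) |z.im|⁻¹ fun t => by
      rw [norm_inv]
      refine inv_anti₀ (abs_pos.2 hz) ?_
      simpa using Complex.abs_im_le_norm ((t : ℂ) - z)

variable (μ : Measure X) {a : X → ℝ} {c : Y → ℝ} {z : ℂ}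

/-- The resolvent `(a - z)⁻¹` of the operator of multiplication by `a`. -/
def mulResolvent (ha : Measurable a) (z : ℂ) (hz : z.im ≠ 0) : Lp ℂ 2 μ →L[ℂ] Lp ℂ 2 μ :=
  mulRep μ (comp a ha (ofContinuous (resolventFun z hz)))

variable {μ}

theorem eq_mulResolvent_iff {ha : Measurable a} {hz : z.im ≠ 0} {u v : Lp ℂ 2 μ} :
    v = mulResolvent μ ha z hz u ↔ v =ᵐ[μ] fun x => ((a x : ℂ) - z)⁻¹ * u x :=
  eq_mulOp_iff

theorem star_mulResolvent (ha : Measurable a) (hz : z.im ≠ 0) :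
    star (mulResolvent μ ha z hz) = mulResolvent μ ha (star z) (by simpa using hz) := by
  rw [mulResolvent, ← map_star, ← map_star, ← map_star]
  refine congrArg (fun h => mulRep μ (comp a ha (ofContinuous h)))
    (BoundedContinuousFunction.ext fun t => ?_)
  simp [resolventFun]

theorem ae_eq_mul_iff_eq_mulResolvent (ha : Measurable a) (hz : z.im ≠ 0) (u v : Lp ℂ 2 μ) :
    (v =ᵐ[μ] fun x => (a x : ℂ) * u x) ↔ u = mulResolvent μ ha z hz (v - z • u) := by
  rw [eq_mulResolvent_iff]
  have hsub : ⇑(v - z • u) =ᵐ[μ] fun x => v x - z * u x := by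
    filter_upwards [Lp.coeFn_sub v (z • u), Lp.coeFn_smul z u] with x h1 h2
    rw [h1, Pi.sub_apply, h2, Pi.smul_apply, smul_eq_mul]
  constructor <;> intro h <;> filter_upwards [h, hsub] with x h1 h2 <;>
    have h0 := ofReal_sub_ne_zero hz (a x)
  · rw [h2, eq_inv_mul_iff_mul_eq₀ h0, h1]
    ring
  · rw [h2, eq_inv_mul_iff_mul_eq₀ h0] at h1
    linear_combination -h1

theorem ae_eq_mul_mulResolvent (ha : Measurable a) (hz : z.im ≠ 0) (w : Lp ℂ 2 μ) :
    ⇑(w + z • mulResolvent μ ha z hz w) =ᵐ[μ]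
      fun x => (a x : ℂ) * mulResolvent μ ha z hz w x := by
  rw [ae_eq_mul_iff_eq_mulResolvent ha hz, add_sub_cancel_right]

theorem inner_mul_eq_inner_mul {u u' v v' : Lp ℂ 2 μ} (h : v =ᵐ[μ] fun x => (a x : ℂ) * u x)
    (h' : v' =ᵐ[μ] fun x => (a x : ℂ) * u' x) : inner ℂ v u' = inner ℂ u v' := by
  rw [L2.inner_def, L2.inner_def]
  refine integral_congr_ae ?_
  filter_upwards [h, h'] with x h1 h2
  simp only [h1, h2, RCLike.inner_apply, map_mul, Complex.conj_ofReal]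
  ring

end Multiplication

/-! ## Uniqueness of the functional calculus -/

section SpectralMeasure

variable {X Y : Type*} [MeasurableSpace X] [MeasurableSpace Y] {μ : Measure X} {ν : Measure Y}
  {a : X → ℝ} {c : Y → ℝ}

open boundedMeasurable

/-- The spectral measure of the operator of multiplication by `a` at the vector `u`. -/
def spectralMeasure (a : X → ℝ) (u : Lp ℂ 2 μ) : Measure ℝ :=
  (μ.withDensity fun x => ((‖u x‖₊ ^ 2 : NNReal) : ENNReal)).map a

instance isFiniteMeasure_spectralMeasure (a : X → ℝ) (u : Lp ℂ 2 μ) :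
    IsFiniteMeasure (spectralMeasure a u) := by
  have : IsFiniteMeasure (μ.withDensity fun x => ((‖u x‖₊ ^ 2 : NNReal) : ENNReal)) := by
    refine isFiniteMeasure_withDensity ?_
    have h := (Lp.memLp u).eLpNorm_lt_top
    rw [eLpNorm_lt_top_iff_lintegral_rpow_enorm_lt_top (by simp) (by simp)] at h
    simpa [enorm_eq_nnnorm] using h.ne
  unfold spectralMeasure
  infer_instance

theorem inner_eq_integral_spectralMeasure (ha : Measurable a) {h : ℝ → ℂ} (hh : Measurable h)
    {u v : Lp ℂ 2 μ} (hv : v =ᵐ[μ] fun x => h (a x) * u x) :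
    inner ℂ u v = ∫ t, h t ∂(spectralMeasure a u) := by
  have hu : Measurable fun x => ‖u x‖₊ ^ 2 :=
    (Lp.stronglyMeasurable u).measurable.nnnorm.pow_const 2
  rw [spectralMeasure, integral_map ha.aemeasurable hh.aestronglyMeasurable,
    integral_withDensity_eq_integral_smul hu, L2.inner_def]
  refine integral_congr_ae ?_
  filter_upwards [hv] with x hx
  rw [hx, RCLike.inner_apply, mul_assoc, RCLike.mul_conj, NNReal.smul_def]
  simp [mul_comm]

/-- `W` carries multiplication by `a`, with its maximal domain, to multiplication by `c`. -/
def CarriesMul (W : Lp ℂ 2 μ ≃ₗᵢ[ℂ] Lp ℂ 2 ν) (a : X → ℝ) (c : Y → ℝ) : Prop :=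
  ∀ u v : Lp ℂ 2 μ, (v =ᵐ[μ] fun x => (a x : ℂ) * u x) ↔ W v =ᵐ[ν] fun y => (c y : ℂ) * W u y

variable (W : Lp ℂ 2 μ ≃ₗᵢ[ℂ] Lp ℂ 2 ν)

/-- The bounded continuous functions `h` such that `W` carries `h ∘ a` to `h ∘ c`. -/
def carriedSubalgebra (ha : Measurable a) (hc : Measurable c) :
    StarSubalgebra ℂ (BoundedContinuousFunction ℝ ℂ) :=
  StarAlgHom.equalizer
    ((W.conjStarAlgEquiv : _ →⋆ₐ[ℂ] _).comp ((mulRep μ).comp ((comp a ha).comp ofContinuous)))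
    ((mulRep ν).comp ((comp c hc).comp ofContinuous))

variable {W}

theorem mem_carriedSubalgebra_iff {ha : Measurable a} {hc : Measurable c}
    {h : BoundedContinuousFunction ℝ ℂ} :
    h ∈ carriedSubalgebra W ha hc ↔
      ∀ u, W (mulRep μ (comp a ha (ofContinuous h)) u) =
        mulRep ν (comp c hc (ofContinuous h)) (W u) := by
  refine ⟨fun hh u => ?_, fun hh => ContinuousLinearMap.ext fun w => ?_⟩
  · simpa using congrArg (fun B : Lp ℂ 2 ν →L[ℂ] Lp ℂ 2 ν => B (W u)) hh
  · simpa using hh (W.symm w)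

theorem CarriesMul.resolventFun_mem (hW : CarriesMul W a c) (ha : Measurable a) (hc : Measurable c)
    {z : ℂ} (hz : z.im ≠ 0) : resolventFun z hz ∈ carriedSubalgebra W ha hc := by
  refine mem_carriedSubalgebra_iff.2 fun u => ?_
  have h := (hW _ _).1 (ae_eq_mul_mulResolvent ha hz u)
  rwa [map_add, map_smul, ae_eq_mul_iff_eq_mulResolvent hc hz, add_sub_cancel_right] at h

theorem CarriesMul.spectralMeasure_eq (hW : CarriesMul W a c) (ha : Measurable a)
    (hc : Measurable c) (u : Lp ℂ 2 μ) : spectralMeasure a u = spectralMeasure c (W u) := by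
  have hI : Complex.I.im ≠ 0 := by simp
  refine ext_of_forall_mem_subalgebra_integral_eq_of_polish
    (A := carriedSubalgebra W ha hc) ?_ fun h hh => ?_
  · intro s t hst
    refine ⟨(resolventFun _ hI).toContinuousMap,
      ⟨(resolventFun _ hI).toContinuousMap, ⟨_, hW.resolventFun_mem ha hc hI, rfl⟩, rfl⟩,
      fun h => hst ?_⟩
    have h' : ((s : ℂ) - Complex.I)⁻¹ = ((t : ℂ) - Complex.I)⁻¹ := h
    exact_mod_cast sub_left_injective (inv_injective h')
  · rw [← inner_eq_integral_spectralMeasure ha h.continuous.measurable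
      (coeFn_mulOp (comp a ha (ofContinuous h)) u),
      ← inner_eq_integral_spectralMeasure hc h.continuous.measurable
        (coeFn_mulOp (comp c hc (ofContinuous h)) (W u))]
    exact (W.inner_map_map _ _).symm.trans
      (congrArg (inner ℂ (W u)) (mem_carriedSubalgebra_iff.1 hh u))

end SpectralMeasure

section FunctionalCalculus

variable {H : Type*} [NormedAddCommGroup H] [InnerProductSpace ℂ H] {A : H →ₗ.[ℂ] H}

theorem ext_inner_self {B B' : H →L[ℂ] H} (h : ∀ ψ, inner ℂ ψ (B ψ) = inner ℂ ψ (B' ψ)) :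
    B = B' := by
  refine ContinuousLinearMap.coe_injective ((ext_inner_map _ _).1 fun ψ => ?_)
  rw [← inner_conj_symm, ← inner_conj_symm _ ψ]
  exact congrArg _ (h ψ)

theorem IsFunctionOf.unique {g : ℝ → ℂ} (hg : Measurable g) {B B' : H →L[ℂ] H}
    (h : IsFunctionOf A g B) (h' : IsFunctionOf A g B') : B = B' := by
  obtain ⟨X, _, μ, V, a, ha, hA, hB⟩ := h
  obtain ⟨Y, _, ν, V', c, hc, hA', hB'⟩ := h'
  have hW : CarriesMul (V.symm.trans V') a c := fun u v => by
    simpa using (hA (V.symm u) (V.symm v)).symm.trans (hA' (V.symm u) (V.symm v))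
  refine ext_inner_self fun ψ => ?_
  rw [← V.inner_map_map, ← V'.inner_map_map, inner_eq_integral_spectralMeasure ha hg (hB ψ),
    inner_eq_integral_spectralMeasure hc hg (hB' ψ), hW.spectralMeasure_eq ha hc]
  simp

variable {X : Type*} [MeasurableSpace X] {μ : Measure X}

/-- The unitary map `V` carries `A` to multiplication by the real function `a`, with its maximal
domain; this is the first half of `IsFunctionOf`. -/
def IsDiagonalizedBy (A : H →ₗ.[ℂ] H) (V : H ≃ₗᵢ[ℂ] Lp ℂ 2 μ) (a : X → ℝ) : Prop :=
  ∀ ψ χ : H, (ψ, χ) ∈ A.graph ↔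
    (V χ : X → ℂ) =ᵐ[μ] fun x => ((a x : ℝ) : ℂ) * (V ψ : X → ℂ) x

/-- Testing an element of the adjoint graph against the range of the resolvent at `i` expresses it
through the resolvent at `-i`. -/
theorem IsDiagonalizedBy.isSelfAdjoint [CompleteSpace H] {V : H ≃ₗᵢ[ℂ] Lp ℂ 2 μ} {a : X → ℝ}
    (hA : IsDiagonalizedBy A V a) (ha : Measurable a) (hd : Dense (A.domain : Set H)) :
    IsSelfAdjoint A := by
  have hI : Complex.I.im ≠ 0 := by simp
  set R := mulResolvent μ ha Complex.I hI with hR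
  rw [LinearPMap.isSelfAdjoint_def]
  refine LinearPMap.eq_of_eq_graph ?_
  rw [LinearPMap.adjoint_graph_eq_graph_adjoint hd]
  ext ⟨ψ, χ⟩
  rw [Submodule.mem_adjoint_iff, hA]
  refine ⟨fun h => ?_, fun h α β hαβ => ?_⟩
  · have hinner : ∀ w, inner ℂ w (V ψ) = inner ℂ (R w) (V χ - star Complex.I • V ψ) := fun w => by
      have h1 := h (V.symm (R w)) (V.symm (w + Complex.I • R w))
        ((hA _ _).2 (by simpa using ae_eq_mul_mulResolvent ha hI w))
      simp only [← V.inner_map_map _ ψ, ← V.inner_map_map _ χ,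
        LinearIsometryEquiv.apply_symm_apply, inner_add_left, inner_smul_left] at h1
      rw [inner_sub_right, inner_smul_right, RCLike.star_def]
      linear_combination h1
    rw [ae_eq_mul_iff_eq_mulResolvent ha (z := star Complex.I) (by simp), ← star_mulResolvent ha hI,
      ContinuousLinearMap.star_eq_adjoint]
    exact ext_inner_left ℂ fun w => by
      rw [ContinuousLinearMap.adjoint_inner_right, ← hR, hinner w]
  · rw [hA] at hαβ
    rw [sub_eq_zero, ← V.inner_map_map, ← V.inner_map_map α]
    exact inner_mul_eq_inner_mul hαβ h

end FunctionalCalculus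

/-! ## Unitary operators preserving the Schwartz space -/

section UnitaryGroup

variable (E : Type*) [NormedAddCommGroup E] [InnerProductSpace ℝ E] [FiniteDimensional ℝ E]
  [MeasurableSpace E] [BorelSpace E]

/-- The unitary operators on `L²(E)` that map the Schwartz space onto itself, each paired with its
restriction to the Schwartz space. -/
def schwartzUnitaries :
    Subgroup ((Lp (α := E) ℂ 2 volume ≃ₗᵢ[ℂ] Lp (α := E) ℂ 2 volume) ×
      (Module.End ℂ 𝓢(E, ℂ))ˣ) where
  carrier := {g | ∀ f : 𝓢(E, ℂ), g.1 (f.toLp 2) = (g.2.val f).toLp 2}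
  mul_mem' := fun {g h} hg hh f => (congrArg g.1 (hh f)).trans (hg _)
  one_mem' _ := rfl
  inv_mem' := fun {g} hg f => by
    refine g.1.injective ((g.1.apply_symm_apply _).trans ?_)
    rw [hg, ← Module.End.mul_apply, ← Units.val_mul, Prod.snd_inv, mul_inv_cancel]
    rfl

/-- The group of unitary operators on `L²(E)` that map the Schwartz space onto itself. -/
abbrev SchwartzUnitary : Type _ := schwartzUnitaries E

variable {E}

namespace SchwartzUnitary

/-- A unitary operator for which it and its inverse restrict to the Schwartz space. -/
def ofRestrictions (U : Lp (α := E) ℂ 2 volume ≃ₗᵢ[ℂ] Lp (α := E) ℂ 2 volume)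
    (S S' : Module.End ℂ 𝓢(E, ℂ)) (hS : ∀ f : 𝓢(E, ℂ), U (f.toLp 2) = (S f).toLp 2)
    (hS' : ∀ f : 𝓢(E, ℂ), U.symm (f.toLp 2) = (S' f).toLp 2) : SchwartzUnitary E :=
  ⟨⟨U, S, S',
    LinearMap.ext fun f => SchwartzMap.injective_toLp (F := ℂ) 2 volume <| by
      beta_reduce
      rw [Module.End.mul_apply, ← hS, ← hS', U.apply_symm_apply, Module.End.one_apply],
    LinearMap.ext fun f => SchwartzMap.injective_toLp (F := ℂ) 2 volume <| by
      beta_reduce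
      rw [Module.End.mul_apply, ← hS', ← hS, U.symm_apply_apply, Module.End.one_apply]⟩, hS⟩

/-- The underlying unitary map. -/
def iso (g : SchwartzUnitary E) : Lp (α := E) ℂ 2 volume ≃ₗᵢ[ℂ] Lp (α := E) ℂ 2 volume := g.1.1

/-- The restriction to the Schwartz space. -/
def core : SchwartzUnitary E →* (Module.End ℂ 𝓢(E, ℂ))ˣ :=
  (MonoidHom.snd _ _).comp (schwartzUnitaries E).subtype

/-- The underlying bounded operator. -/
def op : SchwartzUnitary E →* (Lp (α := E) ℂ 2 volume →L[ℂ] Lp (α := E) ℂ 2 volume) :=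
  (unitary _).subtype.comp <| Unitary.linearIsometryEquiv.symm.toMonoidHom.comp <|
    (MonoidHom.fst _ _).comp (schwartzUnitaries E).subtype

theorem iso_toLp (g : SchwartzUnitary E) (f : 𝓢(E, ℂ)) :
    g.iso (f.toLp 2) = ((core g).val f).toLp 2 := g.2 f

theorem op_injective : Function.Injective (op (E := E)) := fun g h hgh => by
  have h1 : g.iso = h.iso := LinearIsometryEquiv.ext fun ψ => congrArg (fun T => T ψ) hgh
  have h2 : core g = core h := Units.ext <| LinearMap.ext fun f =>
    SchwartzMap.injective_toLp (F := ℂ) 2 volume (by beta_reduce; rw [← iso_toLp, ← iso_toLp, h1])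
  exact Subtype.ext (Prod.ext h1 h2)

theorem op_mem_unitary (g : SchwartzUnitary E) :
    op g ∈ unitary (Lp (α := E) ℂ 2 volume →L[ℂ] Lp (α := E) ℂ 2 volume) :=
  (Unitary.linearIsometryEquiv.symm g.iso).2

theorem op_mul (g h : SchwartzUnitary E) : op (g * h) = op g * op h := map_mul op g h

theorem inverse_op (g : SchwartzUnitary E) : Ring.inverse (op g) = op g⁻¹ :=
  Ring.inverse_unit ⟨op g, op g⁻¹, by rw [← map_mul, mul_inv_cancel, map_one],
    by rw [← map_mul, inv_mul_cancel, map_one]⟩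

end SchwartzUnitary

end UnitaryGroup

open SchwartzUnitary

/-! ## Closures of operators on the Schwartz space -/

section MulCore

variable {E : Type*} [NormedAddCommGroup E] [NormedSpace ℝ E]

/-- Multiplication by a function, on the Schwartz space. It has the junk value `0` unless the
function has temperate growth. -/
def mulCore (a : E → ℂ) : Module.End ℂ 𝓢(E, ℂ) := (SchwartzMap.smulLeftCLM ℂ a).toLinearMap

theorem mulCore_apply {a : E → ℂ} (ha : a.HasTemperateGrowth) (f : 𝓢(E, ℂ)) (x : E) :
    mulCore a f x = a x * f x :=
  SchwartzMap.smulLeftCLM_apply_apply ha f x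

theorem hasTemperateGrowth_coe {a : E → ℝ} (ha : a.HasTemperateGrowth) :
    (fun x => (a x : ℂ)).HasTemperateGrowth :=
  Function.Complex.hasTemperateGrowth_ofReal.comp ha

theorem hasTemperateGrowth_resolvent {a : E → ℝ} (ha : a.HasTemperateGrowth) :
    (fun x => ((a x : ℂ) - Complex.I)⁻¹).HasTemperateGrowth := by
  have h : (fun x => ((a x : ℂ) + Complex.I) *
      (((1 + ‖a x‖ ^ 2) ^ (-1 : ℝ) : ℝ) : ℂ)).HasTemperateGrowth :=
    ((hasTemperateGrowth_coe ha).add (.const _)).mul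
      (hasTemperateGrowth_coe ((Function.hasTemperateGrowth_one_add_norm_sq_rpow ℝ (-1)).comp ha))
  convert! h using 1
  funext x
  have h1 : (1 : ℂ) + (a x : ℂ) ^ 2 = (a x - Complex.I) * (a x + Complex.I) := by
    linear_combination Complex.I_sq
  have h2 := ofReal_sub_ne_zero (z := Complex.I) (by simp) (a x)
  have h3 : (a x : ℂ) + Complex.I ≠ 0 := by
    simpa using ofReal_sub_ne_zero (z := -Complex.I) (by simp) (a x)
  rw [Real.rpow_neg_one, Real.norm_eq_abs, sq_abs]
  push_cast
  rw [h1]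
  field_simp

end MulCore

section CoreGraph

variable {E : Type*} [NormedAddCommGroup E] [InnerProductSpace ℝ E] [FiniteDimensional ℝ E]
  [MeasurableSpace E] [BorelSpace E] {S T : Module.End ℂ 𝓢(E, ℂ)} {g s : SchwartzUnitary E}
  {a : E → ℝ}

/-- The graph in `L²(E) × L²(E)` of an operator on the Schwartz space. -/
def coreGraph (T : Module.End ℂ 𝓢(E, ℂ)) :
    Submodule ℂ (Lp (α := E) ℂ 2 volume × Lp (α := E) ℂ 2 volume) :=
  LinearMap.range <| LinearMap.prod (SchwartzMap.toLpCLM ℂ ℂ 2 volume).toLinearMap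
    ((SchwartzMap.toLpCLM ℂ ℂ 2 volume).toLinearMap ∘ₗ T)

theorem mk_mem_coreGraph (T : Module.End ℂ 𝓢(E, ℂ)) (f : 𝓢(E, ℂ)) :
    (f.toLp 2 volume, (T f).toLp 2 volume) ∈ coreGraph T := ⟨f, rfl⟩

theorem mem_closure_coreGraph_of_semiconjBy {c c' : ℂ} (hc : c' * c = 1)
    (h : SemiconjBy (core g).val S (c • T)) {ψ χ : Lp (α := E) ℂ 2 volume}
    (hψχ : (ψ, χ) ∈ (coreGraph S).topologicalClosure) :
    (g.iso ψ, c' • g.iso χ) ∈ (coreGraph T).topologicalClosure := by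
  refine map_mem_closure (f := fun z => (g.iso z.1, c' • g.iso z.2)) (by fun_prop) hψχ ?_
  rintro _ ⟨f, rfl⟩
  have hf : (core g).val (S f) = c • T ((core g).val f) := LinearMap.congr_fun h.eq f
  have hT : c' • ((c • T ((core g).val f)).toLp 2 : Lp (α := E) ℂ 2 volume) =
      (T ((core g).val f)).toLp 2 := by
    change c' • SchwartzMap.toLpCLM ℂ ℂ 2 volume (c • T ((core g).val f)) = _
    rw [map_smul, smul_smul, hc, one_smul, SchwartzMap.toLpCLM_apply]
  change (g.iso (f.toLp 2), c' • g.iso ((S f).toLp 2)) ∈ coreGraph T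
  rw [iso_toLp, iso_toLp, hf, hT]
  exact mk_mem_coreGraph T _

theorem mem_closure_coreGraph_iff_of_semiconjBy {c c' : ℂ} (hc : c' * c = 1)
    (h : SemiconjBy (core g).val S (c • T)) {ψ χ : Lp (α := E) ℂ 2 volume} :
    (ψ, χ) ∈ (coreGraph S).topologicalClosure ↔
      (g.iso ψ, c' • g.iso χ) ∈ (coreGraph T).topologicalClosure := by
  refine ⟨mem_closure_coreGraph_of_semiconjBy hc h, fun hψχ => ?_⟩
  have hinv : SemiconjBy (core g⁻¹).val T (c' • S) := by
    have h1 := (SemiconjBy.units_inv_symm_left h).eq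
    rw [mul_smul_comm] at h1
    rw [SemiconjBy, smul_mul_assoc, map_inv, ← h1, smul_smul, hc, one_smul]
  have hmem := mem_closure_coreGraph_of_semiconjBy (mul_comm c' c ▸ hc) hinv hψχ
  have hg : ∀ φ, g⁻¹.iso (g.iso φ) = φ := g.iso.symm_apply_apply
  rwa [map_smul, hg, hg, smul_smul, mul_comm, hc, one_smul] at hmem

theorem toLp_mulCore_ae_eq {a : E → ℂ} (ha : a.HasTemperateGrowth) (f : 𝓢(E, ℂ)) :
    (mulCore a f).toLp 2 volume =ᵐ[volume] fun x => a x * f.toLp 2 volume x := by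
  filter_upwards [f.coeFn_toLp 2, (mulCore a f).coeFn_toLp 2] with x h1 h2
  rw [h1, h2, mulCore_apply ha]

/-- Schwartz functions are a core for multiplication by `a` because the resolvent `(a - i)⁻¹` maps
them to Schwartz functions. -/
theorem mem_closure_coreGraph_mulCore_iff (ha : a.HasTemperateGrowth)
    {u v : Lp (α := E) ℂ 2 volume} :
    (u, v) ∈ (coreGraph (mulCore fun x => (a x : ℂ))).topologicalClosure ↔
      v =ᵐ[volume] fun x => (a x : ℂ) * u x := by
  have hm : Measurable a := ha.1.continuous.measurable
  have hI : Complex.I.im ≠ 0 := by simp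
  set R := mulResolvent volume hm Complex.I hI
  constructor
  · have hclosed : IsClosed {z : Lp (α := E) ℂ 2 volume × Lp (α := E) ℂ 2 volume |
        z.1 = R (z.2 - Complex.I • z.1)} := isClosed_eq (by fun_prop) (by fun_prop)
    intro huv
    refine (ae_eq_mul_iff_eq_mulResolvent hm hI u v).2 (closure_minimal ?_ hclosed huv)
    rintro _ ⟨f, rfl⟩
    exact (ae_eq_mul_iff_eq_mulResolvent hm hI _ _).1
      (toLp_mulCore_ae_eq (hasTemperateGrowth_coe ha) f)
  · have hR : ∀ w, (R w, w + Complex.I • R w) ∈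
        (coreGraph (mulCore fun x => (a x : ℂ))).topologicalClosure := fun w => by
      refine (SchwartzMap.denseRange_toLpCLM (F := ℂ) (p := 2) (μ := volume) (by simp)).induction_on
        (p := fun w => (R w, w + Complex.I • R w) ∈ _) w
        ((Submodule.isClosed_topologicalClosure _).preimage (by fun_prop)) fun f => ?_
      have hRf : (mulCore (fun x => ((a x : ℂ) - Complex.I)⁻¹) f).toLp 2 = R (f.toLp 2) :=
        eq_mulResolvent_iff.2 (toLp_mulCore_ae_eq (hasTemperateGrowth_resolvent ha) f)
      have hmul := ae_eq_mul_mulResolvent hm hI (f.toLp 2 : Lp (α := E) ℂ 2 volume)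
      have hcore := toLp_mulCore_ae_eq (hasTemperateGrowth_coe ha)
        (mulCore (fun x => ((a x : ℂ) - Complex.I)⁻¹) f)
      rw [hRf] at hcore
      rw [SchwartzMap.toLpCLM_apply, Lp.ext (hmul.trans hcore.symm), ← hRf]
      exact subset_closure (mk_mem_coreGraph _ _)
    intro huv
    have := hR (v - Complex.I • u)
    rwa [← (ae_eq_mul_iff_eq_mulResolvent hm hI u v).1 huv, sub_add_cancel] at this

/-- The unitary operator `g` carries `T` to multiplication by the real function `a`, on the Schwartz
space. -/
structure DiagonalizedOnCore (T : Module.End ℂ 𝓢(E, ℂ)) (g : SchwartzUnitary E) (a : E → ℝ) :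
    Prop where
  temperate : a.HasTemperateGrowth
  semiconj : SemiconjBy (core g).val T (mulCore fun x => (a x : ℂ))

namespace DiagonalizedOnCore

theorem measurable (h : DiagonalizedOnCore T g a) : Measurable a :=
  h.temperate.1.continuous.measurable

theorem conj (h : DiagonalizedOnCore T g a) (hs : SemiconjBy (core s).val S T) :
    DiagonalizedOnCore S (g * s) a :=
  ⟨h.temperate, by rw [map_mul, Units.val_mul]; exact h.semiconj.mul_left hs⟩

theorem mem_closure_coreGraph_iff (h : DiagonalizedOnCore T g a)
    {ψ χ : Lp (α := E) ℂ 2 volume} :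
    (ψ, χ) ∈ (coreGraph T).topologicalClosure ↔
      g.iso χ =ᵐ[volume] fun x => (a x : ℂ) * g.iso ψ x := by
  rw [mem_closure_coreGraph_iff_of_semiconjBy (one_mul 1) (by rw [one_smul]; exact h.semiconj),
    one_smul, mem_closure_coreGraph_mulCore_iff h.temperate]

end DiagonalizedOnCore

end CoreGraph

section ClosedOp

variable {N : ℕ} [NeZero N] {S T : Module.End ℂ (Core N)} {g s : SchwartzUnitary (Config N)}
  {a : Config N → ℝ}

theorem graph_closedOp (h : ∀ z ∈ (coreGraph T).topologicalClosure, z.1 = 0 → z.2 = 0) :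
    (closedOp T).graph = (coreGraph T).topologicalClosure := by
  set T₀ : L2 N →ₗ.[ℂ] L2 N :=
    { domain := LinearMap.range (coreIncl N)
      toFun := coreIncl N ∘ₗ T ∘ₗ
        (LinearEquiv.ofInjective (coreIncl N) (coreIncl_injective N)).symm.toLinearMap }
  have hT₀ : T₀.graph = coreGraph T := by
    ext ⟨ψ, χ⟩
    rw [LinearPMap.mem_graph_iff]
    have hval (f : Core N) : T₀ ⟨coreIncl N f, f, rfl⟩ = coreIncl N (T f) :=
      congrArg (fun f' => coreIncl N (T f'))
        ((LinearEquiv.ofInjective (coreIncl N) (coreIncl_injective N)).symm_apply_apply f)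
    constructor
    · rintro ⟨⟨_, f, rfl⟩, hψ, hχ⟩
      exact ⟨f, Prod.ext hψ ((hval f).symm.trans hχ)⟩
    · rintro ⟨f, hf⟩
      exact ⟨⟨_, f, rfl⟩, congrArg Prod.fst hf, (hval f).trans (congrArg Prod.snd hf)⟩
  rw [closedOp, ← hT₀, LinearPMap.IsClosable.graph_closure_eq_closure_graph]
  refine ⟨(coreGraph T).topologicalClosure.toLinearPMap, ?_⟩
  rw [hT₀, Submodule.toLinearPMap_graph_eq _ h]

theorem denseRange_coreIncl (N : ℕ) [NeZero N] : DenseRange (coreIncl N) :=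
  SchwartzMap.denseRange_toLpCLM (E := Config N) (F := ℂ) (p := 2) (μ := volume) (by simp)

namespace DiagonalizedOnCore

theorem graph_closedOp_eq (h : DiagonalizedOnCore T g a) :
    (closedOp T).graph = (coreGraph T).topologicalClosure := by
  refine graph_closedOp ?_
  rintro ⟨ψ, χ⟩ hz (rfl : ψ = 0)
  rw [h.mem_closure_coreGraph_iff, map_zero] at hz
  refine g.iso.map_eq_zero_iff.1 (Lp.ext ?_)
  filter_upwards [hz, Lp.coeFn_zero ℂ 2 (volume : Measure (Config N))] with x h1 h2
  rw [h1, h2, Pi.zero_apply, mul_zero]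

theorem isDiagonalizedBy (h : DiagonalizedOnCore T g a) :
    IsDiagonalizedBy (closedOp T) g.iso a := fun ψ χ => by
  rw [h.graph_closedOp_eq, h.mem_closure_coreGraph_iff]

theorem isSelfAdjoint (h : DiagonalizedOnCore T g a) : IsSelfAdjoint (closedOp T) :=
  h.isDiagonalizedBy.isSelfAdjoint h.measurable
    ((denseRange_coreIncl N).mono fun _ hψ => (LinearPMap.le_closure _).1 hψ)

/-- The functional calculus of the closure of a diagonalized operator. -/
def calculus (h : DiagonalizedOnCore T g a) :
    boundedMeasurable ℝ →⋆ₐ[ℂ] (L2 N →L[ℂ] L2 N) :=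
  (g.iso.symm.conjStarAlgEquiv : _ →⋆ₐ[ℂ] _).comp
    ((boundedMeasurable.mulRep volume).comp (boundedMeasurable.comp a h.measurable))

theorem calculus_apply (h : DiagonalizedOnCore T g a) (G : boundedMeasurable ℝ) (ψ : L2 N) :
    h.calculus G ψ = g.iso.symm
      (boundedMeasurable.mulOp volume (boundedMeasurable.comp a h.measurable G) (g.iso ψ)) := rfl

theorem calculus_conj_apply (h : DiagonalizedOnCore T g a) (hs : SemiconjBy (core s).val S T)
    (G : boundedMeasurable ℝ) (ψ : L2 N) :
    (h.conj hs).calculus G ψ = s.iso.symm (h.calculus G (s.iso ψ)) := by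
  rw [calculus_apply, calculus_apply]
  rfl

theorem fc_eq (h : DiagonalizedOnCore T g a) (G : boundedMeasurable ℝ) :
    fc G.1 T = h.calculus G := by
  have hG : IsFunctionOf (closedOp T) G.1 (h.calculus G) := by
    refine ⟨Config N, inferInstance, volume, g.iso, a, h.measurable, h.isDiagonalizedBy,
      fun ψ => ?_⟩
    exact boundedMeasurable.eq_mulOp_iff.1 (g.iso.apply_symm_apply _)
  have hex : ∃ B, IsFunctionOf (closedOp T) G.1 B := ⟨_, hG⟩
  rw [fc, dif_pos hex]
  exact IsFunctionOf.unique G.2.1 hex.choose_spec hG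

theorem fc_mem_unitary (h : DiagonalizedOnCore T g a) {G : boundedMeasurable ℝ}
    (hG : G ∈ unitary (boundedMeasurable ℝ)) : fc G.1 T ∈ unitary (L2 N →L[ℂ] L2 N) :=
  h.fc_eq G ▸ Unitary.map_mem h.calculus hG

theorem semiconjBy_fc (h : DiagonalizedOnCore T g a) (G : boundedMeasurable ℝ)
    (hs : SemiconjBy (core s).val S T) : SemiconjBy (op s) (fc G.1 S) (fc G.1 T) := by
  rw [h.fc_eq G, (h.conj hs).fc_eq G]
  refine ContinuousLinearMap.ext fun ψ => ?_
  change s.iso ((h.conj hs).calculus G ψ) = h.calculus G (s.iso ψ)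
  rw [h.calculus_conj_apply hs]
  exact s.iso.apply_symm_apply _

end DiagonalizedOnCore

end ClosedOp

/-! ## Multiplication by phases -/

section MulCoreAlgebra

variable {E : Type*} [NormedAddCommGroup E] [NormedSpace ℝ E] {a c : E → ℂ}

theorem mulCore_mul (ha : a.HasTemperateGrowth) (hc : c.HasTemperateGrowth) :
    mulCore a * mulCore c = mulCore (a * c) :=
  LinearMap.ext (SchwartzMap.smulLeftCLM_smulLeftCLM_apply ha hc)

theorem commute_mulCore (ha : a.HasTemperateGrowth) (hc : c.HasTemperateGrowth) :
    Commute (mulCore a) (mulCore c) := by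
  rw [commute_iff_eq, mulCore_mul ha hc, mulCore_mul hc ha, mul_comm]

theorem hasTemperateGrowth_const_smul (r : ℂ) (ha : a.HasTemperateGrowth) :
    (r • a).HasTemperateGrowth :=
  (Function.HasTemperateGrowth.const r).mul ha

theorem mulCore_const (r : ℂ) : (mulCore fun _ : E => r) = r • 1 := by
  ext f x
  rw [mulCore_apply (.const r)]
  rfl

theorem mulCore_add (ha : a.HasTemperateGrowth) (hc : c.HasTemperateGrowth) :
    mulCore (a + c) = mulCore a + mulCore c :=
  congrArg ContinuousLinearMap.toLinearMap (SchwartzMap.smulLeftCLM_add ha hc)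

theorem mulCore_smul (ha : a.HasTemperateGrowth) (r : ℂ) : mulCore (r • a) = r • mulCore a :=
  congrArg ContinuousLinearMap.toLinearMap (SchwartzMap.smulLeftCLM_smul ha r)

end MulCoreAlgebra

section Phase

open scoped FourierTransform

theorem hasTemperateGrowth_fourierChar : (fun t : ℝ => (𝐞 t : ℂ)).HasTemperateGrowth := by
  have hderiv (n : ℕ) : iteratedDeriv n (fun t : ℝ => (𝐞 t : ℂ)) =
      fun t => (2 * Real.pi * Complex.I) ^ n * 𝐞 t := by
    induction n with
    | zero => simp
    | succ n ih =>
      rw [iteratedDeriv_succ, ih]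
      funext t
      rw [((Real.hasDerivAt_fourierChar t).const_mul _).deriv, ← mul_assoc, ← pow_succ]
  refine ⟨?_, fun n => ⟨0, (2 * Real.pi) ^ n, fun t => ?_⟩⟩
  · simp only [Real.fourierChar_apply]
    exact ((Complex.ofRealCLM.contDiff.comp (contDiff_const.mul contDiff_id)).mul
      contDiff_const).cexp
  · rw [norm_iteratedFDeriv_eq_norm_iteratedDeriv, hderiv, norm_mul, Circle.norm_coe]
    simp [Real.pi_nonneg, abs_of_nonneg]

variable {E : Type*} [NormedAddCommGroup E] [InnerProductSpace ℝ E] [FiniteDimensional ℝ E]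
  [MeasurableSpace E] [BorelSpace E] {a c : E → ℝ}

/-- The character `t ↦ exp (2πi t)` as a bounded measurable function. -/
def boundedChar : boundedMeasurable ℝ :=
  boundedMeasurable.ofNormEqOne (fun t => 𝐞 t)
    hasTemperateGrowth_fourierChar.1.continuous.measurable fun _ => Circle.norm_coe _

theorem boundedChar_mem_unitary : boundedChar ∈ unitary (boundedMeasurable ℝ) :=
  boundedMeasurable.ofNormEqOne_mem_unitary _ _

theorem boundedMeasurable.comp_boundedChar_mem_unitary (ha : Measurable a) :
    boundedMeasurable.mulRep volume (boundedMeasurable.comp a ha boundedChar) ∈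
      unitary (Lp (α := E) ℂ 2 volume →L[ℂ] Lp (α := E) ℂ 2 volume) :=
  Unitary.map_mem (boundedMeasurable.mulRep volume) <|
    Unitary.map_mem (boundedMeasurable.comp a ha) boundedChar_mem_unitary

/-- Multiplication by the phase `exp (2πi a)`. -/
def phaseMul (a : E → ℝ) (ha : a.HasTemperateGrowth) : SchwartzUnitary E :=
  ofRestrictions
    (Unitary.linearIsometryEquiv
      ⟨_, boundedMeasurable.comp_boundedChar_mem_unitary ha.1.continuous.measurable⟩)
    (mulCore fun x => 𝐞 (a x)) (mulCore fun x => 𝐞 (-a x))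
    (fun f => Eq.symm <| boundedMeasurable.eq_mulOp_iff.2 <|
      toLp_mulCore_ae_eq (hasTemperateGrowth_fourierChar.comp ha) f)
    (fun f => by
      have hstar : star (boundedMeasurable.mulRep volume
          (boundedMeasurable.comp a ha.1.continuous.measurable boundedChar)) =
          boundedMeasurable.mulOp volume (star
            (boundedMeasurable.comp a ha.1.continuous.measurable boundedChar)) :=
        (map_star (boundedMeasurable.mulRep volume) _).symm
      refine (congrArg (fun S => S (f.toLp 2)) hstar).trans
        (boundedMeasurable.eq_mulOp_iff.2 ?_).symm
      filter_upwards [toLp_mulCore_ae_eq (hasTemperateGrowth_fourierChar.comp ha.neg) f] with x hx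
      exact hx.trans <| congrArg (· * _) <|
        (congrArg (fun z : Circle => (z : ℂ)) (AddChar.map_neg_eq_inv 𝐞 (a x))).trans
          (Circle.coe_inv_eq_conj _))

theorem op_phaseMul (ha : a.HasTemperateGrowth) :
    op (phaseMul a ha) = boundedMeasurable.mulRep volume
      (boundedMeasurable.comp a ha.1.continuous.measurable boundedChar) := rfl

theorem core_phaseMul (ha : a.HasTemperateGrowth) :
    (core (phaseMul a ha)).val = mulCore fun x => 𝐞 (a x) := rfl

theorem phaseMul_mul (ha : a.HasTemperateGrowth) (hc : c.HasTemperateGrowth) :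
    phaseMul a ha * phaseMul c hc = phaseMul (a + c) (ha.add hc) := by
  apply op_injective
  rw [map_mul, op_phaseMul, op_phaseMul, op_phaseMul, ← map_mul]
  congr 1
  exact Subtype.ext (funext fun x =>
    (congrArg (fun z : Circle => (z : ℂ)) (AddChar.map_add_eq_mul 𝐞 (a x) (c x))).symm)

theorem commute_phaseMul (ha : a.HasTemperateGrowth) (hc : c.HasTemperateGrowth) :
    Commute (phaseMul a ha) (phaseMul c hc) := by
  rw [commute_iff_eq, phaseMul_mul, phaseMul_mul]
  simp_rw [add_comm]

theorem commute_core_phaseMul (ha : a.HasTemperateGrowth) {c : E → ℂ} (hc : c.HasTemperateGrowth) :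
    Commute (core (phaseMul a ha)).val (mulCore c) :=
  commute_mulCore (hasTemperateGrowth_fourierChar.comp ha) hc

theorem op_phaseMul_const (t : ℝ) : op (phaseMul (fun _ : E => t) (.const t)) = (𝐞 t : ℂ) • 1 := by
  have hconst (ht : Measurable fun _ : E => t) :
      boundedMeasurable.comp (fun _ : E => t) ht boundedChar = (𝐞 t : ℂ) • 1 :=
    Subtype.ext (funext fun _ => (mul_one _).symm)
  rw [op_phaseMul, hconst, map_smul, map_one]

theorem phaseMul_zero : phaseMul (0 : E → ℝ) (.const 0) = 1 := by
  refine op_injective ((op_phaseMul_const 0).trans ?_)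
  rw [AddChar.map_zero_eq_one, Circle.coe_one, one_smul, map_one]

theorem phaseMul_neg (ha : a.HasTemperateGrowth) : phaseMul (-a) ha.neg = (phaseMul a ha)⁻¹ := by
  rw [eq_inv_iff_mul_eq_one, phaseMul_mul]
  simp only [neg_add_cancel]
  exact phaseMul_zero

theorem commute_core_phaseMul_const (t : ℝ) (S : Module.End ℂ 𝓢(E, ℂ)) :
    Commute (core (phaseMul (fun _ : E => t) (.const t))).val S := by
  rw [core_phaseMul, mulCore_const]
  exact (Commute.one_left S).smul_left _

theorem diagonalizedOnCore_mulCore (ha : a.HasTemperateGrowth) :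
    DiagonalizedOnCore (mulCore fun x => (a x : ℂ)) 1 a :=
  ⟨ha, SemiconjBy.one_left _⟩

end Phase

open FourierTransform in
theorem DiagonalizedOnCore.fc_fourierChar_comp {N : ℕ} [NeZero N] {T : Module.End ℂ (Core N)}
    {g : SchwartzUnitary (Config N)} {a : Config N → ℝ} (h : DiagonalizedOnCore T g a) {s : ℝ → ℝ}
    (hs : s.HasTemperateGrowth) :
    fc (fun t => (𝐞 (s t) : ℂ)) T = op (g⁻¹ * phaseMul (s ∘ a) (hs.comp h.temperate) * g) :=
  h.fc_eq (boundedMeasurable.comp s hs.1.continuous.measurable boundedChar)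

theorem commute_phaseMul_const {E : Type*} [NormedAddCommGroup E] [InnerProductSpace ℝ E]
    [FiniteDimensional ℝ E] [MeasurableSpace E] [BorelSpace E] (g : SchwartzUnitary E) (t : ℝ) :
    Commute g (phaseMul (fun _ => t) (.const t)) := by
  refine op_injective ?_
  rw [map_mul, map_mul, op_phaseMul_const, mul_smul_one, smul_one_mul]

open FourierTransform in
theorem DiagonalizedOnCore.commute_conj_phaseMul {N : ℕ} [NeZero N] {T : Module.End ℂ (Core N)}
    {g h : SchwartzUnitary (Config N)} {a : Config N → ℝ} (hT : DiagonalizedOnCore T g a)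
    (hh : Commute (core h).val T) {s : ℝ → ℝ} (hs : s.HasTemperateGrowth) :
    Commute h (g⁻¹ * phaseMul (s ∘ a) (hs.comp hT.temperate) * g) := by
  have hfc : Commute (op h) (fc (fun t => (𝐞 (s t) : ℂ)) T) :=
    hT.semiconjBy_fc (boundedMeasurable.comp s hs.1.continuous.measurable boundedChar) hh
  rw [hT.fc_fourierChar_comp hs] at hfc
  exact op_injective ((map_mul op _ _).trans (hfc.eq.trans (map_mul op _ _).symm))

/-! ## Position and momentum -/

theorem two_pi_I_inv_mul : (2 * (Real.pi : ℂ) * Complex.I)⁻¹ * (2 * Real.pi * Complex.I) = 1 :=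
  inv_mul_cancel₀ Complex.two_pi_I_ne_zero

section PositionMomentum

open scoped FourierTransform

variable {E : Type*} [NormedAddCommGroup E] [InnerProductSpace ℝ E]

/-- The position operator in the direction `v`: multiplication by `⟨x, v⟩`. -/
def position (v : E) : Module.End ℂ 𝓢(E, ℂ) := mulCore fun x => (inner ℝ x v : ℂ)

/-- The momentum operator in the direction `v`: the derivative along `v` divided by `2πi`. -/
def momentum (v : E) : Module.End ℂ 𝓢(E, ℂ) :=
  (2 * (Real.pi : ℂ) * Complex.I)⁻¹ • (LineDeriv.lineDerivOpCLM ℂ 𝓢(E, ℂ) v).toLinearMap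

theorem hasTemperateGrowth_inner_left (v : E) : (fun x : E => inner ℝ x v).HasTemperateGrowth := by
  fun_prop

theorem commute_position (v w : E) : Commute (position v) (position w) :=
  commute_mulCore (hasTemperateGrowth_coe (hasTemperateGrowth_inner_left v))
    (hasTemperateGrowth_coe (hasTemperateGrowth_inner_left w))

theorem hasLineDerivAt_inner_left (v w x : E) :
    HasLineDerivAt ℝ (fun x : E => inner ℝ x v) (inner ℝ w v) x w :=
  (((innerSL ℝ).flip v).hasFDerivAt (x := x)).hasLineDerivAt w

theorem momentum_apply (v : E) (f : 𝓢(E, ℂ)) (x : E) :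
    momentum v f x = (2 * (Real.pi : ℂ) * Complex.I)⁻¹ * lineDeriv ℝ f x v :=
  congrArg (_ * ·) (SchwartzMap.lineDerivOp_apply v f x)

theorem momentum_mul_mulCore {c d : E → ℂ} {v : E} (hc : c.HasTemperateGrowth)
    (hd : d.HasTemperateGrowth) (h : ∀ x, HasLineDerivAt ℝ c (d x) x v) :
    momentum v * mulCore c =
      mulCore c * momentum v + (2 * (Real.pi : ℂ) * Complex.I)⁻¹ • mulCore d := by
  ext f x
  have hf : HasLineDerivAt ℝ f (lineDeriv ℝ f x v) x v :=
    f.differentiableAt.lineDifferentiableAt.hasLineDerivAt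
  have hcf : HasLineDerivAt ℝ (c * (f : E → ℂ)) _ x v := HasDerivAt.mul (h x) hf
  rw [← show (mulCore c f : E → ℂ) = c * (f : E → ℂ) from funext (mulCore_apply hc f)] at hcf
  change momentum v (mulCore c f) x =
    mulCore c (momentum v f) x + (2 * (Real.pi : ℂ) * Complex.I)⁻¹ * mulCore d f x
  rw [momentum_apply, hcf.lineDeriv, mulCore_apply hc, mulCore_apply hd, momentum_apply]
  simp only [zero_smul, add_zero]
  ring

theorem momentum_mul_position (v w : E) : momentum v * position w =
    position w * momentum v + ((2 * (Real.pi : ℂ) * Complex.I)⁻¹ * (inner ℝ v w : ℂ)) • 1 := by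
  rw [position, momentum_mul_mulCore (d := fun _ => (inner ℝ v w : ℂ))
    (hasTemperateGrowth_coe (hasTemperateGrowth_inner_left w)) (.const _)
    fun x => (hasLineDerivAt_inner_left w v x).ofReal_comp, mulCore_const, smul_smul]

theorem hasTemperateGrowth_const_mul_inner_mul_inner (c : ℝ) (v w : E) :
    (fun x : E => c * (inner ℝ x v * inner ℝ x w)).HasTemperateGrowth := by
  fun_prop

theorem smulLeftCLM_inner_eq_position (v : E) (f : 𝓢(E, ℂ)) :
    SchwartzMap.smulLeftCLM ℂ (inner ℝ · v) f = position v f :=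
  SchwartzMap.ext fun x =>
    (SchwartzMap.smulLeftCLM_apply_apply (hasTemperateGrowth_inner_left v) f x).trans
      (mulCore_apply (hasTemperateGrowth_coe (hasTemperateGrowth_inner_left v)) f x).symm

variable [FiniteDimensional ℝ E] [MeasurableSpace E] [BorelSpace E]

theorem semiconjBy_phaseMul_momentum {a d : E → ℝ} {v : E} (ha : a.HasTemperateGrowth)
    (hd : d.HasTemperateGrowth) (h : ∀ x, HasLineDerivAt ℝ a (d x) x v) :
    SemiconjBy (core (phaseMul a ha)).val (momentum v)
      (momentum v - mulCore fun x => (d x : ℂ)) := by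
  have hphase := hasTemperateGrowth_fourierChar.comp ha
  have hd' := hasTemperateGrowth_coe hd
  have hderiv (x : E) : HasLineDerivAt ℝ ((fun t : ℝ => (𝐞 t : ℂ)) ∘ a)
      (((2 * (Real.pi : ℂ) * Complex.I) • ((fun x => (d x : ℂ)) * ((fun t : ℝ => (𝐞 t : ℂ)) ∘ a)))
        x) x v := by
    have hcomp := (Real.hasDerivAt_fourierChar (a (x + (0 : ℝ) • v))).scomp 0 (h x)
    refine hcomp.congr_deriv ?_
    simp only [zero_smul, add_zero, Pi.smul_apply, Pi.mul_apply, Function.comp_apply, smul_eq_mul,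
      Complex.real_smul]
    ring
  have hcomm := momentum_mul_mulCore hphase
    ((Function.HasTemperateGrowth.const (2 * (Real.pi : ℂ) * Complex.I)).mul (hd'.mul hphase))
    hderiv
  rw [show (fun _ : E => 2 * (Real.pi : ℂ) * Complex.I) * ((fun x => (d x : ℂ)) *
      ((fun t : ℝ => (𝐞 t : ℂ)) ∘ a)) = (2 * (Real.pi : ℂ) * Complex.I) •
      ((fun x => (d x : ℂ)) * ((fun t : ℝ => (𝐞 t : ℂ)) ∘ a)) from rfl,
    mulCore_smul (hd'.mul hphase), smul_smul, two_pi_I_inv_mul, one_smul,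
    ← mulCore_mul hd' hphase] at hcomm
  rw [SemiconjBy, sub_mul, eq_sub_iff_add_eq]
  exact hcomm.symm

/-- Multiplication by the Gaussian phase `exp (2πi c ⟨x, v⟩⟨x, w⟩)`. -/
def chirp (c : ℝ) (v w : E) : SchwartzUnitary E :=
  phaseMul _ (hasTemperateGrowth_const_mul_inner_mul_inner c v w)

theorem commute_chirp_position (c : ℝ) (v w u : E) :
    Commute (core (chirp c v w)).val (position u) :=
  commute_core_phaseMul _ (hasTemperateGrowth_coe (hasTemperateGrowth_inner_left u))

theorem commute_chirp (c c' : ℝ) (v w v' w' : E) : Commute (chirp c v w) (chirp c' v' w') :=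
  commute_phaseMul _ _

theorem semiconjBy_chirp_momentum (c : ℝ) (v w u : E) :
    SemiconjBy (core (chirp c v w)).val (momentum u)
      (momentum u -
        (c : ℂ) • ((inner ℝ u v : ℂ) • position w + (inner ℝ u w : ℂ) • position v)) := by
  have hv := hasTemperateGrowth_coe (hasTemperateGrowth_inner_left v)
  have hw := hasTemperateGrowth_coe (hasTemperateGrowth_inner_left w)
  have h := semiconjBy_phaseMul_momentum (hasTemperateGrowth_const_mul_inner_mul_inner c v w)
    (d := fun x => c * (inner ℝ u v * inner ℝ x w + inner ℝ u w * inner ℝ x v)) (v := u)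
    (by fun_prop) fun x => by
      refine (((hasLineDerivAt_inner_left v u x).mul
        (hasLineDerivAt_inner_left w u x)).const_mul c).congr_deriv ?_
      simp only [zero_smul, add_zero]
      ring
  have hvw := Function.HasTemperateGrowth.add (hasTemperateGrowth_const_smul (inner ℝ u v : ℂ) hw)
    (hasTemperateGrowth_const_smul (inner ℝ u w : ℂ) hv)
  rw [position, position, ← mulCore_smul hw, ← mulCore_smul hv, ← mulCore_add
    (hasTemperateGrowth_const_smul _ hw) (hasTemperateGrowth_const_smul _ hv), ← mulCore_smul hvw]
  convert! h using 3
  funext x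
  simp

variable (E) in
/-- The Fourier transform. -/
def fourierUnitary : SchwartzUnitary E :=
  ofRestrictions (Lp.fourierTransformₗᵢ E ℂ)
    (FourierTransform.fourierEquiv ℂ 𝓢(E, ℂ)).toLinearMap
    (FourierTransform.fourierEquiv ℂ 𝓢(E, ℂ)).symm.toLinearMap
    SchwartzMap.toLp_fourier_eq SchwartzMap.toLp_fourierInv_eq

theorem core_fourierUnitary_apply (f : 𝓢(E, ℂ)) : (core (fourierUnitary E)).val f = 𝓕 f := rfl

theorem semiconjBy_fourierUnitary_momentum (v : E) :
    SemiconjBy (core (fourierUnitary E)).val (momentum v) (position v) := by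
  refine LinearMap.ext fun f => ?_
  change (core (fourierUnitary E)).val ((2 * (Real.pi : ℂ) * Complex.I)⁻¹ • ∂_{v} f) =
    position v (𝓕 f)
  rw [map_smul, core_fourierUnitary_apply, SchwartzMap.fourier_lineDerivOp_eq, smul_smul,
    two_pi_I_inv_mul, one_smul, smulLeftCLM_inner_eq_position]

theorem semiconjBy_fourierUnitary_position (v : E) :
    SemiconjBy (core (fourierUnitary E)).val (position v) (-momentum v) := by
  refine LinearMap.ext fun f => ?_
  change 𝓕 (position v f) = -((2 * (Real.pi : ℂ) * Complex.I)⁻¹ • ∂_{v} (𝓕 f))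
  rw [SchwartzMap.lineDerivOp_fourier_eq, ← core_fourierUnitary_apply, ← core_fourierUnitary_apply,
    map_smul, smul_smul, mul_neg, two_pi_I_inv_mul, neg_one_smul, neg_neg,
    smulLeftCLM_inner_eq_position]

theorem commute_momentum (v w : E) : Commute (momentum v) (momentum w) := by
  have hv := semiconjBy_fourierUnitary_momentum v
  have hw := semiconjBy_fourierUnitary_momentum w
  refine (Units.mul_right_inj (core (fourierUnitary E))).1 ?_
  rw [(hv.mul_right hw).eq, (hw.mul_right hv).eq, (commute_position v w).eq]

/-- Composition with a linear isometry. -/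
def compIsometry (e : E ≃ₗᵢ[ℝ] E) : SchwartzUnitary E :=
  ofRestrictions
    (.ofLinearIsometry (Lp.compMeasurePreservingₗᵢ ℂ e e.measurePreserving)
      (Lp.compMeasurePreservingₗᵢ ℂ e.symm e.symm.measurePreserving).toLinearMap
      (LinearMap.ext fun u => by
        refine (Lp.compMeasurePreserving_comp_apply u e.symm.measurePreserving
          e.measurePreserving).symm.trans ?_
        simp)
      (LinearMap.ext fun u => by
        refine (Lp.compMeasurePreserving_comp_apply u e.measurePreserving
          e.symm.measurePreserving).symm.trans ?_
        simp))
    (SchwartzMap.compCLMOfContinuousLinearEquiv ℂ e.toContinuousLinearEquiv).toLinearMap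
    (SchwartzMap.compCLMOfContinuousLinearEquiv ℂ e.symm.toContinuousLinearEquiv).toLinearMap
    (fun _ => rfl) (fun _ => rfl)

theorem compIsometry_mul (e e' : E ≃ₗᵢ[ℝ] E) :
    compIsometry e * compIsometry e' = compIsometry (e.trans e') :=
  op_injective <| ContinuousLinearMap.ext fun u =>
    (Lp.compMeasurePreserving_comp_apply u e'.measurePreserving e.measurePreserving).symm

theorem semiconjBy_compIsometry_position (e : E ≃ₗᵢ[ℝ] E) (v : E) :
    SemiconjBy (core (compIsometry e)).val (position (e v)) (position v) := by
  refine LinearMap.ext fun f => SchwartzMap.ext fun x => ?_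
  change position (e v) f (e x) = position v (SchwartzMap.compCLMOfContinuousLinearEquiv ℂ
    e.toContinuousLinearEquiv f) x
  rw [position, position, mulCore_apply (hasTemperateGrowth_coe (hasTemperateGrowth_inner_left _)),
    mulCore_apply (hasTemperateGrowth_coe (hasTemperateGrowth_inner_left _)), e.inner_map_map]
  rfl

theorem semiconjBy_compIsometry_momentum (e : E ≃ₗᵢ[ℝ] E) (v : E) :
    SemiconjBy (core (compIsometry e)).val (momentum (e v)) (momentum v) :=
  LinearMap.ext fun f => congrArg ((2 * (Real.pi : ℂ) * Complex.I)⁻¹ • ·)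
    (SchwartzMap.lineDerivOp_compCLMOfContinuousLinearEquiv ℂ v e.toContinuousLinearEquiv f).symm

end PositionMomentum

section Coordinates

variable {N : ℕ} [NeZero N]

theorem inner_single_single (i j : ZMod (2 * N)) :
    inner ℝ (EuclideanSpace.single i 1 : Config N) (EuclideanSpace.single j 1) =
      if i = j then 1 else 0 := by
  simp [EuclideanSpace.inner_single_left]

theorem q_eq_position (j : ZMod (2 * N)) : q j = position (EuclideanSpace.single j 1 : Config N) :=
  congrArg mulCore <| funext fun x => by simp [EuclideanSpace.inner_single_right]

theorem p_eq_momentum (j : ZMod (2 * N)) :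
    p j = momentum (EuclideanSpace.single j 1 : Config N) := rfl

theorem commute_q (i j : ZMod (2 * N)) : Commute (q i : Module.End ℂ (Core N)) (q j) := by
  rw [q_eq_position, q_eq_position]
  exact commute_position _ _

theorem commute_p (i j : ZMod (2 * N)) : Commute (p i : Module.End ℂ (Core N)) (p j) :=
  commute_momentum _ _

theorem p_mul_q (i j : ZMod (2 * N)) : (p i * q j : Module.End ℂ (Core N)) =
    q j * p i + if i = j then (2 * (Real.pi : ℂ) * Complex.I)⁻¹ • 1 else 0 := by
  rw [q_eq_position, p_eq_momentum, momentum_mul_position, inner_single_single]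
  split_ifs <;> simp

/-- Multiplication by the Gaussian phase `exp (2πi c x_k x_l)`. -/
def coordChirp (c : ℝ) (k l : ZMod (2 * N)) : SchwartzUnitary (Config N) :=
  chirp c (EuclideanSpace.single k 1) (EuclideanSpace.single l 1)

theorem commute_coordChirp_q (c : ℝ) (k l j : ZMod (2 * N)) :
    Commute (core (coordChirp c k l)).val (q j) := by
  rw [q_eq_position]
  exact commute_chirp_position _ _ _ _

theorem commute_coordChirp (c c' : ℝ) (k l k' l' : ZMod (2 * N)) :
    Commute (coordChirp c k l) (coordChirp c' k' l') :=
  commute_chirp _ _ _ _ _ _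

theorem semiconjBy_coordChirp_p (c : ℝ) (k l j : ZMod (2 * N)) :
    SemiconjBy (core (coordChirp c k l)).val (p j)
      (p j - (c : ℂ) • ((if j = k then q l else 0) + if j = l then q k else 0)) := by
  have h := semiconjBy_chirp_momentum c (EuclideanSpace.single k 1)
    (EuclideanSpace.single l 1) (EuclideanSpace.single j 1 : Config N)
  rw [inner_single_single, inner_single_single, ← q_eq_position, ← q_eq_position] at h
  simp only [apply_ite ((↑) : ℝ → ℂ), Complex.ofReal_one, Complex.ofReal_zero, ite_smul, one_smul,
    zero_smul] at h
  exact h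

theorem semiconjBy_fourierUnitary_p (j : ZMod (2 * N)) :
    SemiconjBy (core (fourierUnitary (Config N))).val (p j) (q j) := by
  rw [q_eq_position]
  exact semiconjBy_fourierUnitary_momentum _

theorem semiconjBy_fourierUnitary_q (j : ZMod (2 * N)) :
    SemiconjBy (core (fourierUnitary (Config N))).val (q j) (-p j) := by
  rw [q_eq_position]
  exact semiconjBy_fourierUnitary_position _

/-- The permutation `x ↦ (x_{σ(i)})_i` of the coordinates. -/
def permCoords (σ : Equiv.Perm (ZMod (2 * N))) : Config N ≃ₗᵢ[ℝ] Config N :=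
  LinearIsometryEquiv.piLpCongrLeft 2 ℝ ℝ σ.symm

theorem permCoords_mul (σ τ : Equiv.Perm (ZMod (2 * N))) :
    permCoords (σ * τ) = (permCoords σ).trans (permCoords τ) :=
  LinearIsometryEquiv.ext fun _ => rfl

theorem permCoords_single (σ : Equiv.Perm (ZMod (2 * N))) (j : ZMod (2 * N)) :
    permCoords σ (EuclideanSpace.single (σ j) 1) = EuclideanSpace.single j 1 := by
  simp [permCoords]

/-- The unitary operator `P σ`. -/
def permUnitary : Equiv.Perm (ZMod (2 * N)) →* SchwartzUnitary (Config N) :=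
  MonoidHom.mk' (fun σ => compIsometry (permCoords σ)) fun σ τ =>
    (congrArg compIsometry (permCoords_mul σ τ)).trans (compIsometry_mul _ _).symm

theorem op_permUnitary (σ : Equiv.Perm (ZMod (2 * N))) : op (permUnitary σ) = P σ := rfl

theorem semiconjBy_permUnitary_q (σ : Equiv.Perm (ZMod (2 * N))) (j : ZMod (2 * N)) :
    SemiconjBy (core (permUnitary σ)).val (q j) (q (σ j)) := by
  rw [q_eq_position, q_eq_position, ← permCoords_single σ j]
  exact semiconjBy_compIsometry_position _ _

theorem semiconjBy_permUnitary_p (σ : Equiv.Perm (ZMod (2 * N))) (j : ZMod (2 * N)) :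
    SemiconjBy (core (permUnitary σ)).val (p j) (p (σ j)) := by
  rw [p_eq_momentum, p_eq_momentum, ← permCoords_single σ j]
  exact semiconjBy_compIsometry_momentum _ _

end Coordinates

/-! ## The quantum dilogarithm -/

section Dilogarithm

open scoped ComplexConjugate

variable {b : ℂ}

/-- The integrand of the quantum dilogarithm `phi b z` at the point `u + i contourHeight b` of the
contour. -/
def phiIntegrand (b : ℂ) (z u : ℝ) : ℂ :=
  (fun w : ℂ => Complex.exp (-2 * Complex.I * (z : ℂ) * w) /
    (Complex.sinh (w * b) * Complex.sinh (w / b) * w))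
    ((u : ℂ) + (contourHeight b : ℂ) * Complex.I)

theorem phi_eq (b : ℂ) (z : ℝ) : phi b z = Complex.exp (1 / 4 * ∫ u, phiIntegrand b z u) := rfl

theorem measurable_uncurry_phiIntegrand (b : ℂ) :
    Measurable (Function.uncurry (phiIntegrand b)) := by
  have := Complex.continuous_sinh
  exact Measurable.div (Continuous.measurable (by fun_prop)) (Continuous.measurable (by fun_prop))

theorem measurable_phi (b : ℂ) : Measurable (phi b) :=
  Complex.measurable_exp.comp <| Measurable.const_mul
    (measurable_uncurry_phiIntegrand b).stronglyMeasurable.integral_prod_right.measurable _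

theorem conj_sinh_mul_sinh (hb : b.im = 0 ∨ ‖b‖ = 1) (w : ℂ) :
    conj (Complex.sinh (w * b) * Complex.sinh (w / b)) =
      Complex.sinh (conj w * b) * Complex.sinh (conj w / b) := by
  simp only [map_mul, ← Complex.sinh_conj, map_div₀]
  rcases hb with hb | hb
  · rw [Complex.conj_eq_iff_im.2 hb]
  · rw [← Complex.inv_eq_conj hb, div_inv_eq_mul, ← div_eq_mul_inv, mul_comm]

theorem conj_phiIntegrand (hb : b.im = 0 ∨ ‖b‖ = 1) (z u : ℝ) :
    conj (phiIntegrand b z u) = -phiIntegrand b z (-u) := by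
  have hw : conj ((u : ℂ) + (contourHeight b : ℂ) * Complex.I) =
      -(((-u : ℝ) : ℂ) + (contourHeight b : ℂ) * Complex.I) := by
    simp only [map_add, map_mul, Complex.conj_ofReal, Complex.conj_I, Complex.ofReal_neg]
    ring
  have hexp (w : ℂ) : conj (Complex.exp (-2 * Complex.I * (z : ℂ) * w)) =
      Complex.exp (-2 * Complex.I * (z : ℂ) * -conj w) := by
    simp [← Complex.exp_conj, Complex.conj_ofNat]
  rw [phiIntegrand, map_div₀, map_mul _ _ ((u : ℂ) + _), conj_sinh_mul_sinh hb, hexp, hw,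
    phiIntegrand]
  simp only [neg_mul, neg_div, neg_neg, Complex.sinh_neg, mul_neg, div_neg]

theorem re_integral_phiIntegrand (hb : b.im = 0 ∨ ‖b‖ = 1) (z : ℝ) :
    (∫ u, phiIntegrand b z u).re = 0 := by
  have hconj : conj (∫ u, phiIntegrand b z u) = -∫ u, phiIntegrand b z u := by
    rw [← integral_conj, funext (conj_phiIntegrand hb z), integral_neg,
      integral_neg_eq_self (phiIntegrand b z) volume]
  have hre := congrArg Complex.re hconj
  rw [Complex.conj_re, Complex.neg_re] at hre
  linarith

theorem norm_phi (hb : b.im = 0 ∨ ‖b‖ = 1) (z : ℝ) : ‖phi b z‖ = 1 := by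
  rw [phi_eq, Complex.norm_exp, Complex.mul_re, re_integral_phiIntegrand hb]
  norm_num

theorem norm_phi_inv (hb : b.im = 0 ∨ ‖b‖ = 1) (z : ℝ) : ‖(phi b z)⁻¹‖ = 1 := by
  rw [norm_inv, norm_phi hb, inv_one]

theorem im_add_inv (hb : b.im = 0 ∨ ‖b‖ = 1) : (b + b⁻¹).im = 0 := by
  rcases hb with hb | hb
  · simp [hb]
  · simp [Complex.inv_eq_conj hb]

theorem norm_zetaPow (hb : b.im = 0 ∨ ‖b‖ = 1) (x : ℝ) : ‖zetaPow b x‖ = 1 := by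
  have hre : b + b⁻¹ = ((b + b⁻¹).re : ℂ) := Complex.ext rfl (im_add_inv hb)
  rw [zetaPow, hre, show -(Complex.I * (Real.pi : ℂ) * ((b + b⁻¹).re : ℂ) ^ 2 / 12) * (x : ℂ) =
    ((-(Real.pi * (b + b⁻¹).re ^ 2 / 12 * x) : ℝ) : ℂ) * Complex.I by push_cast; ring,
    Complex.norm_exp_ofReal_mul_I]

theorem zetaPow_mul_neg (b : ℂ) (x : ℝ) : zetaPow b x * zetaPow b (-x) = 1 := by
  rw [zetaPow, zetaPow, ← Complex.exp_add, Complex.ofReal_neg, mul_neg, add_neg_cancel,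
    Complex.exp_zero]

end Dilogarithm

/-! ## Ordered products -/

section OrderedProducts

variable {M M' : Type*} [Monoid M] [Monoid M']

theorem prodUpTo_zero (F : ℕ → M) : prodUpTo 0 F = 1 := rfl

theorem prodUpTo_succ (n : ℕ) (F : ℕ → M) : prodUpTo (n + 1) F = prodUpTo n F * F (n + 1) := by
  simp [prodUpTo, List.range_succ]

theorem prodUpTo_succ' (n : ℕ) (F : ℕ → M) :
    prodUpTo (n + 1) F = F 1 * prodUpTo n fun i => F (i + 1) := by
  simp [prodUpTo, List.range_succ_eq_map, Function.comp_def]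

theorem map_prodUpTo (φ : M →* M') (n : ℕ) (F : ℕ → M) :
    φ (prodUpTo n F) = prodUpTo n fun i => φ (F i) := by
  simp [prodUpTo, map_list_prod, Function.comp_def]

theorem prodUpTo_congr {n : ℕ} {F G : ℕ → M} (h : ∀ i, 1 ≤ i → i ≤ n → F i = G i) :
    prodUpTo n F = prodUpTo n G :=
  congrArg List.prod <| List.map_congr_left fun _ hi =>
    h _ (Nat.le_add_left 1 _) (List.mem_range.1 hi)

theorem prodUpTo_one (n : ℕ) : prodUpTo n (fun _ => (1 : M)) = 1 := by
  simp [prodUpTo]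

theorem prodUpTo_mem {S : Type*} [SetLike S M] [SubmonoidClass S M] (s : S) {n : ℕ} {F : ℕ → M}
    (h : ∀ i, 1 ≤ i → i ≤ n → F i ∈ s) : prodUpTo n F ∈ s :=
  list_prod_mem fun _ hx => by
    obtain ⟨i, hi, rfl⟩ := List.mem_map.1 hx
    exact h _ (Nat.le_add_left 1 i) (List.mem_range.1 hi)

theorem prodUpTo_semiconjBy {n : ℕ} {F : ℕ → M} (X : ℕ → M)
    (h : ∀ i < n, SemiconjBy (F (i + 1)) (X (i + 1)) (X i)) :
    SemiconjBy (prodUpTo n F) (X n) (X 0) := by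
  induction n with
  | zero => exact SemiconjBy.one_left _
  | succ n ih =>
    rw [prodUpTo_succ]
    exact (ih fun i hi => h i (by lia)).mul_left (h n (by lia))

theorem prodUpTo_commute {n : ℕ} {F : ℕ → M} {x : M}
    (h : ∀ i, 1 ≤ i → i ≤ n → Commute (F i) x) : Commute (prodUpTo n F) x :=
  prodUpTo_semiconjBy (fun _ => x) fun i hi => h _ (by lia) (by lia)

theorem prodUpTo_semiconjBy_single {n : ℕ} {F : ℕ → M} {x y : M} (m : ℕ) (hm : 1 ≤ m)
    (hmn : m ≤ n) (h : SemiconjBy (F m) x y)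
    (hx : ∀ i, 1 ≤ i → i ≤ n → i ≠ m → Commute (F i) x)
    (hy : ∀ i, 1 ≤ i → i ≤ n → i ≠ m → Commute (F i) y) : SemiconjBy (prodUpTo n F) x y := by
  have hprod := prodUpTo_semiconjBy (n := n) (F := F)
      (fun i => if m ≤ i then x else y) fun i hi => by
    rcases lt_trichotomy (i + 1) m with him | him | him
    · rw [if_neg (by lia), if_neg (by lia)]
      exact hy _ (by lia) (by lia) (by lia)
    · rw [if_pos (by lia), if_neg (by lia), him]
      exact h
    · rw [if_pos (by lia), if_pos (by lia)]
      exact hx _ (by lia) (by lia) (by lia)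
  rwa [if_pos hmn, if_neg (by lia)] at hprod

theorem prodUpTo_mul {n : ℕ} {F G : ℕ → M}
    (h : ∀ i j, 1 ≤ i → i ≤ n → 1 ≤ j → j ≤ n → i ≠ j → Commute (F i) (G j)) :
    prodUpTo n (fun i => F i * G i) = prodUpTo n F * prodUpTo n G := by
  induction n with
  | zero => simp only [prodUpTo_zero, one_mul]
  | succ n ih =>
    have hcomm : Commute (prodUpTo n G) (F (n + 1)) := prodUpTo_commute fun i hi hin =>
      (h (n + 1) i (by lia) le_rfl hi (by lia) (by lia)).symm
    rw [prodUpTo_succ, prodUpTo_succ, prodUpTo_succ,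
      ih fun i j hi hin hj hjn => h i j hi (by lia) hj (by lia), hcomm.mul_mul_mul_comm]

theorem prodUpTo_mul_eq_one {n : ℕ} {F G : ℕ → M}
    (h : ∀ i j, 1 ≤ i → i ≤ n → 1 ≤ j → j ≤ n → i ≠ j → Commute (F i) (G j))
    (h1 : ∀ i, 1 ≤ i → i ≤ n → F i * G i = 1) : prodUpTo n F * prodUpTo n G = 1 := by
  rw [← prodUpTo_mul h, prodUpTo_congr h1, prodUpTo_one]

theorem prodUpTo_semiconjBy_prodUpTo {n : ℕ} {F G : ℕ → M} {x : M}
    (h : ∀ i, SemiconjBy x (F i) (G i)) : SemiconjBy x (prodUpTo n F) (prodUpTo n G) := by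
  induction n with
  | zero => exact SemiconjBy.one_right x
  | succ n ih =>
    rw [prodUpTo_succ, prodUpTo_succ]
    exact ih.mul_right (h _)

theorem prodUpTo_inv {G : Type*} [Group G] {n : ℕ} {F : ℕ → G} (h : ∀ i j, Commute (F i) (F j)) :
    prodUpTo n (fun i => (F i)⁻¹) = (prodUpTo n F)⁻¹ :=
  eq_inv_of_mul_eq_one_left <|
    prodUpTo_mul_eq_one (fun i j _ _ _ _ _ => (h i j).inv_left) fun _ _ _ => inv_mul_cancel _

theorem prodUpTo_shift {n : ℕ} {F : ℕ → M} (hc : ∀ i j, Commute (F i) (F j))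
    (hF : F (n + 1) = F 1) (hunit : IsUnit (F 1)) :
    prodUpTo n (fun i => F (i + 1)) = prodUpTo n F := by
  refine hunit.mul_left_cancel ?_
  rw [← prodUpTo_succ', prodUpTo_succ, hF]
  exact prodUpTo_commute fun i _ _ => hc i 1

end OrderedProducts

/-! ## Functions of commuting diagonalized operators -/

namespace SchwartzUnitary

variable {E : Type*} [NormedAddCommGroup E] [InnerProductSpace ℝ E] [FiniteDimensional ℝ E]
  [MeasurableSpace E] [BorelSpace E] {R S T : Module.End ℂ 𝓢(E, ℂ)} {g h : SchwartzUnitary E}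

theorem semiconjBy_mul (hg : SemiconjBy (core g).val S T) (hh : SemiconjBy (core h).val R S) :
    SemiconjBy (core (g * h)).val R T := by
  rw [map_mul, Units.val_mul]
  exact hg.mul_left hh

theorem semiconjBy_inv (hg : SemiconjBy (core g).val S T) : SemiconjBy (core g⁻¹).val T S := by
  rw [map_inv]
  exact hg.units_inv_symm_left

end SchwartzUnitary

section JointDiagonalization

variable {E : Type*} [NormedAddCommGroup E] [InnerProductSpace ℝ E] [FiniteDimensional ℝ E]
  [MeasurableSpace E] [BorelSpace E] {S T : Module.End ℂ 𝓢(E, ℂ)} {g : SchwartzUnitary E}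
  {a c : E → ℝ}

namespace DiagonalizedOnCore

theorem add (h : DiagonalizedOnCore T g a) (h' : DiagonalizedOnCore S g c) :
    DiagonalizedOnCore (T + S) g (a + c) where
  temperate := h.temperate.add h'.temperate
  semiconj := by
    have hsum := SemiconjBy.add_right h.semiconj h'.semiconj
    rw [← mulCore_add (hasTemperateGrowth_coe h.temperate)
      (hasTemperateGrowth_coe h'.temperate)] at hsum
    simpa only [Pi.add_apply, Complex.ofReal_add] using! hsum

theorem mul (h : DiagonalizedOnCore T g a) (h' : DiagonalizedOnCore S g c) :
    DiagonalizedOnCore (T * S) g (a * c) where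
  temperate := h.temperate.mul h'.temperate
  semiconj := by
    have hprod := h.semiconj.mul_right h'.semiconj
    rw [mulCore_mul (hasTemperateGrowth_coe h.temperate)
      (hasTemperateGrowth_coe h'.temperate)] at hprod
    simpa only [Pi.mul_apply, Complex.ofReal_mul] using! hprod

theorem neg (h : DiagonalizedOnCore T g a) : DiagonalizedOnCore (-T) g (-a) where
  temperate := h.temperate.neg
  semiconj := by
    have hneg := SemiconjBy.neg_right h.semiconj
    rw [← neg_one_smul ℂ (mulCore _), ← mulCore_smul (hasTemperateGrowth_coe h.temperate)] at hneg
    simpa using! hneg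

theorem zero (g : SchwartzUnitary E) : DiagonalizedOnCore 0 g 0 where
  temperate := .const 0
  semiconj := by
    have hzero : (mulCore fun x : E => ((0 : E → ℝ) x : ℂ)) = 0 := by
      simpa using! mulCore_const (E := E) 0
    rw [hzero]
    exact SemiconjBy.zero_right _

theorem sum {ι : Type*} (s : Finset ι) {T : ι → Module.End ℂ 𝓢(E, ℂ)} {a : ι → E → ℝ}
    (h : ∀ i, DiagonalizedOnCore (T i) g (a i)) :
    DiagonalizedOnCore (∑ i ∈ s, T i) g (∑ i ∈ s, a i) := by
  classical
  induction s using Finset.induction_on with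
  | empty => exact zero g
  | insert i s hi ih =>
    rw [Finset.sum_insert hi, Finset.sum_insert hi]
    exact (h i).add ih

end DiagonalizedOnCore

theorem diagonalizedOnCore_position (v : E) :
    DiagonalizedOnCore (position v) 1 (fun x => inner ℝ x v) :=
  diagonalizedOnCore_mulCore (hasTemperateGrowth_inner_left v)

theorem diagonalizedOnCore_momentum (v : E) :
    DiagonalizedOnCore (momentum v) (fourierUnitary E) (fun x => inner ℝ x v) :=
  ⟨hasTemperateGrowth_inner_left v, semiconjBy_fourierUnitary_momentum v⟩

variable {N : ℕ} [NeZero N]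

namespace DiagonalizedOnCore

variable {S T : Module.End ℂ (Core N)} {g : SchwartzUnitary (Config N)} {a c : Config N → ℝ}

theorem fc_mul_fc_eq_one (h : DiagonalizedOnCore T g a) {G G' : boundedMeasurable ℝ}
    (hG : G * G' = 1) : fc G.1 T * fc G'.1 T = 1 := by
  rw [h.fc_eq, h.fc_eq, ← map_mul, hG, map_one]

theorem commute_fc (h : DiagonalizedOnCore T g a) (h' : DiagonalizedOnCore S g c)
    (G G' : boundedMeasurable ℝ) : Commute (fc G.1 T) (fc G'.1 S) := by
  rw [h.fc_eq, h'.fc_eq]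
  exact ((Commute.all _ _).map (boundedMeasurable.mulRep volume)).map
    g.iso.symm.conjStarAlgEquiv

theorem fc_neg (h : DiagonalizedOnCore T g a) (G : boundedMeasurable ℝ) :
    fc G.1 (-T) = fc (fun t => G.1 (-t)) T :=
  (h.neg.fc_eq G).trans (h.fc_eq (boundedMeasurable.comp Neg.neg measurable_neg G)).symm

end DiagonalizedOnCore

theorem diagonalizedOnCore_q (k : ZMod (2 * N)) :
    DiagonalizedOnCore (q k) 1 (fun x : Config N => inner ℝ x (EuclideanSpace.single k 1)) := by
  rw [q_eq_position]
  exact diagonalizedOnCore_position _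

theorem diagonalizedOnCore_p (k : ZMod (2 * N)) :
    DiagonalizedOnCore (p k) (fourierUnitary (Config N))
      (fun x => inner ℝ x (EuclideanSpace.single k 1)) :=
  diagonalizedOnCore_momentum _

end JointDiagonalization

/-! ## The operators `A_k` -/

section OperatorA

variable {N : ℕ} [NeZero N]

open scoped FourierTransform

theorem semiconjBy_coordChirp_p_self (c : ℝ) (k : ZMod (2 * N)) :
    SemiconjBy (core (coordChirp c k k)).val (p k) (p k - (2 * c : ℂ) • q k) := by
  have h := semiconjBy_coordChirp_p c k k k
  rwa [if_pos rfl, ← two_smul ℂ (q k : Module.End ℂ (Core N)), smul_smul, mul_comm (c : ℂ)] at h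

theorem commute_coordChirp_p (c : ℝ) {j k l : ZMod (2 * N)} (hk : j ≠ k) (hl : j ≠ l) :
    Commute (core (coordChirp c k l)).val (p j) := by
  have h := semiconjBy_coordChirp_p c k l j
  rwa [if_neg hk, if_neg hl, add_zero, smul_zero, sub_zero] at h

theorem semiconjBy_coordChirp_half_p (k : ZMod (2 * N)) :
    SemiconjBy (core (coordChirp (1 / 2) k k)).val (p k) (p k - q k) := by
  have h := semiconjBy_coordChirp_p_self (1 / 2) k
  have hc : 2 * ((1 / 2 : ℝ) : ℂ) = 1 := by norm_num
  rwa [hc, one_smul] at h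

/-- The unitary operator that diagonalizes `p_k + q_k`. -/
def fourierChirp (k : ZMod (2 * N)) : SchwartzUnitary (Config N) :=
  fourierUnitary (Config N) * coordChirp (1 / 2) k k

theorem semiconjBy_fourierChirp_p (k : ZMod (2 * N)) :
    SemiconjBy (core (fourierChirp k)).val (p k) (p k + q k) := by
  have h := semiconjBy_mul
    (SemiconjBy.sub_right (semiconjBy_fourierUnitary_p k) (semiconjBy_fourierUnitary_q k))
    (semiconjBy_coordChirp_half_p k)
  rwa [sub_neg_eq_add, add_comm] at h

theorem semiconjBy_fourierChirp_q (j k : ZMod (2 * N)) :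
    SemiconjBy (core (fourierChirp k)).val (q j) (-p j) :=
  semiconjBy_mul (semiconjBy_fourierUnitary_q j) (commute_coordChirp_q _ k k j)

theorem semiconjBy_fourierChirp_p_of_ne {j k : ZMod (2 * N)} (h : j ≠ k) :
    SemiconjBy (core (fourierChirp k)).val (p j) (q j) :=
  semiconjBy_mul (semiconjBy_fourierUnitary_p j) (commute_coordChirp_p _ h h)

theorem diagonalizedOnCore_p_add_q (k : ZMod (2 * N)) :
    DiagonalizedOnCore (p k + q k) (fourierChirp k)
      (fun x => inner ℝ x (EuclideanSpace.single k 1)) where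
  temperate := hasTemperateGrowth_inner_left _
  semiconj := by
    have h := SemiconjBy.add_right (semiconjBy_fourierChirp_p k) (semiconjBy_fourierChirp_q k k)
    rw [add_neg_cancel_comm] at h
    exact (q_eq_position k) ▸ h

/-- The unitary operator `A_k`. -/
def unitaryA (k : ZMod (2 * N)) : SchwartzUnitary (Config N) :=
  phaseMul (fun _ => -1 / 6) (.const _) *
    (coordChirp (3 / 2) k k * ((fourierChirp k)⁻¹ * coordChirp (1 / 2) k k * fourierChirp k))

theorem exp_mul_sq_eq_fourierChar {z : ℂ} (c t : ℝ) (hz : z = 2 * Real.pi * Complex.I * c) :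
    Complex.exp (z * (t : ℂ) ^ 2) = 𝐞 (c * (t * t)) := by
  rw [Real.fourierChar_apply, hz]
  push_cast
  ring_nf

theorem hasTemperateGrowth_const_mul_mul_self (c : ℝ) :
    (fun t : ℝ => c * (t * t)).HasTemperateGrowth := by
  fun_prop

theorem coordChirp_self (c : ℝ) (k : ZMod (2 * N)) :
    coordChirp c k k = phaseMul
      ((fun t => c * (t * t)) ∘ fun x : Config N => inner ℝ x (EuclideanSpace.single k 1))
      ((hasTemperateGrowth_const_mul_mul_self c).comp (hasTemperateGrowth_inner_left _)) := rfl

theorem fc_gaussian_q (k : ZMod (2 * N)) :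
    fc (fun x => Complex.exp (3 * (Real.pi : ℂ) * Complex.I * (x : ℂ) ^ 2)) (q k) =
      op (coordChirp (3 / 2) k k) := by
  have hchar := funext fun t =>
    exp_mul_sq_eq_fourierChar (z := 3 * Real.pi * Complex.I) (3 / 2) t (by push_cast; ring)
  rw [coordChirp_self, hchar]
  refine ((diagonalizedOnCore_q k).fc_fourierChar_comp
    (hasTemperateGrowth_const_mul_mul_self _)).trans (congrArg op ?_)
  rw [inv_one, one_mul, mul_one]

theorem fc_gaussian_p_add_q (k : ZMod (2 * N)) :
    fc (fun x => Complex.exp ((Real.pi : ℂ) * Complex.I * (x : ℂ) ^ 2)) (p k + q k) =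
      op ((fourierChirp k)⁻¹ * coordChirp (1 / 2) k k * fourierChirp k) := by
  have hchar := funext fun t =>
    exp_mul_sq_eq_fourierChar (z := Real.pi * Complex.I) (1 / 2) t (by push_cast; ring)
  rw [coordChirp_self, hchar]
  exact (diagonalizedOnCore_p_add_q k).fc_fourierChar_comp
    (hasTemperateGrowth_const_mul_mul_self _)

theorem op_unitaryA (k : ZMod (2 * N)) : op (unitaryA k) = A k := by
  have hphase : (𝐞 (-1 / 6) : ℂ) = Complex.exp (-(Complex.I * Real.pi / 3)) := by
    rw [Real.fourierChar_apply]
    push_cast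
    ring_nf
  have hfc := congrArg₂ (· * ·) (fc_gaussian_q k).symm (fc_gaussian_p_add_q k).symm
  have hscalar := (op_phaseMul_const (E := Config N) (-1 / 6)).trans (congrArg (· • 1) hphase)
  refine (map_mul op _ _).trans ?_
  exact (congrArg₂ (· * ·) hscalar ((map_mul op _ _).trans hfc)).trans (smul_one_mul _ _)

theorem semiconjBy_unitaryA {k : ZMod (2 * N)} {S T R R' S' : Module.End ℂ (Core N)}
    (hST : SemiconjBy (core (fourierChirp k)).val S T)
    (hTR : SemiconjBy (core (coordChirp (1 / 2) k k)).val T R)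
    (hRR' : SemiconjBy (core (fourierChirp k)).val R' R)
    (hRS' : SemiconjBy (core (coordChirp (3 / 2) k k)).val R' S') :
    SemiconjBy (core (unitaryA k)).val S S' :=
  semiconjBy_mul (commute_core_phaseMul_const _ _) <| semiconjBy_mul hRS' <|
    semiconjBy_mul (semiconjBy_mul (semiconjBy_inv hRR') hTR) hST

theorem semiconjBy_unitaryA_p (k : ZMod (2 * N)) :
    SemiconjBy (core (unitaryA k)).val (p k) (-q k) := by
  have hchirp : SemiconjBy (core (coordChirp (1 / 2) k k)).val (p k + q k) (p k) := by
    have h := SemiconjBy.add_right (semiconjBy_coordChirp_half_p k) (commute_coordChirp_q _ k k k)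
    rwa [sub_add_cancel] at h
  have hfourier := (semiconjBy_fourierChirp_q k k).neg_right
  rw [neg_neg] at hfourier
  exact semiconjBy_unitaryA (semiconjBy_fourierChirp_p k) hchirp hfourier
    (SemiconjBy.neg_right (commute_coordChirp_q _ k k k))

theorem semiconjBy_unitaryA_q (k : ZMod (2 * N)) :
    SemiconjBy (core (unitaryA k)).val (q k) (p k - q k) := by
  have hfourier : SemiconjBy (core (fourierChirp k)).val (q k + (p k + q k)) (-(p k - q k)) := by
    have h := SemiconjBy.add_right (semiconjBy_fourierChirp_q k k)
      (diagonalizedOnCore_p_add_q k).semiconj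
    rw [neg_sub, sub_eq_neg_add, q_eq_position]
    rw [q_eq_position] at h
    exact h
  have hchirp : SemiconjBy (core (coordChirp (3 / 2) k k)).val (q k + (p k + q k)) (p k - q k) := by
    have hq := commute_coordChirp_q (3 / 2) k k k
    have h := SemiconjBy.add_right hq (SemiconjBy.add_right (semiconjBy_coordChirp_p_self _ k) hq)
    convert! h using 1
    push_cast
    module
  exact semiconjBy_unitaryA (semiconjBy_fourierChirp_q k k)
    (semiconjBy_coordChirp_half_p k).neg_right hfourier hchirp

theorem commute_unitaryA_p {j k : ZMod (2 * N)} (h : j ≠ k) :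
    Commute (core (unitaryA k)).val (p j) :=
  have hp := semiconjBy_fourierChirp_p_of_ne h
  semiconjBy_unitaryA hp (commute_coordChirp_q _ k k j) hp (commute_coordChirp_p _ h h)

theorem commute_unitaryA_q {j k : ZMod (2 * N)} (h : j ≠ k) :
    Commute (core (unitaryA k)).val (q j) :=
  have hq := semiconjBy_fourierChirp_q j k
  semiconjBy_unitaryA hq (SemiconjBy.neg_right (commute_coordChirp_p _ h h)) hq
    (commute_coordChirp_q _ k k j)

theorem commute_unitaryA (k l : ZMod (2 * N)) :
    Commute (unitaryA k : SchwartzUnitary (Config N)) (unitaryA l) := by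
  rcases eq_or_ne l k with rfl | h
  · exact Commute.refl _
  have hq := (diagonalizedOnCore_q l).commute_conj_phaseMul (commute_unitaryA_q h)
    (hasTemperateGrowth_const_mul_mul_self (3 / 2))
  have hpq := (diagonalizedOnCore_p_add_q l).commute_conj_phaseMul
    (SemiconjBy.add_right (commute_unitaryA_p h) (commute_unitaryA_q h))
    (hasTemperateGrowth_const_mul_mul_self (1 / 2))
  rw [inv_one, one_mul, mul_one] at hq
  exact (commute_phaseMul_const _ _).mul_right (hq.mul_right hpq)

end OperatorA

/-! ## Labels modulo `2N` -/

section Labels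

theorem exists_natCast_mem_Icc {n : ℕ} [NeZero n] (j : ZMod n) :
    ∃ m ∈ Finset.Icc 1 n, (m : ZMod n) = j := by
  refine ⟨(j - 1).val + 1, Finset.mem_Icc.2 ⟨by lia, (j - 1).val_lt⟩, ?_⟩
  rw [Nat.cast_succ, ZMod.natCast_zmod_val, sub_add_cancel]

theorem natCast_injOn_Icc (n : ℕ) : Set.InjOn (Nat.cast : ℕ → ZMod n) (Finset.Icc 1 n) := by
  intro l hl m hm h
  rw [Finset.coe_Icc, Set.mem_Icc] at hl hm
  exact ((ZMod.natCast_eq_natCast_iff _ _ _).1 h).eq_of_abs_lt (by rw [abs_lt]; lia)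

variable {N : ℕ}

theorem two_mul_natCast_inj {l m : ℕ} (hl : l ∈ Finset.Icc 1 N) (hm : m ∈ Finset.Icc 1 N)
    (h : (2 * (l : ZMod (2 * N)) : ZMod (2 * N)) = 2 * (m : ZMod (2 * N))) : l = m := by
  rw [Finset.mem_Icc] at hl hm
  have h2 : 2 * l = 2 * m := natCast_injOn_Icc (2 * N) (Finset.mem_Icc.2 (by lia))
    (Finset.mem_Icc.2 (by lia)) (by exact_mod_cast h)
  lia

theorem two_mul_add_one_ne (l m : ZMod (2 * N)) : 2 * l + 1 ≠ 2 * m := fun h => by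
  have h2 := congrArg (ZMod.castHom (Dvd.intro N rfl) (ZMod 2)) h
  rw [map_add, map_mul, map_mul, map_one, map_ofNat, show (OfNat.ofNat 2 : ZMod 2) = 0 from rfl,
    zero_mul, zero_mul, zero_add] at h2
  exact one_ne_zero h2

variable [NeZero N]

theorem even_val_iff (j : ZMod (2 * N)) :
    Even j.val ↔ ZMod.castHom (Dvd.intro N rfl) (ZMod 2) j = 0 := by
  rw [← ZMod.natCast_eq_zero_iff_even, ← map_natCast (ZMod.castHom (Dvd.intro N rfl) (ZMod 2)),
    ZMod.natCast_zmod_val]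

theorem even_val_two_mul (j : ZMod (2 * N)) : Even (2 * j).val := by
  rw [even_val_iff, map_mul, map_ofNat, show (OfNat.ofNat 2 : ZMod 2) = 0 from rfl, zero_mul]

theorem not_even_val_add_one (j : ZMod (2 * N)) : ¬Even (j + 1).val ↔ Even j.val := by
  rw [even_val_iff, even_val_iff, map_add, map_one]
  generalize ZMod.castHom (Dvd.intro N rfl) (ZMod 2) j = x
  revert x
  decide

theorem even_val_sub_one (j : ZMod (2 * N)) : Even (j - 1).val ↔ ¬Even j.val := by
  rw [← not_even_val_add_one, sub_add_cancel]

theorem exists_eq_two_mul {j : ZMod (2 * N)} (hj : Even j.val) :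
    ∃ m ∈ Finset.Icc 1 N, j = 2 * (m : ZMod (2 * N)) := by
  obtain ⟨n, hn, rfl⟩ := exists_natCast_mem_Icc j
  rw [ZMod.val_natCast, Nat.even_iff, Nat.mod_mod_of_dvd _ (Dvd.intro N rfl)] at hj
  obtain ⟨m, rfl⟩ := Nat.dvd_of_mod_eq_zero hj
  rw [Finset.mem_Icc] at hn
  exact ⟨m, Finset.mem_Icc.2 (by lia), by push_cast; rfl⟩

end Labels

/-! ## The operators `exp (2πi p_k p_l)` -/

section MomentumChirp

variable {N : ℕ} [NeZero N]

open scoped FourierTransform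

/-- The unitary operator `exp (2πi p_k p_l)`. -/
def momentumChirp (k l : ZMod (2 * N)) : SchwartzUnitary (Config N) :=
  (MulAut.conj (fourierUnitary (Config N))).symm (coordChirp 1 k l)

theorem coordChirp_one (k l : ZMod (2 * N)) :
    coordChirp 1 k l = phaseMul ((fun x : Config N => inner ℝ x (EuclideanSpace.single k 1)) *
      fun x => inner ℝ x (EuclideanSpace.single l 1))
      ((hasTemperateGrowth_inner_left _).mul (hasTemperateGrowth_inner_left _)) := by
  simp only [coordChirp, chirp, one_mul]
  rfl

theorem momentumChirp_comm (k l : ZMod (2 * N)) :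
    (momentumChirp k l : SchwartzUnitary (Config N)) = momentumChirp l k := by
  simp only [momentumChirp, coordChirp_one, mul_comm]

theorem commute_momentumChirp (k l k' l' : ZMod (2 * N)) :
    Commute (momentumChirp k l : SchwartzUnitary (Config N)) (momentumChirp k' l') :=
  (commute_coordChirp 1 1 k l k' l').map _

theorem semiconjBy_momentumChirp {k l : ZMod (2 * N)} {S S' T T' : Module.End ℂ (Core N)}
    (hS : SemiconjBy (core (fourierUnitary (Config N))).val S T)
    (hT : SemiconjBy (core (coordChirp 1 k l)).val T T')
    (hS' : SemiconjBy (core (fourierUnitary (Config N))).val S' T') :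
    SemiconjBy (core (momentumChirp k l)).val S S' :=
  semiconjBy_mul (semiconjBy_mul (semiconjBy_inv hS') hT) hS

theorem commute_momentumChirp_p (k l j : ZMod (2 * N)) :
    Commute (core (momentumChirp k l)).val (p j) :=
  semiconjBy_momentumChirp (semiconjBy_fourierUnitary_p j) (commute_coordChirp_q 1 k l j)
    (semiconjBy_fourierUnitary_p j)

theorem semiconjBy_momentumChirp_q (k l j : ZMod (2 * N)) :
    SemiconjBy (core (momentumChirp k l)).val (q j)
      (q j + ((if j = k then p l else 0) + if j = l then p k else 0)) := by
  have hite (P : Prop) [Decidable P] (i : ZMod (2 * N)) :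
      SemiconjBy (core (fourierUnitary (Config N))).val (if P then p i else 0)
        (if P then q i else 0) := by
    split_ifs
    exacts [semiconjBy_fourierUnitary_p i, SemiconjBy.zero_right _]
  refine semiconjBy_momentumChirp (semiconjBy_fourierUnitary_q j)
    (semiconjBy_coordChirp_p 1 k l j).neg_right ?_
  rw [Complex.ofReal_one, one_smul, neg_sub, sub_eq_neg_add]
  exact SemiconjBy.add_right (semiconjBy_fourierUnitary_q j)
    (SemiconjBy.add_right (hite _ l) (hite _ k))

theorem commute_momentumChirp_q {k l j : ZMod (2 * N)} (hk : j ≠ k) (hl : j ≠ l) :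
    Commute (core (momentumChirp k l)).val (q j) := by
  have h := semiconjBy_momentumChirp_q k l j
  rwa [if_neg hk, if_neg hl, add_zero, add_zero] at h

theorem semiconjBy_momentumChirp_q_add_q {k l : ZMod (2 * N)} (h : k ≠ l) :
    SemiconjBy (core (momentumChirp k l)).val (q k + q l - p k - p l) (q k + q l) := by
  have hq := SemiconjBy.add_right (semiconjBy_momentumChirp_q k l k)
    (semiconjBy_momentumChirp_q k l l)
  have hqp := SemiconjBy.sub_right (SemiconjBy.sub_right hq (commute_momentumChirp_p k l k))
    (commute_momentumChirp_p k l l)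
  rw [if_pos rfl, if_neg h, if_neg h.symm, if_pos rfl] at hqp
  convert! hqp using 1
  abel

theorem exp_two_pi_mul (x : ℝ) :
    Complex.exp (2 * (Real.pi : ℂ) * Complex.I * (x : ℂ)) = 𝐞 x := by
  rw [Real.fourierChar_apply]
  push_cast
  ring_nf

theorem exp_neg_two_pi_mul (x : ℝ) :
    Complex.exp (-(2 * (Real.pi : ℂ) * Complex.I * (x : ℂ))) = 𝐞 (-x) := by
  rw [Real.fourierChar_apply]
  push_cast
  ring_nf

theorem fc_exp_neg_p_mul_p (k l : ZMod (2 * N)) :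
    fc (fun x => Complex.exp (-(2 * (Real.pi : ℂ) * Complex.I * (x : ℂ)))) (p k * p l) =
      op (momentumChirp k l)⁻¹ := by
  have hd := (diagonalizedOnCore_p k).mul (diagonalizedOnCore_p l)
  have hinv := congrArg (MulAut.conj (fourierUnitary (Config N))).symm (phaseMul_neg hd.temperate)
  rw [funext exp_neg_two_pi_mul, momentumChirp, ← map_inv, coordChirp_one]
  exact (hd.fc_fourierChar_comp (s := fun x => -x) (by fun_prop)).trans (congrArg op hinv)

theorem prodUpTo_phaseMul (n : ℕ) {a : ℕ → Config N → ℝ} (ha : ∀ j, (a j).HasTemperateGrowth)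
    (hsum : (∑ j ∈ Finset.Icc 1 n, a j).HasTemperateGrowth) :
    prodUpTo n (fun j => phaseMul (a j) (ha j)) = phaseMul _ hsum := by
  induction n with
  | zero => exact phaseMul_zero.symm
  | succ n ih =>
    have hn : (∑ j ∈ Finset.Icc 1 n, a j).HasTemperateGrowth := by
      rw [Finset.sum_fn]
      exact .sum fun j _ => ha j
    rw [prodUpTo_succ, ih hn, phaseMul_mul]
    simp only [Finset.sum_Icc_succ_top (Nat.le_add_left 1 n)]

variable (N) in
/-- The unitary operator `exp (2πi ∑ p_{2j} p_{2j+1})`. -/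
def momentumChirpProd : SchwartzUnitary (Config N) :=
  prodUpTo N fun j => momentumChirp (2 * (j : ZMod (2 * N))) (2 * (j : ZMod (2 * N)) + 1)

theorem fc_exp_sum_p_mul_p :
    fc (fun x => Complex.exp (2 * (Real.pi : ℂ) * Complex.I * (x : ℂ)))
        (∑ j ∈ Finset.Icc 1 N,
          p (N := N) (2 * (j : ZMod (2 * N))) * p (2 * (j : ZMod (2 * N)) + 1)) =
      op (momentumChirpProd N) := by
  have hd := DiagonalizedOnCore.sum (Finset.Icc 1 N) fun j : ℕ =>
    (diagonalizedOnCore_p (N := N) (2 * (j : ZMod (2 * N)))).mul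
      (diagonalizedOnCore_p (2 * (j : ZMod (2 * N)) + 1))
  have hprod := map_prodUpTo (MulAut.conj (fourierUnitary (Config N))).symm.toMonoidHom N
    fun j => coordChirp 1 (2 * (j : ZMod (2 * N))) (2 * (j : ZMod (2 * N)) + 1)
  simp only [coordChirp_one, prodUpTo_phaseMul N _ hd.temperate] at hprod
  rw [funext exp_two_pi_mul]
  refine (hd.fc_fourierChar_comp (s := fun x => x) (by fun_prop)).trans (congrArg op ?_)
  simp only [momentumChirpProd, momentumChirp, coordChirp_one]
  exact hprod

theorem commute_momentumChirpProd_p (j : ZMod (2 * N)) :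
    Commute (core (momentumChirpProd N)).val (p j) := by
  rw [momentumChirpProd, ← Units.coeHom_apply, ← MonoidHom.comp_apply, map_prodUpTo]
  exact prodUpTo_commute fun i _ _ => commute_momentumChirp_p _ _ j

theorem semiconjBy_momentumChirpProd {k : ZMod (2 * N)} (hk : Even k.val) :
    SemiconjBy (core (momentumChirpProd N)).val (q k + q (k + 1) - p k - p (k + 1))
      (q k + q (k + 1)) := by
  obtain ⟨m, hm, rfl⟩ := exists_eq_two_mul hk
  have hq (i : ℕ) (hi : i ∈ Finset.Icc 1 N) (him : i ≠ m) :
      Commute (core (momentumChirp (2 * (i : ZMod (2 * N))) (2 * (i : ZMod (2 * N)) + 1))).val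
        (q (2 * (m : ZMod (2 * N))) + q (2 * (m : ZMod (2 * N)) + 1)) := by
    have hne : (2 * (m : ZMod (2 * N)) : ZMod (2 * N)) ≠ 2 * (i : ZMod (2 * N)) := fun h =>
      him (two_mul_natCast_inj hm hi h).symm
    exact SemiconjBy.add_right (commute_momentumChirp_q hne (two_mul_add_one_ne _ _).symm)
      (commute_momentumChirp_q (two_mul_add_one_ne _ _) fun h => hne (add_right_cancel h))
  rw [Finset.mem_Icc] at hm
  rw [momentumChirpProd, ← Units.coeHom_apply, ← MonoidHom.comp_apply, map_prodUpTo]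
  refine prodUpTo_semiconjBy_single m hm.1 hm.2
    (semiconjBy_momentumChirp_q_add_q (two_mul_add_one_ne _ _).symm) (fun i h1 h2 him => ?_)
    (fun i h1 h2 => hq i (Finset.mem_Icc.2 ⟨h1, h2⟩))
  exact SemiconjBy.sub_right (SemiconjBy.sub_right (hq i (Finset.mem_Icc.2 ⟨h1, h2⟩) him)
    (commute_momentumChirp_p _ _ _)) (commute_momentumChirp_p _ _ _)

end MomentumChirp

/-! ## The operator `κ(G)` -/

section OperatorG

variable {N : ℕ} [NeZero N]

variable (N) in
/-- The unitary operator `∏ A_k`. -/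
def unitaryAProd : SchwartzUnitary (Config N) :=
  prodUpTo (2 * N) fun k => unitaryA (k : ZMod (2 * N))

theorem op_unitaryAProd :
    op (unitaryAProd N) = prodUpTo (2 * N) fun k => A (N := N) (k : ZMod (2 * N)) := by
  simp only [unitaryAProd, map_prodUpTo, op_unitaryA]

theorem op_unitaryAProd_inv : op (unitaryAProd N)⁻¹ =
    prodUpTo (2 * N) fun k => Ring.inverse (A (N := N) (k : ZMod (2 * N))) := by
  rw [unitaryAProd, ← prodUpTo_inv fun _ _ => commute_unitaryA _ _, map_prodUpTo]
  simp only [← op_unitaryA, inverse_op]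

theorem semiconjBy_unitaryAProd {j : ZMod (2 * N)} {S T : Module.End ℂ (Core N)}
    (h : SemiconjBy (core (unitaryA j)).val S T)
    (hS : ∀ k, j ≠ k → Commute (core (unitaryA k)).val S)
    (hT : ∀ k, j ≠ k → Commute (core (unitaryA k)).val T) :
    SemiconjBy (core (unitaryAProd N)).val S T := by
  obtain ⟨m, hm, rfl⟩ := exists_natCast_mem_Icc j
  have hne (i : ℕ) (h1 : 1 ≤ i) (h2 : i ≤ 2 * N) (him : i ≠ m) :
      (m : ZMod (2 * N)) ≠ i := fun h =>
    him (natCast_injOn_Icc (2 * N) hm (Finset.mem_Icc.2 ⟨h1, h2⟩) h).symm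
  rw [Finset.mem_Icc] at hm
  rw [unitaryAProd, ← Units.coeHom_apply, ← MonoidHom.comp_apply, map_prodUpTo]
  exact prodUpTo_semiconjBy_single m hm.1 hm.2 h (fun i h1 h2 him => hS _ (hne i h1 h2 him))
    fun i h1 h2 him => hT _ (hne i h1 h2 him)

theorem semiconjBy_unitaryAProd_inv_q (j : ZMod (2 * N)) :
    SemiconjBy (core (unitaryAProd N)⁻¹).val (q j) (-p j) := by
  have h := semiconjBy_unitaryAProd (semiconjBy_unitaryA_p j) (fun _ => commute_unitaryA_p)
    fun _ hk => SemiconjBy.neg_right (commute_unitaryA_q hk)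
  simpa only [neg_neg] using! (semiconjBy_inv h).neg_right

theorem semiconjBy_unitaryAProd_inv_p (j : ZMod (2 * N)) :
    SemiconjBy (core (unitaryAProd N)⁻¹).val (p j) (q j - p j) := by
  have h := semiconjBy_unitaryAProd (semiconjBy_unitaryA_q j) (fun _ => commute_unitaryA_q)
    fun _ hk => SemiconjBy.sub_right (commute_unitaryA_p hk) (commute_unitaryA_q hk)
  simpa only [sub_add_cancel, ← sub_eq_add_neg] using!
    SemiconjBy.add_right (semiconjBy_inv h) (semiconjBy_unitaryAProd_inv_q j)

variable (N) in
/-- The operator `κ(G)` without its scalar factor. -/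
def unitaryG : SchwartzUnitary (Config N) :=
  momentumChirpProd N * (unitaryAProd N)⁻¹ * permUnitary (Equiv.subRight (1 : ZMod (2 * N)))

theorem kappaG_eq (b : ℂ) :
    kappaG N b = zetaPow b ((N : ℝ) + 6 / (N : ℝ)) • op (unitaryG N) := by
  simp only [unitaryG, op_mul, op_unitaryAProd_inv, op_permUnitary, ← fc_exp_sum_p_mul_p, kappaG]

theorem semiconjBy_unitaryG_p {j : ZMod (2 * N)} (hj : Even j.val) :
    SemiconjBy (core (unitaryG N)).val (p j + p (j - 1)) (q (j - 1) + q (j - 1 - 1)) := by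
  have hperm := SemiconjBy.add_right (semiconjBy_permUnitary_p (Equiv.subRight 1) j)
    (semiconjBy_permUnitary_p (Equiv.subRight 1) (j - 1))
  have hA := SemiconjBy.add_right (semiconjBy_unitaryAProd_inv_p (j - 1))
    (semiconjBy_unitaryAProd_inv_p (j - 1 - 1))
  have hE := semiconjBy_momentumChirpProd (k := j - 1 - 1)
    (by rwa [even_val_sub_one, even_val_sub_one, not_not])
  rw [sub_add_cancel, add_comm (q (j - 1 - 1))] at hE
  rw [show (q (j - 1) - p (j - 1) + (q (j - 1 - 1) - p (j - 1 - 1)) : Module.End ℂ (Core N)) =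
    q (j - 1) + q (j - 1 - 1) - p (j - 1 - 1) - p (j - 1) by abel] at hA
  exact semiconjBy_mul (semiconjBy_mul hE hA) hperm

theorem semiconjBy_unitaryG_q (j : ZMod (2 * N)) :
    SemiconjBy (core (unitaryG N)).val (q j + q (j - 1)) (-(p (j - 1) + p (j - 1 - 1))) := by
  have hperm := SemiconjBy.add_right (semiconjBy_permUnitary_q (Equiv.subRight 1) j)
    (semiconjBy_permUnitary_q (Equiv.subRight 1) (j - 1))
  have hA := SemiconjBy.add_right (semiconjBy_unitaryAProd_inv_q (j - 1))
    (semiconjBy_unitaryAProd_inv_q (j - 1 - 1))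
  have hE := SemiconjBy.neg_right <| SemiconjBy.add_right
    (commute_momentumChirpProd_p (j - 1)) (commute_momentumChirpProd_p (j - 1 - 1))
  rw [← neg_add] at hA
  exact semiconjBy_mul (semiconjBy_mul hE hA) hperm

end OperatorG

/-! ## The flip operators and the fractional Dehn twist -/

section Flips

variable {N : ℕ} [NeZero N] {b : ℂ}

/-- `φ_b` as a bounded measurable function. -/
def boundedPhi (hb : b.im = 0 ∨ ‖b‖ = 1) : boundedMeasurable ℝ :=
  boundedMeasurable.ofNormEqOne (phi b) (measurable_phi b) (norm_phi hb)

/-- `φ_b⁻¹` as a bounded measurable function. -/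
def boundedPhiInv (hb : b.im = 0 ∨ ‖b‖ = 1) : boundedMeasurable ℝ :=
  boundedMeasurable.ofNormEqOne (fun x => (phi b x)⁻¹) (measurable_phi b).inv (norm_phi_inv hb)

/-- `x ↦ exp (-2πi x)` as a bounded measurable function. -/
def boundedCharNeg : boundedMeasurable ℝ :=
  boundedMeasurable.ofNormEqOne
    (fun x => Complex.exp (-(2 * (Real.pi : ℂ) * Complex.I * (x : ℂ))))
    (by fun_prop) fun x => by rw [exp_neg_two_pi_mul, Circle.norm_coe]

theorem boundedCharNeg_neg (x : ℝ) :
    boundedCharNeg.1 (-x) = Complex.exp (2 * (Real.pi : ℂ) * Complex.I * (x : ℂ)) := by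
  simp only [boundedCharNeg, boundedMeasurable.ofNormEqOne, Complex.ofReal_neg, mul_neg, neg_neg]

theorem boundedPhi_mul_boundedPhiInv (hb : b.im = 0 ∨ ‖b‖ = 1) :
    boundedPhi hb * boundedPhiInv hb = 1 :=
  Subtype.ext (funext fun _ => mul_inv_cancel₀ (Complex.exp_ne_zero _))

theorem diagonalizedOnCore_q_add_q (k l : ZMod (2 * N)) :
    DiagonalizedOnCore (q k + q l) 1 ((fun x : Config N => inner ℝ x (EuclideanSpace.single k 1)) +
      fun x => inner ℝ x (EuclideanSpace.single l 1)) :=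
  (diagonalizedOnCore_q k).add (diagonalizedOnCore_q l)

theorem diagonalizedOnCore_p_add_p (k l : ZMod (2 * N)) :
    DiagonalizedOnCore (p k + p l) (fourierUnitary (Config N))
      ((fun x => inner ℝ x (EuclideanSpace.single k 1)) +
        fun x => inner ℝ x (EuclideanSpace.single l 1)) :=
  (diagonalizedOnCore_p k).add (diagonalizedOnCore_p l)

theorem fc_phi_inv_mem_unitary (hb : b.im = 0 ∨ ‖b‖ = 1) (k l : ZMod (2 * N)) :
    fc (fun x => (phi b x)⁻¹) (q k + q l) ∈ unitary (L2 N →L[ℂ] L2 N) :=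
  (diagonalizedOnCore_q_add_q k l).fc_mem_unitary (G := boundedPhiInv hb)
    (boundedMeasurable.ofNormEqOne_mem_unitary _ _)

theorem fc_phi_mul_fc_phi_inv (hb : b.im = 0 ∨ ‖b‖ = 1) (k l : ZMod (2 * N)) :
    fc (phi b) (q k + q l) * fc (fun x => (phi b x)⁻¹) (q k + q l) = 1 :=
  (diagonalizedOnCore_q_add_q k l).fc_mul_fc_eq_one (boundedPhi_mul_boundedPhiInv hb)

theorem Tcheck_eq (b : ℂ) (k l : ZMod (2 * N)) : Tcheck b k l =
    op (momentumChirp k l)⁻¹ * fc (fun x => (phi b x)⁻¹) (q k + q l) := by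
  rw [← fc_exp_neg_p_mul_p, Tcheck]

variable (N) in
/-- The product of the operators `φ_b(q_{2l+1} + q_{2l})⁻¹`. -/
def prodPhiInv (b : ℂ) : L2 N →L[ℂ] L2 N :=
  prodUpTo N fun l => fc (fun x => (phi b x)⁻¹)
    (q (N := N) (2 * (l : ZMod (2 * N)) + 1) + q (2 * (l : ZMod (2 * N))))

theorem prodUpTo_Tcheck (hb : b.im = 0 ∨ ‖b‖ = 1) :
    prodUpTo N (fun l => Tcheck b (2 * (l : ZMod (2 * N)) + 1) (2 * (l : ZMod (2 * N)))) =
      op (momentumChirpProd N)⁻¹ * prodPhiInv N b := by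
  have hinv : (momentumChirpProd N)⁻¹ = prodUpTo N fun l =>
      (momentumChirp (2 * (l : ZMod (2 * N)) + 1) (2 * (l : ZMod (2 * N))))⁻¹ := by
    rw [momentumChirpProd, ← prodUpTo_inv fun _ _ => commute_momentumChirp _ _ _ _]
    exact prodUpTo_congr fun l _ _ => congrArg _ (momentumChirp_comm _ _)
  rw [(congrArg op hinv).trans (map_prodUpTo op _ _)]
  refine (prodUpTo_congr fun l _ _ => Tcheck_eq b _ _).trans (prodUpTo_mul ?_)
  intro i j hi hiN hj hjN hij
  have hne : (2 * (j : ZMod (2 * N)) : ZMod (2 * N)) ≠ 2 * (i : ZMod (2 * N)) := fun h =>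
    hij (two_mul_natCast_inj (Finset.mem_Icc.2 ⟨hj, hjN⟩) (Finset.mem_Icc.2 ⟨hi, hiN⟩) h).symm
  exact (diagonalizedOnCore_q_add_q _ _).semiconjBy_fc (boundedPhiInv hb) <| semiconjBy_inv <|
    SemiconjBy.add_right
      (commute_momentumChirp_q (fun h => hne (add_right_cancel h)) (two_mul_add_one_ne _ _))
      (commute_momentumChirp_q (two_mul_add_one_ne _ _).symm hne)

theorem fracDehnOp_eq (hb : b.im = 0 ∨ ‖b‖ = 1) : fracDehnOp N b =
    zetaPow b (-(N : ℝ) - 6 / (N : ℝ)) • (op (unitaryG N)⁻¹ * prodPhiInv N b) := by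
  have hperm : (permUnitary (Equiv.subRight (1 : ZMod (2 * N))))⁻¹ =
      permUnitary (Equiv.addRight 1) :=
    (map_inv permUnitary (Equiv.subRight (1 : ZMod (2 * N)))).symm.trans
      (congrArg permUnitary (Equiv.ext fun _ => rfl))
  have hG : (unitaryG N)⁻¹ = permUnitary (Equiv.addRight (1 : ZMod (2 * N))) *
      unitaryAProd N * (momentumChirpProd N)⁻¹ := by
    simp only [unitaryG, mul_inv_rev, inv_inv, hperm, mul_assoc]
  simp only [fracDehnOp, prodUpTo_Tcheck hb, hG, op_mul, op_permUnitary, op_unitaryAProd, mul_assoc]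

theorem smul_mem_unitary {c : ℂ} (hc : ‖c‖ = 1) {X : L2 N →L[ℂ] L2 N} (hX : X ∈ unitary _) :
    c • X ∈ unitary (L2 N →L[ℂ] L2 N) := by
  refine Unitary.smul_mem_of_mem (Unitary.mem_iff_star_mul_self.2 ?_) hX
  rw [RCLike.star_def, Complex.conj_mul', hc, Complex.ofReal_one, one_pow]

theorem fracDehnOp_mem_unitary (hb : b.im = 0 ∨ ‖b‖ = 1) :
    fracDehnOp N b ∈ unitary (L2 N →L[ℂ] L2 N) := by
  rw [fracDehnOp_eq hb]
  exact smul_mem_unitary (norm_zetaPow hb _) (mul_mem (op_mem_unitary _)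
    (prodUpTo_mem _ fun _ _ _ => fc_phi_inv_mem_unitary hb _ _))

theorem kappaG_mem_unitary (hb : b.im = 0 ∨ ‖b‖ = 1) :
    kappaG N b ∈ unitary (L2 N →L[ℂ] L2 N) := by
  rw [kappaG_eq]
  exact smul_mem_unitary (norm_zetaPow hb _) (op_mem_unitary _)

theorem kappaG_mul_fracDehnOp (hb : b.im = 0 ∨ ‖b‖ = 1) :
    kappaG N b * fracDehnOp N b = prodPhiInv N b := by
  have hz : zetaPow b ((N : ℝ) + 6 / (N : ℝ)) * zetaPow b (-(N : ℝ) - 6 / (N : ℝ)) = 1 := by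
    rw [← neg_add', zetaPow_mul_neg]
  have hG : op (unitaryG N) * op (unitaryG N)⁻¹ = 1 := by
    simp only [← op_mul, mul_inv_cancel, map_one]
  rw [kappaG_eq, fracDehnOp_eq hb]
  refine (smul_mul_smul_comm _ _ _ _).trans ?_
  simp only [hz, one_smul, ← mul_assoc, hG, one_mul]

theorem semiconjBy_unitaryA_Tcheck (hb : b.im = 0 ∨ ‖b‖ = 1) {k l : ZMod (2 * N)} (hkl : k ≠ l) :
    SemiconjBy (op (unitaryA l)) (Tcheck b k l) (T b k l) := by
  have hneg : SemiconjBy (core (unitaryA k)).val (p k * q l) (-q k * q l) :=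
    SemiconjBy.mul_right (semiconjBy_unitaryA_p k) (commute_unitaryA_q hkl.symm)
  have hd := ((diagonalizedOnCore_q k).neg.mul (diagonalizedOnCore_q l)).conj hneg
  have hpp : SemiconjBy (core (unitaryA l)).val (p k * p l) (-(p k * q l)) := by
    rw [← mul_neg]
    exact SemiconjBy.mul_right (commute_unitaryA_p hkl) (semiconjBy_unitaryA_p l)
  have hqq : SemiconjBy (core (unitaryA l)).val (q k + q l) (q k + p l - q l) := by
    rw [add_sub_assoc]
    exact SemiconjBy.add_right (commute_unitaryA_q hkl) (semiconjBy_unitaryA_q l)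
  have hexp := hd.neg.semiconjBy_fc boundedCharNeg hpp
  have hphi := ((diagonalizedOnCore_q_add_q k l).conj (semiconjBy_inv hqq)).semiconjBy_fc
    (boundedPhiInv hb) hqq
  simp only [hd.fc_neg, boundedCharNeg_neg] at hexp
  exact SemiconjBy.mul_right hexp hphi

end Flips

/-! ## The evolution operator -/

section Evolution

variable {N : ℕ} [NeZero N] {b : ℂ}

variable (N) in
/-- The product of the operators `φ_b(q_{2j-1} + q_{2j-2})`. -/
def prodPhi (b : ℂ) : L2 N →L[ℂ] L2 N :=
  prodUpTo N fun j => fc (phi b)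
    (q (N := N) (2 * (j : ZMod (2 * N)) - 1) + q (2 * (j : ZMod (2 * N)) - 1 - 1))

theorem prodPhi_eq_prodUpTo (hb : b.im = 0 ∨ ‖b‖ = 1) : prodPhi N b = prodUpTo N fun l =>
    fc (phi b) (q (N := N) (2 * (l : ZMod (2 * N)) + 1) + q (2 * (l : ZMod (2 * N)))) := by
  set F : ℕ → L2 N →L[ℂ] L2 N := fun j => fc (phi b)
    (q (N := N) (2 * (j : ZMod (2 * N)) - 1) + q (2 * (j : ZMod (2 * N)) - 1 - 1)) with hF
  have hsucc (l : ℕ) : F (l + 1) = fc (phi b)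
      (q (N := N) (2 * (l : ZMod (2 * N)) + 1) + q (2 * (l : ZMod (2 * N)))) := by
    have hl : (2 * ((l + 1 : ℕ) : ZMod (2 * N)) - 1 : ZMod (2 * N)) = 2 * l + 1 := by
      push_cast
      ring
    simp only [hF, hl, add_sub_cancel_right]
  have hperiod : F (N + 1) = F 1 := by
    have hN : (2 * (N : ZMod (2 * N)) : ZMod (2 * N)) = 0 := by
      exact_mod_cast ZMod.natCast_self (2 * N)
    rw [hsucc, hsucc 0, hN, Nat.cast_zero, mul_zero]
  have hcomm (i j : ℕ) : Commute (F i) (F j) :=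
    (diagonalizedOnCore_q_add_q _ _).commute_fc (diagonalizedOnCore_q_add_q _ _)
      (boundedPhi hb) (boundedPhi hb)
  have hmem : F 1 ∈ unitary (L2 N →L[ℂ] L2 N) :=
    (diagonalizedOnCore_q_add_q _ _).fc_mem_unitary (G := boundedPhi hb)
      (boundedMeasurable.ofNormEqOne_mem_unitary _ _)
  have hunit : IsUnit (F 1) := (Unitary.toUnits ⟨F 1, hmem⟩).isUnit
  exact (prodUpTo_shift hcomm hperiod hunit).symm.trans (congrArg _ (funext hsucc))

theorem prodPhi_mul_prodPhiInv (hb : b.im = 0 ∨ ‖b‖ = 1) : prodPhi N b * prodPhiInv N b = 1 := by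
  rw [prodPhi_eq_prodUpTo hb]
  exact prodUpTo_mul_eq_one
    (fun _ _ _ _ _ _ _ => (diagonalizedOnCore_q_add_q _ _).commute_fc
      (diagonalizedOnCore_q_add_q _ _) (boundedPhi hb) (boundedPhiInv hb))
    fun _ _ _ => fc_phi_mul_fc_phi_inv hb _ _

theorem prodPhi_mul_kappaG (hb : b.im = 0 ∨ ‖b‖ = 1) :
    prodPhi N b * kappaG N b = Ring.inverse (fracDehnOp N b) := by
  have hunit : IsUnit (fracDehnOp N b) :=
    (Unitary.toUnits ⟨_, fracDehnOp_mem_unitary hb⟩).isUnit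
  refine hunit.mul_right_cancel ?_
  calc prodPhi N b * kappaG N b * fracDehnOp N b
      = prodPhi N b * prodPhiInv N b :=
        (mul_assoc _ _ _).trans (congrArg _ (kappaG_mul_fracDehnOp hb))
    _ = 1 := prodPhi_mul_prodPhiInv hb
    _ = Ring.inverse (fracDehnOp N b) * fracDehnOp N b := (Ring.inverse_mul_cancel _ hunit).symm

theorem kappaG_mul_prodUpTo_fc_phi (hb : b.im = 0 ∨ ‖b‖ = 1) :
    kappaG N b * prodUpTo N (fun j => fc (phi b)
      (p (N := N) (2 * (j : ZMod (2 * N))) + p (2 * (j : ZMod (2 * N)) - 1))) =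
    prodPhi N b * kappaG N b := by
  have hG : SemiconjBy (op (unitaryG N))
      (prodUpTo N fun j => fc (phi b)
        (p (N := N) (2 * (j : ZMod (2 * N))) + p (2 * (j : ZMod (2 * N)) - 1)))
      (prodPhi N b) :=
    prodUpTo_semiconjBy_prodUpTo fun j => (diagonalizedOnCore_q_add_q _ _).semiconjBy_fc
      (boundedPhi hb) (semiconjBy_unitaryG_p (even_val_two_mul _))
  rw [kappaG_eq]
  exact (hG.smul_left _).eq

end Evolution

/-! ## The realization of the observable algebra -/

section Realization

theorem sub_one_ne_add_one {N : ℕ} (hN : 1 < N) (m : ZMod (2 * N)) : m - 1 ≠ m + 1 := fun h => by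
  have htwo : ((2 : ℕ) : ZMod (2 * N)) = 0 := by
    push_cast
    linear_combination -h
  rw [ZMod.natCast_eq_zero_iff] at htwo
  have := Nat.le_of_dvd two_pos htwo
  lia

variable {N : ℕ} [NeZero N]

/-- The operator on Schwartz functions that realizes the generator `f_j`. -/
def obsOp (j : ZMod (2 * N)) : Module.End ℂ (Core N) :=
  if Even j.val then p j + p (j - 1) else q j + q (j - 1)

theorem obsOp_of_even {j : ZMod (2 * N)} (h : Even j.val) : obsOp j = p j + p (j - 1) := if_pos h

theorem obsOp_of_not_even {j : ZMod (2 * N)} (h : ¬Even j.val) : obsOp j = q j + q (j - 1) :=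
  if_neg h

theorem obsOp_two_mul (j : ZMod (2 * N)) : obsOp (2 * j) = p (2 * j) + p (2 * j - 1) :=
  obsOp_of_even (even_val_two_mul j)

theorem obsOp_two_mul_sub_one (j : ZMod (2 * N)) :
    obsOp (2 * j - 1) = q (2 * j - 1) + q (2 * j - 1 - 1) :=
  obsOp_of_not_even fun h => (even_val_sub_one _).1 h (even_val_two_mul j)

theorem commConst_eq_zero {m n : ZMod (2 * N)} (h : Even m.val ↔ Even n.val) :
    commConst N m n = 0 := by
  refine if_neg ?_
  rintro (rfl | rfl)
  · have := not_even_val_add_one m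
    tauto
  · have := even_val_sub_one m
    tauto

theorem commutator_p_add_p_q_add_q (hN : 1 < N) {m n : ZMod (2 * N)} (hmn : m ≠ n) :
    ((p m + p (m - 1)) * (q n + q (n - 1)) - (q n + q (n - 1)) * (p m + p (m - 1)) :
      Module.End ℂ (Core N)) =
    (if n = m + 1 ∨ n = m - 1 then (2 * (Real.pi : ℂ) * Complex.I)⁻¹ else 0) • 1 := by
  have hmn' : m - 1 ≠ n - 1 := fun h => hmn (sub_left_injective h)
  simp only [add_mul, mul_add, p_mul_q, if_neg hmn, if_neg hmn']
  by_cases hsucc : m = n - 1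
  · have hpred : m - 1 ≠ n := fun h => sub_one_ne_add_one hN m (by rw [h, hsucc, sub_add_cancel])
    rw [if_pos hsucc, if_neg hpred, if_pos (Or.inl (by rw [hsucc, sub_add_cancel]))]
    abel
  · by_cases hpred : m - 1 = n
    · rw [if_neg hsucc, if_pos hpred, if_pos (Or.inr hpred.symm)]
      abel
    · have hnot : ¬(n = m + 1 ∨ n = m - 1) := by
        rintro (h | h)
        exacts [hsucc (by rw [h, add_sub_cancel_right]), hpred h.symm]
      rw [if_neg hsucc, if_neg hpred, if_neg hnot, zero_smul]
      abel

theorem commutator_obsOp (hN : 1 < N) (m n : ZMod (2 * N)) :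
    obsOp m * obsOp n - obsOp n * obsOp m =
      algebraMap ℂ (Module.End ℂ (Core N)) (commConst N m n) := by
  rw [Algebra.algebraMap_eq_smul_one]
  by_cases hm : Even m.val <;> by_cases hn : Even n.val
  · rw [obsOp_of_even hm, obsOp_of_even hn, commConst_eq_zero (iff_of_true hm hn), zero_smul,
      sub_eq_zero]
    exact ((commute_p _ _).add_right (commute_p _ _)).add_left
      ((commute_p _ _).add_right (commute_p _ _))
  · have hmn : m ≠ n := fun h => hn (h ▸ hm)
    rw [obsOp_of_even hm, obsOp_of_not_even hn, commutator_p_add_p_q_add_q hN hmn, commConst,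
      hm.neg_one_pow, one_mul]
  · have hnm : n ≠ m := fun h => hm (h ▸ hn)
    have hadj : (m = n + 1 ∨ m = n - 1) ↔ (n = m + 1 ∨ n = m - 1) := by
      rw [← sub_eq_iff_eq_add, eq_sub_iff_add_eq, or_comm, eq_comm, eq_comm (a := m - 1)]
    rw [obsOp_of_not_even hm, obsOp_of_even hn, ← neg_sub, commutator_p_add_p_q_add_q hN hnm,
      commConst, (Nat.not_even_iff_odd.1 hm).neg_one_pow, ← neg_smul, neg_one_mul]
    simp only [hadj]
    split_ifs <;> simp only [neg_zero]
  · rw [obsOp_of_not_even hm, obsOp_of_not_even hn, commConst_eq_zero (iff_of_false hm hn),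
      zero_smul, sub_eq_zero]
    exact ((commute_q _ _).add_right (commute_q _ _)).add_left
      ((commute_q _ _).add_right (commute_q _ _))

/-- The realization of the observable algebra on the Schwartz space. -/
def realization (hN : 1 < N) : ObsAlgebra N →ₐ[ℂ] Module.End ℂ (Core N) :=
  RingQuot.liftAlgHom ℂ ⟨FreeAlgebra.lift ℂ obsOp, by
    rintro _ _ ⟨m, n⟩
    rw [map_sub, map_mul, map_mul, FreeAlgebra.lift_ι_apply, FreeAlgebra.lift_ι_apply,
      AlgHom.commutes, commutator_obsOp hN]⟩

theorem realization_f (hN : 1 < N) (j : ZMod (2 * N)) : realization hN (f j) = obsOp j := by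
  rw [realization, f, RingQuot.liftAlgHom_mkAlgHom_apply, FreeAlgebra.lift_ι_apply]

theorem exists_diagonalizedOnCore_obsOp (j : ZMod (2 * N)) :
    ∃ g a, DiagonalizedOnCore (obsOp j) g a := by
  by_cases h : Even j.val
  · rw [obsOp_of_even h]
    exact ⟨_, _, diagonalizedOnCore_p_add_p _ _⟩
  · rw [obsOp_of_not_even h]
    exact ⟨_, _, diagonalizedOnCore_q_add_q _ _⟩

theorem isSelfAdjoint_closedOp_obsOp (j : ZMod (2 * N)) : IsSelfAdjoint (closedOp (obsOp j)) := by
  obtain ⟨_, _, h⟩ := exists_diagonalizedOnCore_obsOp j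
  exact h.isSelfAdjoint

theorem semiconjBy_unitaryG_obsOp (j : ZMod (2 * N)) :
    SemiconjBy (core (unitaryG N)).val (obsOp j) ((-1 : ℂ) ^ j.val • obsOp (j - 1)) := by
  by_cases h : Even j.val
  · rw [obsOp_of_even h, obsOp_of_not_even fun h' => (even_val_sub_one j).1 h' h, h.neg_one_pow,
      one_smul]
    exact semiconjBy_unitaryG_p h
  · rw [obsOp_of_not_even h, obsOp_of_even ((even_val_sub_one j).2 h),
      (Nat.not_even_iff_odd.1 h).neg_one_pow, neg_one_smul]
    exact semiconjBy_unitaryG_q j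

theorem mem_graph_closedOp_obsOp_iff (b : ℂ) (j : ZMod (2 * N)) (ψ χ : L2 N) :
    (ψ, χ) ∈ (closedOp (obsOp j)).graph ↔
      (kappaG N b ψ, (-1 : ℂ) ^ j.val • kappaG N b χ) ∈ (closedOp (obsOp (j - 1))).graph := by
  obtain ⟨_, _, hj⟩ := exists_diagonalizedOnCore_obsOp j
  obtain ⟨_, _, hj'⟩ := exists_diagonalizedOnCore_obsOp (j - 1)
  have hsign : (-1 : ℂ) ^ j.val * (-1) ^ j.val = 1 := by
    rw [← mul_pow, neg_one_mul, neg_neg, one_pow]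
  have hphase : zetaPow b ((N : ℝ) + 6 / (N : ℝ)) ≠ 0 := Complex.exp_ne_zero _
  have hscalar : (kappaG N b ψ, (-1 : ℂ) ^ j.val • kappaG N b χ) =
      zetaPow b ((N : ℝ) + 6 / (N : ℝ)) •
        ((unitaryG N).iso ψ, (-1 : ℂ) ^ j.val • (unitaryG N).iso χ) := by
    rw [kappaG_eq]
    exact Prod.ext rfl (smul_comm ((-1 : ℂ) ^ j.val) (zetaPow b _) ((unitaryG N).iso χ))
  rw [hj.graph_closedOp_eq, hj'.graph_closedOp_eq, hscalar,
    Submodule.smul_mem_iff _ hphase,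
    mem_closure_coreGraph_iff_of_semiconjBy hsign (semiconjBy_unitaryG_obsOp j)]

variable {b : ℂ} {κ : ObsAlgebra N →ₐ[ℂ] Module.End ℂ (Core N)}

theorem evolOdd_eq_inverse (hb : b.im = 0 ∨ ‖b‖ = 1) (hκ : ∀ j, κ (f j) = obsOp j) :
    evolOdd b κ (kappaG N b) = Ring.inverse (fracDehnOp N b) := by
  rw [← prodPhi_mul_kappaG hb]
  simp only [evolOdd, prodPhi, hκ, obsOp_two_mul_sub_one]

theorem evolEven_eq_evolOdd (hb : b.im = 0 ∨ ‖b‖ = 1) (hκ : ∀ j, κ (f j) = obsOp j) :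
    evolEven b κ (kappaG N b) = evolOdd b κ (kappaG N b) := by
  simp only [evolEven, evolOdd, hκ, obsOp_two_mul, obsOp_two_mul_sub_one]
  exact kappaG_mul_prodUpTo_fc_phi hb

end Realization

/-! ## Moving distinguished corners -/

section Triangulation

open MarkedPoint

/-- The decorated triangle with the distinguished corner moved one step counterclockwise. -/
def rotTriple (s : Triple) : Triple := ![s 1, s 2, s 0]

theorem rotTriple_apply (s : Triple) (i : Fin 3) : rotTriple s i = s (i + 1) := by
  fin_cases i <;> rfl

theorem rotTriple_rotTriple_rotTriple (s : Triple) : rotTriple (rotTriple (rotTriple s)) = s := by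
  funext i
  fin_cases i <;> rfl

theorem ccw_rotate {x y z : MarkedPoint} (h : CCW x y z) : CCW y z x := by
  unfold CCW at *
  tauto

theorem interiorsDisjoint_rotTriple_left (s t : Triple) :
    InteriorsDisjoint (rotTriple s) t ↔ InteriorsDisjoint s t := by
  simp only [InteriorsDisjoint, rotTriple_apply]
  exact (Equiv.addRight (1 : Fin 3)).exists_congr fun _ => Iff.rfl

theorem interiorsDisjoint_rotTriple_right (s t : Triple) :
    InteriorsDisjoint s (rotTriple t) ↔ InteriorsDisjoint s t := by
  simp only [InteriorsDisjoint, rotTriple_apply]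
  exact exists_congr fun _ => (Equiv.addRight (1 : Fin 3)).forall_congr fun _ => Iff.rfl

variable {N : ℕ}

theorem exists_toAnn_eq (c : AnnTriangle N) : ∃ s, toAnn N s = c := Quotient.exists_rep c

/-- The triangle of the annulus with the distinguished corner moved one step counterclockwise. -/
def AnnTriangle.rot : AnnTriangle N → AnnTriangle N :=
  Quotient.map (sa := deckSetoid N) (sb := deckSetoid N) rotTriple fun s t ⟨k, h⟩ =>
    ⟨k, fun i => by rw [rotTriple_apply, rotTriple_apply, h]⟩

theorem rot_toAnn (s : Triple) : (toAnn N s).rot = toAnn N (rotTriple s) := rfl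

theorem AnnTriangle.rot_rot_rot (c : AnnTriangle N) : c.rot.rot.rot = c := by
  obtain ⟨s, rfl⟩ := exists_toAnn_eq c
  exact congrArg (toAnn N) (rotTriple_rotTriple_rotTriple s)

theorem AnnTriangle.rot_injective : Function.Injective (AnnTriangle.rot (N := N)) := fun c d h => by
  rw [← c.rot_rot_rot, h, d.rot_rot_rot]

theorem exists_lift_of_toAnn_eq_update_rot {F : ZMod (2 * N) → AnnTriangle N}
    {i k : ZMod (2 * N)} {s : Triple} (h : toAnn N s = Function.update F i (F i).rot k) :
    ∃ t, toAnn N t = F k ∧ s = if k = i then rotTriple t else t := by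
  by_cases hk : k = i
  · subst hk
    rw [Function.update_self, ← rotTriple_rotTriple_rotTriple s, ← rot_toAnn] at h
    exact ⟨rotTriple (rotTriple s), AnnTriangle.rot_injective h,
      by rw [if_pos rfl, rotTriple_rotTriple_rotTriple]⟩
  · rw [Function.update_of_ne hk] at h
    exact ⟨s, h, (if_neg hk).symm⟩

/-- The triangulation with the distinguished corner of the triangle number `i` moved one step
counterclockwise. -/
def DecTriangulation.rotAt (τ : DecTriangulation N) (i : ZMod (2 * N)) : DecTriangulation N where
  tri := Function.update τ.tri i (τ.tri i).rot
  ccw k s h := by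
    obtain ⟨s, hs, rfl⟩ := exists_lift_of_toAnn_eq_update_rot h
    split_ifs
    exacts [ccw_rotate (τ.ccw k s hs), τ.ccw k s hs]
  disjoint k l s t hs ht hne := by
    obtain ⟨s, hs', rfl⟩ := exists_lift_of_toAnn_eq_update_rot hs
    obtain ⟨t, ht', rfl⟩ := exists_lift_of_toAnn_eq_update_rot ht
    have hdisj : InteriorsDisjoint s t := τ.disjoint k l s t hs' ht' <| by
      contrapose! hne
      simp only [hne.1, hne.2, true_and]
    split_ifs <;>
      simpa only [interiorsDisjoint_rotTriple_left, interiorsDisjoint_rotTriple_right]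

theorem DecTriangulation.rotAt_tri (τ : DecTriangulation N) (i : ZMod (2 * N)) :
    (τ.rotAt i).tri = Function.update τ.tri i (τ.tri i).rot := rfl

theorem DecTriangulation.rotAt_rotAt_tri (τ : DecTriangulation N) (i : ZMod (2 * N)) :
    ((τ.rotAt i).rotAt i).tri = Function.update τ.tri i (τ.tri i).rot.rot := by
  simp only [rotAt_tri, Function.update_self, Function.update_idem]

theorem DecTriangulation.rotAt_rotAt_rotAt (τ : DecTriangulation N) (i : ZMod (2 * N)) :
    ((τ.rotAt i).rotAt i).rotAt i = τ := by
  ext1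
  rw [rotAt_tri, rotAt_rotAt_tri, Function.update_self, Function.update_idem,
    AnnTriangle.rot_rot_rot, Function.update_eq_self]

/-- The triangulation with the distinguished corners of the triangles number `1, …, n` moved one
step counterclockwise. -/
def DecTriangulation.rotUpTo (τ : DecTriangulation N) : ℕ → DecTriangulation N
  | 0 => τ
  | n + 1 => (τ.rotUpTo n).rotAt ((n + 1 : ℕ) : ZMod (2 * N))

theorem DecTriangulation.rotUpTo_tri_of_ne (τ : DecTriangulation N) {n : ℕ} {k : ZMod (2 * N)}
    (hk : ∀ i ∈ Finset.Icc 1 n, k ≠ (i : ZMod (2 * N))) : (τ.rotUpTo n).tri k = τ.tri k := by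
  induction n with
  | zero => rfl
  | succ n ih =>
    rw [rotUpTo, rotAt_tri, Function.update_of_ne (hk _ (by simp)),
      ih fun i hi => hk i (Finset.Icc_subset_Icc_right n.le_succ hi)]

theorem DecTriangulation.rotUpTo_tri_natCast (τ : DecTriangulation N) {n m : ℕ}
    (hm : m ∈ Finset.Icc 1 n) (hn : n ≤ 2 * N) :
    (τ.rotUpTo n).tri (m : ZMod (2 * N)) = (τ.tri (m : ZMod (2 * N))).rot := by
  have hne {i j : ℕ} (hi : i ∈ Finset.Icc 1 n) (hj : j ∈ Finset.Icc 1 n) (hij : i ≠ j) :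
      (i : ZMod (2 * N)) ≠ j :=
    (natCast_injOn_Icc (2 * N)).ne (Finset.Icc_subset_Icc_right hn hi)
      (Finset.Icc_subset_Icc_right hn hj) hij
  induction n with
  | zero => simp at hm
  | succ n ih =>
    rw [rotUpTo, rotAt_tri]
    simp only [Finset.mem_Icc] at hne hm ih
    obtain hmn | rfl := Nat.lt_or_eq_of_le hm.2
    · rw [Function.update_of_ne (hne hm (by lia) hmn.ne),
        ih (by lia) (by lia) fun hi hj => hne (by lia) (by lia)]
    · rw [Function.update_self, rotUpTo_tri_of_ne]
      intro i hi
      rw [Finset.mem_Icc] at hi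
      exact hne (by lia) (by lia) (by lia)

theorem DecTriangulation.rotUpTo_tri [NeZero N] (τ : DecTriangulation N) (k : ZMod (2 * N)) :
    (τ.rotUpTo (2 * N)).tri k = (τ.tri k).rot := by
  obtain ⟨m, hm, rfl⟩ := exists_natCast_mem_Icc k
  exact τ.rotUpTo_tri_natCast hm le_rfl

/-- The triangulation in which the triangle number `k` is the triangle number `σ k` of `τ`. -/
def DecTriangulation.relabel (τ : DecTriangulation N) (σ : Equiv.Perm (ZMod (2 * N))) :
    DecTriangulation N where
  tri k := τ.tri (σ k)
  ccw k := τ.ccw (σ k)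
  disjoint k l s t hs ht hne :=
    τ.disjoint (σ k) (σ l) s t hs ht (hne.imp_left σ.injective.ne)

/-! ## Triangulations with some diagonals flipped -/

theorem toAnn_eq_toAnn_of_shift {T : ℤ → Triple}
    (hT : ∀ n k i, shift (N * k) (T n i) = T (n + 2 * N * k) i) {n n' : ℤ}
    (h : (n : ZMod (2 * N)) = n') : toAnn N (T n) = toAnn N (T n') := by
  obtain ⟨k, hk⟩ := (ZMod.intCast_eq_intCast_iff_dvd_sub _ _ _).1 h
  refine Quotient.sound (s := deckSetoid N) ⟨k, fun i => ?_⟩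
  rw [hT, ← sub_add_cancel n' n, hk, add_comm]
  push_cast
  rfl

/-- The lift of the triangulation obtained from the standard one by flipping the diagonals of the
squares in `S`. The triangles number `2m` and `2m+1` fill the square with lower left corner `m`,
cut by the diagonal from the lower left to the upper right corner if `m` belongs to `S` and by the
other diagonal otherwise. The corners and labels are chosen so that `S = ∅` gives a relabelling of
the standard triangulation with all corners moved, and `S = univ` gives the standard triangulation
with the top boundary rotated by one spacing. -/
def flipLift (S : Finset (ZMod N)) (n : ℤ) : Triple :=
  if ((n / 2 : ℤ) : ZMod N) ∈ S then MarkedPoint.rotateTop 1 ∘ stdLift n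
  else rotTriple (stdLift (n + 1))

theorem two_mul_intCast_eq {m l : ℤ} (h : (m : ZMod N) = l) :
    (2 * (m : ZMod (2 * N)) : ZMod (2 * N)) = 2 * l := by
  obtain ⟨c, hc⟩ := (ZMod.intCast_eq_intCast_iff_dvd_sub _ _ _).1 h
  have hdvd : (((2 * m : ℤ)) : ZMod (2 * N)) = ((2 * l : ℤ) : ZMod (2 * N)) :=
    (ZMod.intCast_eq_intCast_iff_dvd_sub _ _ _).2 ⟨c, by push_cast; linear_combination 2 * hc⟩
  exact_mod_cast hdvd

theorem two_mul_ediv_two (m : ℤ) : 2 * m / 2 = m := by lia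

theorem two_mul_add_one_ediv_two (m : ℤ) : (2 * m + 1) / 2 = m := by lia

section FlipLift

variable {S : Finset (ZMod N)} {m : ℤ}

theorem flipLift_two_mul_of_mem (h : (m : ZMod N) ∈ S) :
    flipLift S (2 * m) = ![.bot m, .top (m + 1), .top m] := by
  rw [flipLift, two_mul_ediv_two, if_pos h, stdLift_even]
  funext i
  fin_cases i <;> simp [MarkedPoint.rotateTop]

theorem flipLift_two_mul_add_one_of_mem (h : (m : ZMod N) ∈ S) :
    flipLift S (2 * m + 1) = ![.top (m + 1), .bot m, .bot (m + 1)] := by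
  rw [flipLift, two_mul_add_one_ediv_two, if_pos h, stdLift_odd]
  funext i
  fin_cases i <;> simp [MarkedPoint.rotateTop]

theorem flipLift_two_mul_of_notMem (h : (m : ZMod N) ∉ S) :
    flipLift S (2 * m) = ![.bot m, .bot (m + 1), .top m] := by
  rw [flipLift, two_mul_ediv_two, if_neg h, stdLift_odd]
  rfl

theorem flipLift_two_mul_add_one_of_notMem (h : (m : ZMod N) ∉ S) :
    flipLift S (2 * m + 1) = ![.top (m + 1), .top m, .bot (m + 1)] := by
  rw [flipLift, two_mul_add_one_ediv_two, if_neg h, show 2 * m + 1 + 1 = 2 * (m + 1) by ring,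
    stdLift_even, add_sub_cancel_right]
  rfl

variable (S) in
theorem flipLift_induction {motive : ℤ → Triple → Prop}
    (even_mem : ∀ m, motive (2 * m) ![.bot m, .top (m + 1), .top m])
    (odd_mem : ∀ m, motive (2 * m + 1) ![.top (m + 1), .bot m, .bot (m + 1)])
    (even_notMem : ∀ m, motive (2 * m) ![.bot m, .bot (m + 1), .top m])
    (odd_notMem : ∀ m, motive (2 * m + 1) ![.top (m + 1), .top m, .bot (m + 1)]) (n : ℤ) :
    motive n (flipLift S n) := by
  obtain ⟨m, rfl | rfl⟩ := Int.even_or_odd' n <;> by_cases h : (m : ZMod N) ∈ S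
  · exact flipLift_two_mul_of_mem h ▸ even_mem m
  · exact flipLift_two_mul_of_notMem h ▸ even_notMem m
  · exact flipLift_two_mul_add_one_of_mem h ▸ odd_mem m
  · exact flipLift_two_mul_add_one_of_notMem h ▸ odd_notMem m

variable (S)

theorem flipLift_ccw (n : ℤ) : CCW (flipLift S n 0) (flipLift S n 1) (flipLift S n 2) :=
  flipLift_induction S (motive := fun _ s => CCW (s 0) (s 1) (s 2)) (by simp [CCW, Before])
    (by simp [CCW, Before]) (by simp [CCW, Before]) (by simp [CCW, Before]) n

/-- The vertices of the square of the strip with lower left corner `m`. -/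
def squareVertices (m : ℤ) : Set MarkedPoint := {.bot m, .bot (m + 1), .top m, .top (m + 1)}

theorem flipLift_mem_squareVertices (n : ℤ) (j : Fin 3) :
    flipLift S n j ∈ squareVertices (n / 2) := by
  induction n using flipLift_induction S with
  | _ m => fin_cases j <;> simp [squareVertices, two_mul_add_one_ediv_two]

theorem exists_edge_right (n : ℤ) : ∃ i : Fin 3, ∀ m, n / 2 < m → ∀ x ∈ squareVertices m,
    x = flipLift S n i ∨ x = flipLift S n (i + 1) ∨
      CCW (flipLift S n i) x (flipLift S n (i + 1)) := by
  induction n using flipLift_induction S with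
  | even_mem l =>
    refine ⟨0, ?_⟩
    rintro m hm x (rfl | rfl | rfl | rfl) <;> simp [CCW, Before] <;> lia
  | odd_mem l | odd_notMem l =>
    refine ⟨2, ?_⟩
    rintro m hm x (rfl | rfl | rfl | rfl) <;> simp [CCW, Before] <;> lia
  | even_notMem l =>
    refine ⟨1, ?_⟩
    rintro m hm x (rfl | rfl | rfl | rfl) <;> simp [CCW, Before] <;> lia

theorem exists_edge_left (n : ℤ) : ∃ i : Fin 3, ∀ m, m < n / 2 → ∀ x ∈ squareVertices m,
    x = flipLift S n i ∨ x = flipLift S n (i + 1) ∨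
      CCW (flipLift S n i) x (flipLift S n (i + 1)) := by
  induction n using flipLift_induction S with
  | even_mem l | even_notMem l =>
    refine ⟨2, ?_⟩
    rintro m hm x (rfl | rfl | rfl | rfl) <;> simp [CCW, Before] <;> lia
  | odd_mem l =>
    refine ⟨0, ?_⟩
    rintro m hm x (rfl | rfl | rfl | rfl) <;> simp [CCW, Before] <;> lia
  | odd_notMem l =>
    refine ⟨1, ?_⟩
    rintro m hm x (rfl | rfl | rfl | rfl) <;> simp [CCW, Before] <;> lia

-- The witness is the diagonal, which is edge `0` of both triangles or edge `1` of both.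
theorem interiorsDisjoint_flipLift_same_square (m : ℤ) :
    InteriorsDisjoint (flipLift S (2 * m)) (flipLift S (2 * m + 1)) ∧
      InteriorsDisjoint (flipLift S (2 * m + 1)) (flipLift S (2 * m)) := by
  by_cases h : (m : ZMod N) ∈ S
  · rw [flipLift_two_mul_of_mem h, flipLift_two_mul_add_one_of_mem h]
    constructor <;> refine ⟨0, fun j => ?_⟩ <;> fin_cases j <;> simp [CCW, Before]
  · rw [flipLift_two_mul_of_notMem h, flipLift_two_mul_add_one_of_notMem h]
    constructor <;> refine ⟨1, fun j => ?_⟩ <;> fin_cases j <;> simp [CCW, Before]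

theorem interiorsDisjoint_flipLift {n n' : ℤ} (h : n ≠ n') :
    InteriorsDisjoint (flipLift S n) (flipLift S n') := by
  obtain hlt | heq | hgt := lt_trichotomy (n / 2) (n' / 2)
  · obtain ⟨i, hi⟩ := exists_edge_right S n
    exact ⟨i, fun j => hi _ hlt _ (flipLift_mem_squareVertices S n' j)⟩
  · obtain ⟨m, ⟨rfl, rfl⟩ | ⟨rfl, rfl⟩⟩ :
        ∃ m, (n = 2 * m ∧ n' = 2 * m + 1) ∨ (n = 2 * m + 1 ∧ n' = 2 * m) := ⟨n / 2, by lia⟩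
    exacts [(interiorsDisjoint_flipLift_same_square S m).1,
      (interiorsDisjoint_flipLift_same_square S m).2]
  · obtain ⟨i, hi⟩ := exists_edge_left S n
    exact ⟨i, fun j => hi _ hgt _ (flipLift_mem_squareVertices S n' j)⟩

theorem shift_flipLift (n k : ℤ) (i : Fin 3) :
    shift (N * k) (flipLift S n i) = flipLift S (n + 2 * N * k) i := by
  have hsquare : ((((n + 2 * N * k) / 2 : ℤ)) : ZMod N) = ((n / 2 : ℤ) : ZMod N) := by
    rw [mul_assoc, Int.add_mul_ediv_left _ _ two_ne_zero]
    push_cast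
    rw [ZMod.natCast_self, zero_mul, add_zero]
  rw [flipLift, flipLift, hsquare]
  split_ifs
  · exact (rotateTop_shift _ _ _).symm.trans (congrArg _ (stdLift_shift N n k i))
  · rw [rotTriple_apply, rotTriple_apply, stdLift_shift, add_right_comm]

theorem exists_eq_flipLift_of_toAnn_eq {s : Triple} {n : ℤ}
    (h : toAnn N s = toAnn N (flipLift S n)) : ∃ k : ℤ, s = flipLift S (n + 2 * N * k) := by
  obtain ⟨k, hk⟩ := Quotient.exact (s := deckSetoid N) h.symm
  exact ⟨k, funext fun i => (hk i).trans (shift_flipLift S n k i)⟩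

variable [NeZero N]

/-- The triangulation of the annulus obtained from the standard one by flipping the diagonals of
the squares in `S`, see `flipLift`. -/
def flipTriangulation : DecTriangulation N where
  tri k := toAnn N (flipLift S k.val)
  ccw k s h := by
    obtain ⟨l, rfl⟩ := exists_eq_flipLift_of_toAnn_eq S h
    exact flipLift_ccw _ _
  disjoint k l s t hs ht hne := by
    obtain ⟨a, rfl⟩ := exists_eq_flipLift_of_toAnn_eq S hs
    obtain ⟨c, rfl⟩ := exists_eq_flipLift_of_toAnn_eq S ht
    refine interiorsDisjoint_flipLift S fun h => ?_
    have hkl : k = l := by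
      have hzero : (2 * (N : ZMod (2 * N))) = 0 := by exact_mod_cast ZMod.natCast_self (2 * N)
      simpa [hzero] using congrArg (Int.cast : ℤ → ZMod (2 * N)) h
    exact hne.elim (· hkl) (· (congrArg _ h))

theorem flipTriangulation_tri_intCast (n : ℤ) :
    (flipTriangulation S).tri (n : ZMod (2 * N)) = toAnn N (flipLift S n) :=
  toAnn_eq_toAnn_of_shift (shift_flipLift S) (by simp)

theorem stdTriangulation_tri_intCast (n : ℤ) :
    (stdTriangulation N).tri (n : ZMod (2 * N)) = toAnn N (stdLift n) :=
  toAnn_eq_toAnn_of_shift (stdLift_shift N) (by simp)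

theorem flipTriangulation_empty_tri (k : ZMod (2 * N)) :
    (flipTriangulation (∅ : Finset (ZMod N))).tri k = ((stdTriangulation N).tri (k + 1)).rot := by
  obtain ⟨n, rfl⟩ := ZMod.intCast_surjective k
  rw [flipTriangulation_tri_intCast, flipLift, if_neg (Finset.notMem_empty _), ← rot_toAnn,
    ← stdTriangulation_tri_intCast, Int.cast_add, Int.cast_one]

theorem flipTriangulation_univ :
    flipTriangulation (Finset.univ : Finset (ZMod N)) = (stdTriangulation N).rotateTop 1 := by
  ext1
  funext k
  change toAnn N (flipLift Finset.univ k.val) = toAnn N (MarkedPoint.rotateTop 1 ∘ stdLift k.val)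
  rw [flipLift, if_pos (Finset.mem_univ _)]

variable {S} {l : ℤ}

theorem flipTriangulation_insert_tri_of_ne {k : ZMod (2 * N)} (heven : k ≠ 2 * l)
    (hodd : k ≠ 2 * l + 1) :
    (flipTriangulation (insert (l : ZMod N) S)).tri k = (flipTriangulation S).tri k := by
  obtain ⟨n, rfl⟩ := ZMod.intCast_surjective k
  have hn : ((n / 2 : ℤ) : ZMod N) ≠ l := by
    obtain ⟨m, rfl | rfl⟩ := Int.even_or_odd' n
    · rw [two_mul_ediv_two]
      exact fun h => heven (by rw [← two_mul_intCast_eq h]; push_cast; rfl)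
    · rw [two_mul_add_one_ediv_two]
      exact fun h => hodd (by rw [← two_mul_intCast_eq h]; push_cast; rfl)
  rw [flipTriangulation_tri_intCast, flipTriangulation_tri_intCast, flipLift, flipLift]
  simp only [Finset.mem_insert, hn, false_or]

end FlipLift

/-! ## Rotation of the top boundary -/

theorem toAnn_rotateTop (m : ℤ) (s : Triple) :
    (toAnn N s).rotateTop m = toAnn N (MarkedPoint.rotateTop m ∘ s) := rfl

theorem toAnn_rotateTop_vec (m : ℤ) (x y z : MarkedPoint) :
    (toAnn N ![x, y, z]).rotateTop m =
      toAnn N ![x.rotateTop m, y.rotateTop m, z.rotateTop m] := by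
  rw [toAnn_rotateTop]
  congr 1
  funext i
  fin_cases i <;> rfl

theorem DecTriangulation.rotateTop_tri (τ : DecTriangulation N) (m : ℤ) :
    (τ.rotateTop m).tri = AnnTriangle.rotateTop m ∘ τ.tri := rfl

theorem DecTriangulation.rotateTop_zero (τ : DecTriangulation N) : τ.rotateTop 0 = τ := by
  ext1
  funext k
  obtain ⟨s, hs⟩ := exists_toAnn_eq (τ.tri k)
  rw [rotateTop_tri, Function.comp_apply, ← hs, toAnn_rotateTop]
  congr 1
  funext i
  cases h : s i <;> simp [MarkedPoint.rotateTop, h]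

theorem DecTriangulation.rotateTop_rotateTop (τ : DecTriangulation N) (m n : ℤ) :
    (τ.rotateTop m).rotateTop n = τ.rotateTop (m + n) := by
  ext1
  funext k
  obtain ⟨s, hs⟩ := exists_toAnn_eq (τ.tri k)
  simp only [rotateTop_tri, Function.comp_apply, ← hs, toAnn_rotateTop]
  congr 1
  funext i
  cases h : s i <;> simp [MarkedPoint.rotateTop, h, add_assoc]

end Triangulation

/-! ## Quantization of the elementary moves -/

section Quantization

variable {N : ℕ} [NeZero N] {b : ℂ} {τ τ' : DecTriangulation N}

theorem Quantizes.rotAt (τ : DecTriangulation N) (i : ZMod (2 * N)) :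
    Quantizes b τ (τ.rotAt i) (A i) := by
  obtain ⟨s, hs⟩ := exists_toAnn_eq (τ.tri i)
  refine Quantizes.rho τ (τ.rotAt i) i s hs.symm ?_
  rw [DecTriangulation.rotAt_tri, ← hs, rot_toAnn, rotTriple]

theorem Quantizes.rotAt_rotAt (τ : DecTriangulation N) (i : ZMod (2 * N)) :
    Quantizes b τ ((τ.rotAt i).rotAt i) (Ring.inverse (A i)) := by
  have h : Quantizes b ((τ.rotAt i).rotAt i) (((τ.rotAt i).rotAt i).rotAt i) (A i) :=
    Quantizes.rotAt _ i
  rw [DecTriangulation.rotAt_rotAt_rotAt] at h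
  exact Quantizes.symm _ _ _ h

theorem Quantizes.rotUpTo (τ : DecTriangulation N) (n : ℕ) :
    Quantizes b τ (τ.rotUpTo n) (prodUpTo n fun k => A (N := N) (k : ZMod (2 * N))) := by
  induction n with
  | zero => exact Quantizes.refl τ
  | succ n ih =>
    rw [prodUpTo_succ]
    exact Quantizes.trans _ _ _ _ _ ih (Quantizes.rotAt _ _)

theorem Quantizes.prod_A (h : ∀ k, τ'.tri k = (τ.tri k).rot) :
    Quantizes b τ τ' (prodUpTo (2 * N) fun k => A (N := N) (k : ZMod (2 * N))) := by
  have hτ' : τ.rotUpTo (2 * N) = τ' :=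
    DecTriangulation.ext (funext fun k => (τ.rotUpTo_tri k).trans (h k).symm)
  exact hτ' ▸ Quantizes.rotUpTo τ (2 * N)

theorem inverse_A_mul_T_mul_A (hb : b.im = 0 ∨ ‖b‖ = 1) {k l : ZMod (2 * N)} (hkl : k ≠ l) :
    Ring.inverse (A l) * T b k l * A l = Tcheck b k l := by
  have hunit : IsUnit (A l : L2 N →L[ℂ] L2 N) := op_unitaryA l ▸ (Group.isUnit _).map op
  have hconj : A l * Tcheck b k l = T b k l * A l :=
    op_unitaryA l ▸ (semiconjBy_unitaryA_Tcheck hb hkl).eq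
  exact (mul_assoc _ _ _).trans <| (congrArg (Ring.inverse (A l) * ·) hconj.symm).trans <|
    Ring.inverse_mul_cancel_left _ _ hunit

-- Move the corner of the triangle `j` from `R` to `B`, apply `T_{ij}`, and move the corner back.
theorem Quantizes.flip (hb : b.im = 0 ∨ ‖b‖ = 1) {i j : ZMod (2 * N)} (hij : i ≠ j)
    {L B R U : MarkedPoint} (hi : τ.tri i = toAnn N ![L, B, U])
    (hj : τ.tri j = toAnn N ![R, U, B]) (hi' : τ'.tri i = toAnn N ![L, R, U])
    (hj' : τ'.tri j = toAnn N ![R, L, B]) (hne : ∀ k, k ≠ i → k ≠ j → τ'.tri k = τ.tri k) :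
    Quantizes b τ τ' (Tcheck b i j) := by
  have hT : Quantizes b ((τ.rotAt j).rotAt j) ((τ'.rotAt j).rotAt j) (T b i j) := by
    refine Quantizes.omega _ _ i j hij L B R U ?_ ?_ ?_
    · rw [DecTriangulation.rotAt_rotAt_tri, Function.update_of_ne hij, hi]
    · rw [DecTriangulation.rotAt_rotAt_tri, Function.update_self, hj]
      rfl
    · funext k
      rw [DecTriangulation.rotAt_rotAt_tri, DecTriangulation.rotAt_rotAt_tri]
      by_cases hkj : k = j
      · rw [hkj, Function.update_self, Function.update_self, hj']
        rfl
      · rw [Function.update_of_ne hkj, Function.update_of_ne hkj]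
        by_cases hki : k = i
        · rw [hki, Function.update_self, hi']
        · rw [Function.update_of_ne hki, Function.update_of_ne hkj, hne k hki hkj]
  have hback : Quantizes b ((τ'.rotAt j).rotAt j) τ' (A j) := by
    simpa only [DecTriangulation.rotAt_rotAt_rotAt] using Quantizes.rotAt ((τ'.rotAt j).rotAt j) j
  rw [← inverse_A_mul_T_mul_A hb hij]
  exact Quantizes.trans _ _ _ _ _ (Quantizes.trans _ _ _ _ _ (Quantizes.rotAt_rotAt τ j) hT) hback

theorem Quantizes.flipTriangulation_insert (hb : b.im = 0 ∨ ‖b‖ = 1) {S : Finset (ZMod N)}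
    {l : ℤ} (hl : (l : ZMod N) ∉ S) :
    Quantizes b (flipTriangulation S) (flipTriangulation (insert (l : ZMod N) S))
      (Tcheck b (2 * l + 1) (2 * l)) := by
  have heven (S : Finset (ZMod N)) :
      (flipTriangulation S).tri (2 * l) = toAnn N (flipLift S (2 * l)) := by
    rw [← flipTriangulation_tri_intCast]
    push_cast
    rfl
  have hodd (S : Finset (ZMod N)) :
      (flipTriangulation S).tri (2 * l + 1) = toAnn N (flipLift S (2 * l + 1)) := by
    rw [← flipTriangulation_tri_intCast]
    push_cast
    rfl
  have hl' : (l : ZMod N) ∈ insert (l : ZMod N) S := Finset.mem_insert_self _ _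
  refine Quantizes.flip hb (two_mul_add_one_ne _ _) (L := .top (l + 1)) (B := .top l)
    (R := .bot l) (U := .bot (l + 1)) ?_ ?_ ?_ ?_
    fun k hkodd hkeven => flipTriangulation_insert_tri_of_ne hkeven hkodd
  · rw [hodd, flipLift_two_mul_add_one_of_notMem hl]
  · rw [heven, flipLift_two_mul_of_notMem hl]
  · rw [hodd, flipLift_two_mul_add_one_of_mem hl']
  · rw [heven, flipLift_two_mul_of_mem hl']

theorem Quantizes.prod_Tcheck (hb : b.im = 0 ∨ ‖b‖ = 1) {n : ℕ} (hn : n ≤ N) :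
    Quantizes b (flipTriangulation ∅) (flipTriangulation ((Finset.Icc 1 n).image Nat.cast))
      (prodUpTo n fun l => Tcheck b (2 * (l : ZMod (2 * N)) + 1) (2 * (l : ZMod (2 * N)))) := by
  induction n with
  | zero => exact Quantizes.refl _
  | succ n ih =>
    have hnotMem : (((n + 1 : ℕ) : ℤ) : ZMod N) ∉ (Finset.Icc 1 n).image Nat.cast := by
      rw [Int.cast_natCast, Finset.mem_image]
      rintro ⟨m, hm, h⟩
      rw [Finset.mem_Icc] at hm
      have : m = n + 1 := natCast_injOn_Icc N (Finset.mem_coe.2 (Finset.mem_Icc.2 (by lia)))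
        (Finset.mem_coe.2 (Finset.mem_Icc.2 (by lia))) h
      lia
    have hflip := Quantizes.flipTriangulation_insert hb hnotMem
    rw [Int.cast_natCast, Int.cast_natCast, ← Finset.image_insert,
      Finset.insert_Icc_right_eq_Icc_add_one (by lia)] at hflip
    rw [prodUpTo_succ]
    exact Quantizes.trans _ _ _ _ _ (ih (by lia)) hflip

theorem image_natCast_Icc : (Finset.Icc 1 N).image Nat.cast = (Finset.univ : Finset (ZMod N)) :=
  Finset.eq_univ_of_forall fun k => Finset.mem_image.2 (exists_natCast_mem_Icc k)

theorem Quantizes.fracDehnOp (hb : b.im = 0 ∨ ‖b‖ = 1) :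
    Quantizes b (stdTriangulation N) ((stdTriangulation N).rotateTop 1) (fracDehnOp N b) := by
  have hrelabel : Quantizes b (stdTriangulation N)
      ((stdTriangulation N).relabel (Equiv.addRight 1)) (P (Equiv.addRight 1)) :=
    Quantizes.relabel _ _ _ fun _ => rfl
  have hcorners : Quantizes b ((stdTriangulation N).relabel (Equiv.addRight 1))
      (flipTriangulation ∅) (prodUpTo (2 * N) fun k => A (N := N) (k : ZMod (2 * N))) :=
    Quantizes.prod_A flipTriangulation_empty_tri
  have hflips := Quantizes.prod_Tcheck (N := N) hb le_rfl
  rw [image_natCast_Icc, flipTriangulation_univ] at hflips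
  exact Quantizes.phase _ _ _ _ (norm_zetaPow hb _)
    (Quantizes.trans _ _ _ _ _ (Quantizes.trans _ _ _ _ _ hrelabel hcorners) hflips)

/-! ## Naturality under the mapping class group -/

theorem Quantizes.rotateTop {X : L2 N →L[ℂ] L2 N} (h : Quantizes b τ τ' X) (m : ℤ) :
    Quantizes b (τ.rotateTop m) (τ'.rotateTop m) X := by
  induction h with
  | relabel τ τ' σ h =>
    exact Quantizes.relabel _ _ σ fun k => congrArg (AnnTriangle.rotateTop m) (h k)
  | rho τ τ' i s h h' =>
    refine Quantizes.rho _ _ i (MarkedPoint.rotateTop m ∘ s)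
      (congrArg (AnnTriangle.rotateTop m) h) ?_
    rw [DecTriangulation.rotateTop_tri, h', Function.comp_update, toAnn_rotateTop_vec]
    rfl
  | omega τ τ' i j hij L B R U hi hj h' =>
    refine Quantizes.omega _ _ i j hij (L.rotateTop m) (B.rotateTop m) (R.rotateTop m)
      (U.rotateTop m) ?_ ?_ ?_
    · rw [DecTriangulation.rotateTop_tri, Function.comp_apply, hi, toAnn_rotateTop_vec]
    · rw [DecTriangulation.rotateTop_tri, Function.comp_apply, hj, toAnn_rotateTop_vec]
    · rw [DecTriangulation.rotateTop_tri, h', Function.comp_update, Function.comp_update,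
        toAnn_rotateTop_vec, toAnn_rotateTop_vec]
      rfl
  | refl τ => exact Quantizes.refl _
  | trans τ τ' τ'' X Y _ _ ihX ihY => exact Quantizes.trans _ _ _ _ _ ihX ihY
  | symm τ τ' X _ ih => exact Quantizes.symm _ _ _ ih
  | phase τ τ' X c hc _ ih => exact Quantizes.phase _ _ _ _ hc ih

theorem Quantizes.pow {X : L2 N →L[ℂ] L2 N} (h : Quantizes b τ (τ.rotateTop 1) X) (n : ℕ) :
    Quantizes b τ (τ.rotateTop n) (X ^ n) := by
  induction n with
  | zero =>
    rw [Nat.cast_zero, DecTriangulation.rotateTop_zero, pow_zero]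
    exact Quantizes.refl τ
  | succ n ih =>
    have hstep := h.rotateTop n
    rw [DecTriangulation.rotateTop_rotateTop, add_comm, ← Nat.cast_succ] at hstep
    rw [pow_succ]
    exact Quantizes.trans _ _ _ _ _ ih hstep

end Quantization

end QuantumLiouville

end

open QuantumLiouville in
theorem mainTheorem1 (N : ℕ) [NeZero N] (hN : 1 < N) (b : ℂ) (hb : b.re ≠ 0)
    (hb' : b.im = 0 ∨ ‖b‖ = 1) :
    -- the fractional Dehn twist operator and the Dehn twist operator
    (fracDehnOp N b ∈ unitary (L2 N →L[ℂ] L2 N) ∧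
      Quantizes b (stdTriangulation N) ((stdTriangulation N).rotateTop 1) (fracDehnOp N b) ∧
      Quantizes b (stdTriangulation N) ((stdTriangulation N).rotateTop N) (dehnOp N b)) ∧
    ∃ κ : ObsAlgebra N →ₐ[ℂ] Module.End ℂ (Core N),
      -- the realization of the observable algebra
      (∀ j : ZMod (2 * N),
        κ (f j) = if Even j.val then p j + p (j - 1) else q j + q (j - 1)) ∧
      (∀ j : ZMod (2 * N), IsSelfAdjoint (closedOp (κ (f j)))) ∧
      kappaG N b ∈ unitary (L2 N →L[ℂ] L2 N) ∧
      (∀ (j : ZMod (2 * N)) (ψ χ : L2 N),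
        (ψ, χ) ∈ (closedOp (κ (f j))).graph ↔
          (kappaG N b ψ, (-1 : ℂ) ^ j.val • kappaG N b χ) ∈
            (closedOp (κ (f (j - 1)))).graph) ∧
      -- the light-cone evolution operator
      evolEven b κ (kappaG N b) = Ring.inverse (fracDehnOp N b) ∧
      evolOdd b κ (kappaG N b) = Ring.inverse (fracDehnOp N b) ∧
      evolEven b κ (kappaG N b) ^ N = Ring.inverse (dehnOp N b) := by
  have hκ := realization_f hN
  have hodd := evolOdd_eq_inverse hb' hκ
  have heven := (evolEven_eq_evolOdd hb' hκ).trans hodd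
  have hD := Quantizes.fracDehnOp (N := N) hb'
  refine ⟨⟨fracDehnOp_mem_unitary hb', hD, hD.pow N⟩, realization hN, hκ, fun j => ?_,
    kappaG_mem_unitary hb', fun j ψ χ => ?_, heven, hodd, ?_⟩
  · rw [hκ]
    exact isSelfAdjoint_closedOp_obsOp j
  · rw [hκ, hκ]
    exact mem_graph_closedOp_obsOp_iff b j ψ χ
  · rw [heven, dehnOp, Ring.inverse_pow]
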